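/- Let $d\ge 2$. Let $X_S$ be a homogeneous Poisson point process on $\mathbb R^d$ with intensity $\lambda_S\in(0,\infty)$, and let $E$ and $V$ be the sets of edges (1-facets, called streets) and vertices (0-facets, called crossroads) of its Voronoi tessellation. Let $\Lambda(dx)=\nu_1\big(\bigcup_{e\in E}e\cap dx\big)$ be the edge length measure, where $\nu_1$ is the one-dimensional Hausdorff measure, and let $\bar l\in(0,\infty)$ be the mean length of the typical street. Given parameters $p\in[0,1]$, $U\ge 0$, $H\ge 0$, put $\lambda=U/\bar l$ and $r=\bar l/H\in(0,\infty]$ (with $r=\infty$ if $H=0$). Conditionally on the tessellation, let $X^\lambda$ (users) be a Poisson point process with mean measure $\lambda\Lambda$ and let $Y$ (relays) contain each crossroad independently with probability $p$, with $X^\lambda$ and $Y$ conditionally independent. Let $\mathcal G_{p,U,H}$ be the graph whose vertices are the points of $X^\lambda\cup Y$, two distinct points $z,z'$ being adjacent if and only if some street $e\in E$ contains both of them and $\|z-z'\|\le r$. Let $P(p,U,H)$ be the probability that $\mathcal G_{p,U,H}$ percolates, i.e. has an infinite connected component; by scaling it does not depend on $\lambda_S$. Theorem (existence of super-critical intensities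 of users). For every $H\in[0,\infty)$ there are $p_0\in(0,1)$ and $U_0\in[0,\infty)$, depending only on $d$ and $H$, such that $P(p,U,H)>0$ for all $p\in(p_0,1)$ and all $U\in[U_0,\infty)$, whatever the value of $\lambda_S\in(0,\infty)$. In particular the threshold $p_0$ does not depend on $U$ and the threshold $U_0$ does not depend on $p$. -/

import Mathlib

open MeasureTheory ProbabilityTheory Set
open scoped ENNReal NNReal

noncomputable section

namespace LineOfSight

/-- The state space `ℝ^d`, with its Euclidean metric. -/
abbrev Space (d : ℕ) : Type := EuclideanSpace ℝ (Fin d)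

/-! ### Point configurations and point process laws -/

/-- A locally finite (simple) point configuration in `ℝ^d`. -/
@[ext]
structure Config (d : ℕ) where
  /-- the points of the configuration -/
  carrier : Set (Space d)
  /-- every ball contains only finitely many points -/
  finite_inter_closedBall : ∀ R : ℝ, (carrier ∩ Metric.closedBall 0 R).Finite

/-- The number of points of a configuration in a set `B`. -/
def Config.count {d : ℕ} (B : Set (Space d)) (η : Config d) : ℕ∞ := (η.carrier ∩ B).encard

/-- The evaluation `σ`-algebra: the smallest one for which all the counting maps
`η ↦ #(η ∩ B)`, `B` Borel, are measurable. -/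
instance (d : ℕ) : MeasurableSpace (Config d) :=
  ⨆ B : {B : Set (Space d) // MeasurableSet B},
    MeasurableSpace.comap (Config.count (B : Set (Space d))) inferInstance

/-- `Q` is the law of a Poisson point process with mean measure `m`: the number of points in a Borel
set `B` of finite mean measure is Poisson distributed with mean `m B`, and the numbers of points
in pairwise disjoint Borel sets are independent. -/
structure IsPoissonLaw {d : ℕ} (m : Measure (Space d)) (Q : Measure (Config d)) : Prop where
  isProbabilityMeasure : IsProbabilityMeasure Q
  count_law : ∀ B : Set (Space d), MeasurableSet B → m B ≠ ∞ → ∀ k : ℕ,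
    Q {η | Config.count B η = k} =
      ENNReal.ofReal (Real.exp (-(m B).toReal) * (m B).toReal ^ k / (k.factorial : ℝ))
  indep : ∀ B : ℕ → Set (Space d), (∀ i, MeasurableSet (B i)) →
    Pairwise (fun i j => Disjoint (B i) (B j)) →
    iIndepFun (fun i => Config.count (B i)) Q

/-- `Q` is the law of a Bernoulli point process on the set `V` with parameter `p`: all points belong
to `V`, and the points of `V` are retained independently of each other, each with
probability `p`. -/
structure IsBernoulliLaw {d : ℕ} (V : Set (Space d)) (p : ℝ) (Q : Measure (Config d)) : Prop where
  isProbabilityMeasure : IsProbabilityMeasure Q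
  subset : ∀ᵐ η ∂Q, η.carrier ⊆ V
  prob_mem : ∀ v ∈ V, Q {η | v ∈ η.carrier} = ENNReal.ofReal p
  indep : iIndepSet (fun v : V => {η : Config d | (v : Space d) ∈ η.carrier}) Q

/-! ### The Voronoi tessellation -/

/-- The closed Voronoi cell of `y` with respect to the configuration `η`. -/
def cell {d : ℕ} (η : Config d) (y : Space d) : Set (Space d) :=
  {x | ∀ z ∈ η.carrier, dist x y ≤ dist x z}

/-- The `k`-facets of the Voronoi tessellation of `η`: the nonempty intersections of Voronoi cells
whose affine hull has dimension `k`. (The tessellation is face-to-face, so the intersections of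
cells are exactly the faces of cells.) -/
def facets {d : ℕ} (k : ℕ) (η : Config d) : Set (Set (Space d)) :=
  {F | F.Nonempty ∧ Module.finrank ℝ (vectorSpan ℝ F) = k ∧
    ∃ σ : Set (Space d), σ ⊆ η.carrier ∧ σ.Nonempty ∧ F = ⋂ y ∈ σ, cell η y}

/-- The streets: the edges (`1`-facets) of the Voronoi tessellation. -/
def streets {d : ℕ} (η : Config d) : Set (Set (Space d)) := facets 1 η

/-- The crossroads: the vertices (`0`-facets) of the Voronoi tessellation. -/
def crossroads {d : ℕ} (η : Config d) : Set (Space d) := {v | {v} ∈ facets 0 η}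

/-- The street length measure `Λ`: one-dimensional Hausdorff measure on the union of all streets. -/
def streetMeasure {d : ℕ} (η : Config d) : Measure (Space d) :=
  (Measure.hausdorffMeasure 1).restrict (⋃₀ streets η)

/-! ### The mean length of the typical street -/

/-- The (bounded) streets whose midpoint lies in the window `W`. -/
def streetsAt {d : ℕ} (W : Set (Space d)) (η : Config d) : Set (Set (Space d)) :=
  {e | e ∈ streets η ∧ ∃ a b : Space d, e = segment ℝ a b ∧ midpoint ℝ a b ∈ W}

/-- The cube `[0, a]^d`. -/
def cube (d : ℕ) (a : ℝ) : Set (Space d) := {x | ∀ i, 0 ≤ x i ∧ x i ≤ a}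

/-- The mean length of the typical street, when `Q` is the law of a stationary point process with
intensity `lamS`: the expected total length of the streets with midpoint in a window, divided by
the expected number of such streets. By stationarity every window of positive finite volume
gives the same value; the window here is the cube of volume `1 / lamS`. -/
def meanStreetLength {d : ℕ} (lamS : ℝ) (Q : Measure (Config d)) : ℝ≥0∞ :=
  (∫⁻ η, ∑' e : streetsAt (cube d (lamS ^ (-(1 / (d : ℝ))))) η,
      (Measure.hausdorffMeasure 1 : Measure (Space d)) (e : Set (Space d)) ∂Q) /
    (∫⁻ η, ((streetsAt (cube d (lamS ^ (-(1 / (d : ℝ))))) η).encard : ℝ≥0∞) ∂Q)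

/-! ### The connectivity graph -/

/-- The connectivity graph: its vertices are the points of `X ∪ Y` (users and relays); two distinct
points are adjacent iff they lie on a common street of the Voronoi tessellation of `S` and are
at distance at most `r` (where `r = ∞` is allowed). -/
def connectivityGraph {d : ℕ} (r : ℝ≥0∞) (S X Y : Config d) :
    SimpleGraph (X.carrier ∪ Y.carrier : Set (Space d)) where
  Adj z w := z ≠ w ∧ (∃ e ∈ streets S, (z : Space d) ∈ e ∧ (w : Space d) ∈ e) ∧
    edist (z : Space d) (w : Space d) ≤ r
  symm := ⟨fun _ _ h => ⟨h.1.symm, h.2.1.imp fun _ he => ⟨he.1, he.2.2, he.2.1⟩,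
    by rw [edist_comm]; exact h.2.2⟩⟩
  loopless := ⟨fun _ h => h.1 rfl⟩

/-- A graph percolates if it has an infinite connected component. -/
def Percolates {V : Type*} (G : SimpleGraph V) : Prop :=
  ∃ c : G.ConnectedComponent, c.supp.Infinite

/-! ### The random model -/

/-- The random configurations `XS` (nuclei), `X` (users), `Y` (relays) follow the model with
parameters `lamS`, `lam`, `p`: `XS` is a homogeneous Poisson point process of intensity `lamS`
and, conditionally on `XS`, the processes `X` and `Y` are independent, `X` is a Poisson point
process with mean measure `lam • Λ` and `Y` is a Bernoulli point process of parameter `p` on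
the crossroads. -/
structure IsModel {d : ℕ} {Ω : Type*} [MeasurableSpace Ω] (P : Measure Ω)
    (lamS : ℝ) (lam : ℝ≥0∞) (p : ℝ) (XS X Y : Ω → Config d) : Prop where
  measurable_nuclei : Measurable XS
  measurable_users : Measurable X
  measurable_relays : Measurable Y
  nuclei_law : IsPoissonLaw (ENNReal.ofReal lamS • (volume : Measure (Space d))) (P.map XS)
  conditional_law : ∃ κX κY : Kernel (Config d) (Config d),
    IsMarkovKernel κX ∧ IsMarkovKernel κY ∧
    (∀ᵐ η ∂(P.map XS), IsPoissonLaw (lam • streetMeasure η) (κX η)) ∧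
    (∀ᵐ η ∂(P.map XS), IsBernoulliLaw (crossroads η) p (κY η)) ∧
    P.map (fun ω => (XS ω, X ω, Y ω)) = (P.map XS).compProd (κX.prod κY)

end LineOfSight

end

noncomputable section
namespace LineOfSight

/-! ### Nearest nuclei -/

/-- The nuclei of `η` that are closest to `x`. -/
def nearest {d : ℕ} (η : Config d) (x : Space d) : Set (Space d) :=
  {y | y ∈ η.carrier ∧ x ∈ cell η y}

/-- The intersection of the cells of the nuclei of `σ`. -/
def face {d : ℕ} (η : Config d) (σ : Set (Space d)) : Set (Space d) := ⋂ y ∈ σ, cell η y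

variable {d : ℕ} {η : Config d}

theorem mem_face {σ : Set (Space d)} {x : Space d} : x ∈ face η σ ↔ ∀ y ∈ σ, x ∈ cell η y := by
  simp [face]

theorem Config.finite_inter_of_isBounded (η : Config d) {B : Set (Space d)}
    (hB : Bornology.IsBounded B) : (η.carrier ∩ B).Finite := by
  obtain ⟨R, hR⟩ := hB.subset_closedBall 0
  exact (η.finite_inter_closedBall R).subset (inter_subset_inter_right _ hR)

theorem Config.countable (η : Config d) : η.carrier.Countable := by
  have h : η.carrier = ⋃ n : ℕ, η.carrier ∩ Metric.closedBall 0 n := by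
    rw [← inter_iUnion, Metric.iUnion_closedBall_nat, inter_univ]
  rw [h]
  exact countable_iUnion fun n => (η.finite_inter_closedBall n).countable

theorem dist_eq_of_mem_nearest {x y z : Space d} (hy : y ∈ nearest η x) (hz : z ∈ nearest η x) :
    dist x y = dist x z :=
  le_antisymm (hy.2 z hz.1) (hz.2 y hy.1)

theorem mem_nearest_of_dist_le {x y z : Space d} (hy : y ∈ nearest η x) (hz : z ∈ η.carrier)
    (h : dist x z ≤ dist x y) : z ∈ nearest η x :=
  ⟨hz, fun w hw => h.trans (hy.2 w hw)⟩

theorem nearest_nonempty (hη : η.carrier.Nonempty) (x : Space d) : (nearest η x).Nonempty := by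
  obtain ⟨y₀, hy₀⟩ := hη
  have hfin : (η.carrier ∩ Metric.closedBall x (dist x y₀)).Finite :=
    η.finite_inter_of_isBounded Metric.isBounded_closedBall
  obtain ⟨y, hy, hmin⟩ := hfin.exists_minimalFor (fun y => dist x y) _
    ⟨y₀, hy₀, by simp [dist_comm]⟩
  refine ⟨y, hy.1, fun z hz => ?_⟩
  by_contra! hlt
  have hzy : z ∈ η.carrier ∩ Metric.closedBall x (dist x y₀) :=
    ⟨hz, by have := hy.2; simp only [Metric.mem_closedBall] at this ⊢; rw [dist_comm] at this ⊢; linarith⟩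
  exact absurd (hmin hzy hlt.le) (not_le.2 hlt)

theorem nearest_subset_closedBall {x y : Space d} (hy : y ∈ η.carrier) :
    nearest η x ⊆ Metric.closedBall x (dist x y) := fun z hz => by
  rw [Metric.mem_closedBall, dist_comm]
  exact hz.2 y hy

theorem nearest_finite (x : Space d) : (nearest η x).Finite := by
  rcases (nearest η x).eq_empty_or_nonempty with h | ⟨y, hy⟩
  · rw [h]; exact finite_empty
  · exact (η.finite_inter_of_isBounded Metric.isBounded_closedBall).subset
      fun z hz => ⟨hz.1, nearest_subset_closedBall hy.1 hz⟩

/-- Near `q`, all nearest nuclei are nearest nuclei of `q`. -/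
theorem exists_forall_nearest_subset (q : Space d) :
    ∃ ε > 0, ∀ x ∈ Metric.ball q ε, nearest η x ⊆ nearest η q := by
  rcases η.carrier.eq_empty_or_nonempty with h | hη
  · exact ⟨1, one_pos, fun x _ y hy => by have := hy.1; simp [h] at this⟩
  obtain ⟨y₀, hy₀⟩ := nearest_nonempty hη q
  set ρ := dist q y₀ with hρ
  have hfin : ((η.carrier ∩ Metric.closedBall q (ρ + 2)) \ nearest η q).Finite :=
    (η.finite_inter_of_isBounded Metric.isBounded_closedBall).subset sdiff_subset
  have key : ∃ δ > 0, ∀ z ∈ (η.carrier ∩ Metric.closedBall q (ρ + 2)) \ nearest η q,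
      ρ + δ ≤ dist q z := by
    rcases ((η.carrier ∩ Metric.closedBall q (ρ + 2)) \ nearest η q).eq_empty_or_nonempty
      with h | hne
    · exact ⟨1, one_pos, by simp [h]⟩
    obtain ⟨z, hz, hmin⟩ := hfin.exists_minimalFor (fun y => dist q y) _ hne
    refine ⟨dist q z - ρ, ?_, fun w hw => ?_⟩
    · by_contra! hle
      exact hz.2 (mem_nearest_of_dist_le hy₀ hz.1.1 (by linarith))
    · have : dist q z ≤ dist q w := by
        rcases le_total (dist q z) (dist q w) with h | h
        · exact h
        · exact hmin hw h
      linarith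
  obtain ⟨δ, hδ, hsep⟩ := key
  refine ⟨min (δ / 2) 1, lt_min (half_pos hδ) one_pos, fun x hx y hy => ?_⟩
  rw [Metric.mem_ball] at hx
  have hx1 : dist x q < δ / 2 := hx.trans_le (min_le_left _ _)
  have hx2 : dist x q < 1 := hx.trans_le (min_le_right _ _)
  have h1 : dist x y ≤ dist x y₀ := hy.2 y₀ hy₀.1
  have h2 : dist x y₀ ≤ dist x q + ρ := dist_triangle _ _ _
  have h3 : dist q y ≤ dist q x + dist x y := dist_triangle _ _ _
  rw [dist_comm q x] at h3
  by_contra hn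
  have := hsep y ⟨⟨hy.1, by rw [Metric.mem_closedBall, dist_comm]; linarith⟩, hn⟩
  linarith

theorem dist_sq_add (q v y : Space d) :
    dist (q + v) y ^ 2 = dist q y ^ 2 + 2 * inner ℝ v (q - y) + ‖v‖ ^ 2 := by
  rw [dist_eq_norm, dist_eq_norm, show q + v - y = (q - y) + v by abel, norm_add_sq_real,
    real_inner_comm]

theorem inner_eq_zero_of_equidistant {x q y z : Space d} (hq : dist q y = dist q z)
    (hx : dist x y = dist x z) : inner ℝ (x - q) (y - z) = 0 := by
  have h1 := dist_sq_add q (x - q) y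
  have h2 := dist_sq_add q (x - q) z
  rw [add_sub_cancel, hx] at h1
  rw [add_sub_cancel] at h2
  rw [hq] at h1
  have h3 : inner ℝ (x - q) (y - z) = inner ℝ (x - q) (q - z) - inner ℝ (x - q) (q - y) := by
    rw [← inner_sub_right]; congr 1; abel
  rw [h3]; linarith

theorem equidistant_of_inner_eq_zero {x q y z : Space d} (hq : dist q y = dist q z)
    (h : inner ℝ (x - q) (y - z) = 0) : dist x y = dist x z := by
  have h1 := dist_sq_add q (x - q) y
  have h2 := dist_sq_add q (x - q) z
  rw [add_sub_cancel] at h1 h2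
  have h3 : inner ℝ (x - q) (y - z) = inner ℝ (x - q) (q - z) - inner ℝ (x - q) (q - y) := by
    rw [← inner_sub_right]; congr 1; abel
  have h4 : dist x y ^ 2 = dist x z ^ 2 := by rw [h1, h2, hq]; linarith
  exact (pow_left_inj₀ dist_nonneg dist_nonneg two_ne_zero).1 h4

/-- A vector orthogonal to a set of differences generating `vectorSpan` is orthogonal to it. -/
theorem mem_orthogonal_vectorSpan {σ : Set (Space d)} {v y₀ : Space d} (hy₀ : y₀ ∈ σ)
    (h : ∀ y ∈ σ, inner ℝ v (y - y₀) = 0) : v ∈ (vectorSpan ℝ σ)ᗮ := by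
  rw [vectorSpan_eq_span_vsub_set_right ℝ hy₀, Submodule.mem_orthogonal']
  intro u hu
  induction hu using Submodule.span_induction with
  | mem x hx => obtain ⟨y, hy, rfl⟩ := hx; exact h y hy
  | zero => simp
  | add x y _ _ hx hy => rw [inner_add_right, hx, hy, add_zero]
  | smul a x _ hx => rw [inner_smul_right, hx, mul_zero]

theorem inner_eq_zero_of_mem_orthogonal {σ : Set (Space d)} {v y z : Space d}
    (hv : v ∈ (vectorSpan ℝ σ)ᗮ) (hy : y ∈ σ) (hz : z ∈ σ) : inner ℝ v (y - z) = 0 :=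
  (Submodule.mem_orthogonal' _ _).1 hv _ (vsub_mem_vectorSpan ℝ hy hz)

theorem sub_mem_orthogonal {σ : Set (Space d)} (hσ : σ.Nonempty) {x q : Space d}
    (hx : σ ⊆ nearest η x) (hq : σ ⊆ nearest η q) : x - q ∈ (vectorSpan ℝ σ)ᗮ := by
  obtain ⟨y₀, hy₀⟩ := hσ
  exact mem_orthogonal_vectorSpan hy₀ fun y hy => inner_eq_zero_of_equidistant
    (dist_eq_of_mem_nearest (hq hy) (hq hy₀)) (dist_eq_of_mem_nearest (hx hy) (hx hy₀))

theorem subset_nearest_iff {σ : Set (Space d)} (hσ : σ ⊆ η.carrier) {x : Space d} :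
    σ ⊆ nearest η x ↔ x ∈ face η σ := by
  rw [mem_face]
  exact ⟨fun h y hy => (h hy).2, fun h y hy => ⟨hσ hy, h y hy⟩⟩

theorem nearest_subset_carrier (x : Space d) : nearest η x ⊆ η.carrier := fun _ h => h.1

theorem mem_face_nearest (x : Space d) : x ∈ face η (nearest η x) :=
  (subset_nearest_iff (nearest_subset_carrier x)).1 le_rfl

theorem face_anti {σ τ : Set (Space d)} (h : σ ⊆ τ) : face η τ ⊆ face η σ :=
  fun _ hx => mem_face.2 fun y hy => mem_face.1 hx y (h hy)

theorem face_nearest_subset {σ : Set (Space d)} (hσ : σ ⊆ η.carrier) {x : Space d}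
    (hx : x ∈ face η σ) : face η (nearest η x) ⊆ face η σ :=
  face_anti ((subset_nearest_iff hσ).2 hx)

/-- Moving orthogonally to the nearest nuclei by a small amount does not change them. -/
theorem exists_forall_mem_face_nearest (hη : η.carrier.Nonempty) (q : Space d) :
    ∃ ε > 0, ∀ v ∈ (vectorSpan ℝ (nearest η q))ᗮ, ‖v‖ < ε → q + v ∈ face η (nearest η q) := by
  obtain ⟨ε, hε, h⟩ := exists_forall_nearest_subset (η := η) q
  refine ⟨ε, hε, fun v hv hvε => ?_⟩
  obtain ⟨y₀, hy₀⟩ := nearest_nonempty hη (q + v)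
  have hsub := h (q + v) (by simpa [Metric.mem_ball, dist_eq_norm] using hvε)
  refine (subset_nearest_iff (nearest_subset_carrier q)).1 fun y hy => ?_
  refine mem_nearest_of_dist_le hy₀ hy.1 (le_of_eq ?_)
  refine equidistant_of_inner_eq_zero (q := q) (dist_eq_of_mem_nearest hy (hsub hy₀)) ?_
  rw [add_sub_cancel_left]
  exact inner_eq_zero_of_mem_orthogonal hv hy (hsub hy₀)

theorem vectorSpan_face_nearest (hη : η.carrier.Nonempty) (q : Space d) :
    vectorSpan ℝ (face η (nearest η q)) = (vectorSpan ℝ (nearest η q))ᗮ := by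
  apply le_antisymm
  · rw [vectorSpan_eq_span_vsub_set_right ℝ (mem_face_nearest q), Submodule.span_le]
    rintro _ ⟨x, hx, rfl⟩
    exact sub_mem_orthogonal (nearest_nonempty hη q)
      ((subset_nearest_iff (nearest_subset_carrier q)).2 hx) le_rfl
  · intro v hv
    obtain ⟨ε, hε, h⟩ := exists_forall_mem_face_nearest hη q
    rcases eq_or_ne v 0 with rfl | hv0
    · exact Submodule.zero_mem _
    have hpos : 0 < ‖v‖ := norm_pos_iff.2 hv0
    set c : ℝ := ε / (2 * ‖v‖) with hc
    have hcpos : 0 < c := by positivity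
    have hmem : q + c • v ∈ face η (nearest η q) := by
      refine h _ (Submodule.smul_mem _ _ hv) ?_
      rw [norm_smul, Real.norm_of_nonneg hcpos.le, hc]
      field_simp
      linarith
    have h2 := vsub_mem_vectorSpan ℝ hmem (mem_face_nearest q)
    rw [vsub_eq_sub, add_sub_cancel_left] at h2
    have := Submodule.smul_mem _ c⁻¹ h2
    rwa [smul_smul, inv_mul_cancel₀ hcpos.ne', one_smul] at this

/-- The points whose nearest nuclei span at least dimension `k`. -/
def skeleton (η : Config d) (k : ℕ) : Set (Space d) :=
  {x | k ≤ Module.finrank ℝ (vectorSpan ℝ (nearest η x))}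

theorem finrank_face_nearest (hη : η.carrier.Nonempty) (q : Space d) :
    Module.finrank ℝ (vectorSpan ℝ (nearest η q)) +
      Module.finrank ℝ (vectorSpan ℝ (face η (nearest η q))) = d := by
  rw [vectorSpan_face_nearest hη, Submodule.finrank_add_finrank_orthogonal]
  simp

theorem convex_cell {y : Space d} : Convex ℝ (cell η y) := by
  have : cell η y = ⋂ z ∈ η.carrier, {x | inner ℝ (z - y) x ≤ (‖z‖ ^ 2 - ‖y‖ ^ 2) / 2} := by
    ext x
    simp only [cell, mem_ofPred_eq, mem_iInter]
    refine forall₂_congr fun z _ => ?_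
    rw [← pow_le_pow_iff_left₀ dist_nonneg dist_nonneg two_ne_zero, dist_eq_norm, dist_eq_norm,
      norm_sub_sq_real, norm_sub_sq_real, inner_sub_left, real_inner_comm x z, real_inner_comm x y]
    constructor <;> intro h <;> linarith
  rw [this]
  exact convex_iInter₂ fun z _ => convex_halfSpace_le (innerₛₗ ℝ (z - y)).isLinear _

theorem isClosed_cell {y : Space d} : IsClosed (cell η y) := by
  have : cell η y = ⋂ z ∈ η.carrier, {x | dist x y ≤ dist x z} := by ext; simp [cell]
  rw [this]
  exact isClosed_biInter fun z _ => isClosed_le (by fun_prop) (by fun_prop)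

theorem convex_face (σ : Set (Space d)) : Convex ℝ (face η σ) :=
  convex_iInter₂ fun _ _ => convex_cell

theorem isClosed_face (σ : Set (Space d)) : IsClosed (face η σ) :=
  isClosed_biInter fun _ _ => isClosed_cell

/-- If an interior point of a segment with end points in a face has additional nearest nuclei, they
are nearest to the end points as well. -/
theorem mem_face_nearest_of_mem_openSegment {σ : Set (Space d)} (hσ : σ ⊆ η.carrier)
    (hne : σ.Nonempty) {p q x : Space d} (hp : p ∈ face η σ) (hq : q ∈ face η σ)
    (hx : x ∈ openSegment ℝ p q) : p ∈ face η (nearest η x) := by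
  obtain ⟨y₀, hy₀⟩ := hne
  have hxσ : x ∈ face η σ := (convex_face σ).openSegment_subset hp hq hx
  have hy₀x : y₀ ∈ nearest η x := (subset_nearest_iff hσ).2 hxσ hy₀
  have hy₀p : y₀ ∈ nearest η p := (subset_nearest_iff hσ).2 hp hy₀
  have hy₀q : y₀ ∈ nearest η q := (subset_nearest_iff hσ).2 hq hy₀
  refine (subset_nearest_iff (nearest_subset_carrier x)).1 fun y hy => ?_
  refine mem_nearest_of_dist_le hy₀p hy.1 ?_
  obtain ⟨a, b, ha, hb, hab, rfl⟩ := hx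
  have e1 := dist_eq_of_mem_nearest hy hy₀x
  have h1 := hy₀q.2 y hy.1
  rw [← pow_le_pow_iff_left₀ dist_nonneg dist_nonneg two_ne_zero] at h1 ⊢
  have e2 : dist (a • p + b • q) y ^ 2 = dist (a • p + b • q) y₀ ^ 2 := by rw [e1]
  simp only [dist_eq_norm, norm_sub_sq_real, inner_add_left, inner_smul_left,
    RCLike.conj_to_real] at e2 h1 ⊢
  have h3 : a * (‖p‖ ^ 2 - 2 * inner ℝ p y + ‖y‖ ^ 2 - (‖p‖ ^ 2 - 2 * inner ℝ p y₀ + ‖y₀‖ ^ 2)) +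
    b * (‖q‖ ^ 2 - 2 * inner ℝ q y + ‖y‖ ^ 2 - (‖q‖ ^ 2 - 2 * inner ℝ q y₀ + ‖y₀‖ ^ 2)) = 0 := by
    have : b = 1 - a := by linarith
    subst this
    linarith
  by_contra! hlt
  nlinarith [mul_nonneg hb.le (sub_nonneg.2 h1), mul_pos ha (sub_pos.2 hlt)]

theorem crossroads_eq_skeleton (hd : 0 < d) : crossroads η = skeleton η d := by
  ext v
  constructor
  · rintro ⟨-, h0, σ, hσ, hne, hv⟩
    have hη : η.carrier.Nonempty := hne.mono hσ
    have hvσ : v ∈ face η σ := by rw [face, ← hv]; rfl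
    have h1 : face η (nearest η v) ⊆ {v} := by
      rw [hv]; exact face_nearest_subset hσ hvσ
    have h2 : face η (nearest η v) = {v} := subset_antisymm h1 (by simpa using mem_face_nearest v)
    have := finrank_face_nearest hη v
    rw [h2, vectorSpan_singleton, finrank_bot] at this
    exact this.ge
  · intro h
    have hη : (nearest η v).Nonempty := by
      by_contra hn
      rw [not_nonempty_iff_eq_empty] at hn
      have h' : d ≤ Module.finrank ℝ (vectorSpan ℝ (nearest η v)) := h
      rw [hn, vectorSpan_empty, finrank_bot] at h'
      omega
    have h1 := finrank_face_nearest (hη.mono (nearest_subset_carrier v)) v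
    have h2 : Module.finrank ℝ (vectorSpan ℝ (face η (nearest η v))) = 0 := by
      have : d ≤ _ := h
      omega
    have h3 : face η (nearest η v) = {v} := by
      rw [Submodule.finrank_eq_zero, vectorSpan_eq_bot_iff_subsingleton] at h2
      exact h2.eq_singleton_of_mem (mem_face_nearest v)
    refine ⟨singleton_nonempty v, by simp, nearest η v, nearest_subset_carrier v, hη, h3.symm⟩

theorem facet_subset_skeleton {F : Set (Space d)} {k : ℕ} (hF : F ∈ facets k η) :
    F ⊆ skeleton η (d - k) := by
  obtain ⟨-, hk, σ, hσ, hne, rfl⟩ := hF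
  intro x hx
  have hsub := face_nearest_subset hσ hx
  have h1 := finrank_face_nearest (hne.mono hσ) x
  have h2 := Submodule.finrank_mono (vectorSpan_mono ℝ hsub)
  simp only [skeleton, mem_ofPred_eq]
  change Module.finrank ℝ (vectorSpan ℝ (face η σ)) = k at hk
  omega

theorem face_eq_singleton_of_mem_crossroads {v : Space d} (hv : v ∈ crossroads η) :
    face η (nearest η v) = {v} := by
  obtain ⟨-, h0, σ, hσ, hne, hv⟩ := hv
  have hvσ : v ∈ face η σ := by rw [face, ← hv]; rfl
  refine subset_antisymm ?_ (by simpa using mem_face_nearest v)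
  rw [hv]; exact face_nearest_subset hσ hvσ

theorem mem_crossroads_of_face_eq {v : Space d} (hη : η.carrier.Nonempty)
    (hv : face η (nearest η v) = {v}) : v ∈ crossroads η :=
  ⟨singleton_nonempty v, by simp, nearest η v, nearest_subset_carrier v,
    nearest_nonempty hη v, hv.symm⟩

/-- An extreme point of a face is a crossroad. -/
theorem mem_crossroads_of_mem_extremePoints {σ : Set (Space d)} (hσ : σ ⊆ η.carrier)
    (hne : σ.Nonempty) {v : Space d} (hv : v ∈ (face η σ).extremePoints ℝ) :
    v ∈ crossroads η := by
  have hη := hne.mono hσ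
  have hsub := face_nearest_subset hσ hv.1
  refine mem_crossroads_of_face_eq hη ?_
  have hbot : vectorSpan ℝ (face η (nearest η v)) = ⊥ := by
    rw [vectorSpan_face_nearest hη, Submodule.eq_bot_iff]
    intro u hu
    by_contra hu0
    have hpos : 0 < ‖u‖ := norm_pos_iff.2 hu0
    obtain ⟨ε, hε, h⟩ := exists_forall_mem_face_nearest hη v
    set c : ℝ := ε / (2 * ‖u‖) with hc
    have hcpos : 0 < c := by positivity
    have hlt : ‖c • u‖ < ε := by
      rw [norm_smul, Real.norm_of_nonneg hcpos.le, hc]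
      field_simp
      linarith
    have h1 := hsub (h _ (Submodule.smul_mem _ c hu) hlt)
    have h2 := hsub (h (-(c • u)) (Submodule.neg_mem _ (Submodule.smul_mem _ c hu))
      (by rwa [norm_neg]))
    have h3 := hv.2 h1 h2 ⟨1 / 2, 1 / 2, by norm_num, by norm_num, by norm_num, by module⟩
    rw [add_eq_left, smul_eq_zero] at h3
    exact h3.elim hcpos.ne' hu0
  rw [vectorSpan_eq_bot_iff_subsingleton] at hbot
  exact hbot.eq_singleton_of_mem (mem_face_nearest v)

theorem exists_mem_crossroads {σ : Set (Space d)} (hσ : σ ⊆ η.carrier)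
    (hne : σ.Nonempty) (hc : IsCompact (face η σ)) (hF : (face η σ).Nonempty) :
    ∃ v ∈ face η σ, v ∈ crossroads η := by
  obtain ⟨v, hv⟩ := hc.extremePoints_nonempty hF
  exact ⟨v, hv.1, mem_crossroads_of_mem_extremePoints hσ hne hv⟩

theorem isClosed_skeleton (k : ℕ) : IsClosed (skeleton η k) := by
  rw [← isOpen_compl_iff, Metric.isOpen_iff]
  intro q hq
  obtain ⟨ε, hε, h⟩ := exists_forall_nearest_subset (η := η) q
  refine ⟨ε, hε, fun x hx hxk => hq ?_⟩
  exact le_trans hxk (Submodule.finrank_mono (vectorSpan_mono ℝ (h x hx)))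

/-- Crossroads are isolated. -/
theorem exists_forall_crossroads_eq (q : Space d) :
    ∃ ε > 0, ∀ x ∈ Metric.ball q ε, x ∈ crossroads η → x = q := by
  obtain ⟨ε, hε, h⟩ := exists_forall_nearest_subset (η := η) q
  refine ⟨ε, hε, fun x hx hxc => ?_⟩
  have h1 : q ∈ face η (nearest η x) :=
    (subset_nearest_iff (nearest_subset_carrier x)).1 (h x hx)
  rw [face_eq_singleton_of_mem_crossroads hxc] at h1
  exact h1.symm

/-- Near a point of the `1`-skeleton which is not a crossroad the skeleton is contained in a line. -/
theorem exists_collinear_skeleton (hd : 0 < d) {q : Space d} (hq : q ∉ crossroads η) :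
    ∃ ε > 0, Collinear ℝ (skeleton η (d - 1) ∩ Metric.ball q ε) := by
  rw [crossroads_eq_skeleton hd] at hq
  by_cases hqs : q ∈ skeleton η (d - 1)
  · obtain ⟨ε, hε, h⟩ := exists_forall_nearest_subset (η := η) q
    refine ⟨ε, hε, ?_⟩
    have hrk : Module.finrank ℝ (vectorSpan ℝ (nearest η q)) = d - 1 := by
      have h1 : d - 1 ≤ _ := hqs
      have h2 : ¬ d ≤ _ := hq
      omega
    have hW : Module.finrank ℝ (vectorSpan ℝ (nearest η q))ᗮ = 1 := by
      have := Submodule.finrank_add_finrank_orthogonal (vectorSpan ℝ (nearest η q))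
      rw [hrk, finrank_euclideanSpace_fin] at this
      omega
    have hmem : q ∈ skeleton η (d - 1) ∩ Metric.ball q ε := ⟨hqs, by simpa using hε⟩
    rw [collinear_iff_finrank_le_one]
    refine le_trans (Submodule.finrank_mono ?_) hW.le
    rw [vectorSpan_eq_span_vsub_set_right ℝ hmem, Submodule.span_le]
    rintro _ ⟨x, ⟨hxs, hxb⟩, rfl⟩
    have hsub := h x hxb
    have heq : vectorSpan ℝ (nearest η x) = vectorSpan ℝ (nearest η q) := by
      refine Submodule.eq_of_le_of_finrank_le (vectorSpan_mono ℝ hsub) ?_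
      rw [hrk]; exact hxs
    rcases (nearest η x).eq_empty_or_nonempty with he | hne
    · rw [← heq, he]; simp
    · have := sub_mem_orthogonal hne le_rfl hsub
      rwa [heq] at this
  · obtain ⟨ε, hε, h⟩ := Metric.isOpen_iff.1 (isClosed_skeleton (η := η) (d - 1)).isOpen_compl q hqs
    refine ⟨ε, hε, ?_⟩
    have : skeleton η (d - 1) ∩ Metric.ball q ε = ∅ := by
      ext x
      simp only [mem_inter_iff, mem_empty_iff_false, iff_false, not_and]
      exact fun hx hb => h hb hx
    rw [this]
    exact collinear_empty ℝ _

end LineOfSight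
end

noncomputable section
namespace LineOfSight

/-- If finitely many closed sets meet a preconnected set and cover it, then a property that passes
from each of them to those intersecting it inside the preconnected set, and holds for one of
them, holds for all. -/
theorem forall_of_isPreconnected_of_cover {E ι : Type*} [TopologicalSpace E] [Finite ι]
    {K : Set E} (hK : IsPreconnected K) {C : ι → Set E} (hC : ∀ i, IsClosed (C i))
    (hcov : K ⊆ ⋃ i, C i) (hmeet : ∀ i, (K ∩ C i).Nonempty) {p : ι → Prop} {i₀ : ι} (h₀ : p i₀)
    (hp : ∀ i j, p i → (K ∩ (C i ∩ C j)).Nonempty → p j) (i : ι) : p i := by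
  classical
  by_contra hi
  have hU : IsClosed (⋃ j : {j // p j}, C j) := isClosed_iUnion_of_finite fun j => hC j
  have hW : IsClosed (⋃ j : {j // ¬ p j}, C j) := isClosed_iUnion_of_finite fun j => hC j
  obtain ⟨x, hxK, hxU, hxW⟩ := isPreconnected_closed_iff.1 hK _ _ hU hW
    (fun x hx => by
      obtain ⟨j, hj⟩ := mem_iUnion.1 (hcov hx)
      by_cases h : p j
      · exact Or.inl (mem_iUnion.2 ⟨⟨j, h⟩, hj⟩)
      · exact Or.inr (mem_iUnion.2 ⟨⟨j, h⟩, hj⟩))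
    ((hmeet i₀).mono fun x hx => ⟨hx.1, mem_iUnion.2 ⟨⟨i₀, h₀⟩, hx.2⟩⟩)
    ((hmeet i).mono fun x hx => ⟨hx.1, mem_iUnion.2 ⟨⟨i, hi⟩, hx.2⟩⟩)
  obtain ⟨⟨j, hj⟩, hxj⟩ := mem_iUnion.1 hxU
  obtain ⟨⟨k, hk⟩, hxk⟩ := mem_iUnion.1 hxW
  exact hk (hp j k hj ⟨x, hxK, hxj, hxk⟩)

/-- In dimension at least two, the frontier of a compact convex neighbourhood of the origin is
connected. -/
theorem isPreconnected_frontier_of_convex {W : Type*} [NormedAddCommGroup W] [NormedSpace ℝ W]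
    (hW : 1 < Module.rank ℝ W) {s : Set W} (hs : Convex ℝ s) (h0 : s ∈ nhds 0)
    (hb : Bornology.IsBounded s) : IsPreconnected (frontier s) := by
  have habs : Absorbent ℝ s := absorbent_nhds_zero h0
  have hpos : ∀ x : W, x ≠ 0 → 0 < gauge s x := fun x hx =>
    (gauge_pos habs (NormedSpace.isVonNBounded_iff ℝ |>.2 hb)).2 hx
  have : frontier s = (fun x => (gauge s x)⁻¹ • x) '' {0}ᶜ := by
    ext x
    rw [← gauge_eq_one_iff_mem_frontier hs h0]
    constructor
    · intro hx
      refine ⟨x, ?_, by simp [hx]⟩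
      rintro rfl
      simp at hx
    · rintro ⟨y, hy, rfl⟩
      have := hpos y hy
      simp only
      rw [gauge_smul_of_nonneg (inv_nonneg.2 this.le), smul_eq_mul, inv_mul_cancel₀ this.ne']
  rw [this]
  refine (isConnected_compl_singleton_of_one_lt_rank hW 0).isPreconnected.image _ ?_
  exact ((continuous_gauge hs h0).continuousOn.inv₀ fun x hx => (hpos x hx).ne').smul
    continuousOn_id

variable {d : ℕ} {η : Config d}

theorem finite_nearest_of_isBounded {B : Set (Space d)} (hB : Bornology.IsBounded B)
    (hη : η.carrier.Nonempty) : {τ | ∃ x ∈ B, nearest η x = τ}.Finite := by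
  obtain ⟨y, hy⟩ := hη
  obtain ⟨R, hR⟩ := hB.subset_closedBall y
  refine ((η.finite_inter_of_isBounded
    (Metric.isBounded_closedBall (x := y) (r := R + R))).finite_subsets).subset ?_
  rintro _ ⟨x, hx, rfl⟩ z hz
  refine ⟨hz.1, ?_⟩
  have h1 := hR hx
  have h2 := nearest_subset_closedBall hy hz
  rw [Metric.mem_closedBall] at *
  linarith [dist_triangle z x y]

/-- Any two crossroads of a compact face are connected through the streets contained in it. -/
theorem rel_of_mem_face {Rel : Space d → Space d → Prop} (hrefl : ∀ v, Rel v v)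
    (htrans : ∀ u v w, Rel u v → Rel v w → Rel u w) {F₀ : Set (Space d)}
    (hstreet : ∀ e ∈ streets η, e ⊆ F₀ → ∀ v ∈ e, ∀ w ∈ e, v ∈ crossroads η → w ∈ crossroads η →
      Rel v w) (k : ℕ) :
    ∀ σ : Set (Space d), σ ⊆ η.carrier → σ.Nonempty → IsCompact (face η σ) → face η σ ⊆ F₀ →
      Module.finrank ℝ (vectorSpan ℝ (face η σ)) = k → ∀ v ∈ face η σ, ∀ w ∈ face η σ,
        v ∈ crossroads η → w ∈ crossroads η → Rel v w := by
  induction k using Nat.strong_induction_on with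
  | _ k ih =>
  intro σ hσ hne hcpt hF₀ hk v hv w hw hvc hwc
  have hη := hne.mono hσ
  rcases Nat.lt_or_ge k 2 with hk2 | hk2
  · interval_cases k
    · rw [Submodule.finrank_eq_zero, vectorSpan_eq_bot_iff_subsingleton] at hk
      rw [hk hv hw]
      exact hrefl w
    · exact hstreet _ ⟨⟨v, hv⟩, hk, σ, hσ, hne, rfl⟩ hF₀ v hv w hw hvc hwc
  set F := face η σ with hF
  set W := vectorSpan ℝ F with hW
  -- a point with a neighbourhood in the face
  set f : W →ᵃ[ℝ] Space d := W.subtype.toAffineMap + AffineMap.const ℝ W v with hf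
  have hfx : ∀ x : W, f x = x + v := fun x => rfl
  have hfcont : Continuous f := by
    have : (f : W → Space d) = fun x : W => (x : Space d) + v := rfl
    rw [this]; fun_prop
  set S : Set W := f ⁻¹' F with hS
  have hSconv : Convex ℝ S := (convex_face σ).affine_preimage f
  have hspan : affineSpan ℝ S = ⊤ := by
    have h0 : (0 : W) ∈ S := by
      change f 0 ∈ F
      rw [hfx]; simpa using hv
    rw [AffineSubspace.affineSpan_eq_top_iff_vectorSpan_eq_top_of_nonempty ℝ W W ⟨0, h0⟩,
      vectorSpan_eq_span_vsub_set_right ℝ h0]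
    have : (fun x : W => x -ᵥ (0 : W)) '' S = S := by simp
    rw [this, ← Submodule.map_injective_of_injective W.injective_subtype |>.eq_iff,
      Submodule.map_span, Submodule.map_top, Submodule.range_subtype]
    conv_rhs => rw [hW, vectorSpan_eq_span_vsub_set_right ℝ hv]
    congr 1
    ext x
    constructor
    · rintro ⟨y, hy, rfl⟩
      exact ⟨f y, hy, by simp [hfx]⟩
    · rintro ⟨y, hy, rfl⟩
      refine ⟨⟨y -ᵥ v, vsub_mem_vectorSpan ℝ hy hv⟩, ?_, rfl⟩
      change f _ ∈ F
      rw [hfx]; simpa using hy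
  obtain ⟨c, hc⟩ := (hSconv.interior_nonempty_iff_affineSpan_eq_top).2 hspan
  set x₀ : Space d := f c with hx₀
  set T : Set W := {w | x₀ + w ∈ F} with hT
  have hTS : T = (fun w => c + w) ⁻¹' S := by
    ext w
    simp only [hT, hS, mem_ofPred_eq, mem_preimage, hfx, hx₀, Submodule.coe_add]
    rw [show (c : Space d) + v + w = c + w + v by abel]
  have hTconv : Convex ℝ T := by
    rw [hTS]; exact hSconv.translate_preimage_right c
  have hT0 : T ∈ nhds (0 : W) := by
    rw [hTS]
    refine (continuous_const.add continuous_id).continuousAt.preimage_mem_nhds ?_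
    simpa using mem_interior_iff_mem_nhds.1 hc
  have hTb : Bornology.IsBounded T := by
    obtain ⟨R, hR⟩ := hcpt.isBounded.subset_closedBall x₀
    refine (Metric.isBounded_closedBall (x := (0 : W)) (r := R)).subset fun w hw => ?_
    have := hR hw
    simpa [Metric.mem_closedBall, dist_eq_norm] using this
  have hTcl : IsClosed T := (isClosed_face σ).preimage (by fun_prop : Continuous fun w : W => x₀ + (w : Space d))
  have hrank : 1 < Module.rank ℝ W := by
    rw [← Module.finrank_eq_rank, hk]; exact_mod_cast hk2
  have hconn := isPreconnected_frontier_of_convex hrank hTconv hT0 hTb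
  -- the frontier is covered by faces of smaller dimension
  have hlow : ∀ x ∈ frontier T,
      Module.finrank ℝ (vectorSpan ℝ (face η (nearest η (x₀ + x)))) < k := by
    intro x hx
    have hxT : x₀ + (x : Space d) ∈ F := hTcl.frontier_subset hx
    have hsub := face_nearest_subset hσ hxT
    by_contra! hle
    have heq : vectorSpan ℝ (face η (nearest η (x₀ + x))) = W :=
      Submodule.eq_of_le_of_finrank_le (vectorSpan_mono ℝ hsub) (by rw [hk]; exact hle)
    obtain ⟨ε, hε, h⟩ := exists_forall_mem_face_nearest hη (x₀ + (x : Space d))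
    refine hx.2 (mem_interior_iff_mem_nhds.2 (Metric.mem_nhds_iff.2 ⟨ε, hε, fun y hy => ?_⟩))
    have h1 := h (y - x : W) (by
      rw [← vectorSpan_face_nearest hη, heq]; exact Submodule.coe_mem _)
      (by rw [Metric.mem_ball, dist_eq_norm] at hy; exact hy)
    have h2 := hsub h1
    change x₀ + (y : Space d) ∈ F
    rwa [Submodule.coe_sub, add_assoc, add_sub_cancel] at h2
  have hcross : ∀ u ∈ F, u ∈ crossroads η → ∃ x ∈ frontier T, x₀ + (x : Space d) = u := by
    intro u hu huc
    have hx₀F : x₀ ∈ F := by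
      have := mem_of_mem_nhds hT0
      simpa [hT] using this
    set x : W := ⟨u -ᵥ x₀, vsub_mem_vectorSpan ℝ hu hx₀F⟩ with hx
    have hxu : x₀ + (x : Space d) = u := by simp [hx]
    refine ⟨x, ⟨subset_closure (show x₀ + (x : Space d) ∈ F by rwa [hxu]), fun hint => ?_⟩, hxu⟩
    obtain ⟨ε, hε, hball⟩ := Metric.mem_nhds_iff.1 (mem_interior_iff_mem_nhds.1 hint)
    have : Nontrivial W := Module.nontrivial_of_finrank_pos (R := ℝ) (by omega)
    obtain ⟨y, hy⟩ := exists_ne (0 : W)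
    have hpos : 0 < ‖y‖ := norm_pos_iff.2 hy
    set a : ℝ := ε / (2 * ‖y‖) with ha
    have hapos : 0 < a := by positivity
    have hlt : ‖a • y‖ < ε := by
      rw [norm_smul, Real.norm_of_nonneg hapos.le, ha]
      field_simp
      linarith
    have h1 : u + ((a • y : W) : Space d) ∈ F := by
      have : x₀ + ((x + a • y : W) : Space d) ∈ F := hball (by
        rwa [Metric.mem_ball, dist_eq_norm, add_sub_cancel_left])
      rwa [Submodule.coe_add, ← add_assoc, hxu] at this
    have h2 : u + ((-(a • y) : W) : Space d) ∈ F := by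
      have : x₀ + ((x + -(a • y) : W) : Space d) ∈ F := hball (by
        rwa [Metric.mem_ball, dist_eq_norm, add_sub_cancel_left, norm_neg])
      rwa [Submodule.coe_add, ← add_assoc, hxu] at this
    have h3 := mem_face_nearest_of_mem_openSegment hσ hne h1 h2 (x := u)
      ⟨1 / 2, 1 / 2, by norm_num, by norm_num, by norm_num, by
        rw [Submodule.coe_neg]; module⟩
    rw [face_eq_singleton_of_mem_crossroads huc, mem_singleton_iff, add_eq_left,
      Submodule.coe_eq_zero, smul_eq_zero] at h3
    exact h3.elim hapos.ne' hy
  -- chain of faces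
  have hfin : {τ | ∃ x ∈ F, nearest η x = τ}.Finite :=
    finite_nearest_of_isBounded hcpt.isBounded hη
  set ι : Type := {τ : Set (Space d) // ∃ x ∈ frontier T, nearest η (x₀ + (x : Space d)) = τ}
  have : Finite ι := by
    refine (hfin.subset ?_).to_subtype
    rintro _ ⟨x, hx, rfl⟩
    exact ⟨x₀ + x, hTcl.frontier_subset hx, rfl⟩
  have hιF : ∀ i : ι, face η i.1 ⊆ F := by
    rintro ⟨_, x, hx, rfl⟩
    exact face_nearest_subset hσ (hTcl.frontier_subset hx)
  have hιη : ∀ i : ι, i.1 ⊆ η.carrier := by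
    rintro ⟨_, x, hx, rfl⟩
    exact nearest_subset_carrier _
  have hιne : ∀ i : ι, i.1.Nonempty := by
    rintro ⟨_, x, hx, rfl⟩
    exact nearest_nonempty hη _
  obtain ⟨xv, hxv, hxv'⟩ := hcross v hv hvc
  obtain ⟨xw, hxw, hxw'⟩ := hcross w hw hwc
  have main := forall_of_isPreconnected_of_cover hconn
    (C := fun i : ι => {y : W | x₀ + (y : Space d) ∈ face η i.1})
    (fun i => (isClosed_face _).preimage (by fun_prop))
    (fun x hx => mem_iUnion.2 ⟨⟨_, x, hx, rfl⟩, mem_face_nearest _⟩)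
    (by
      rintro ⟨_, x, hx, rfl⟩
      exact ⟨x, hx, mem_face_nearest _⟩)
    (p := fun i => ∀ u ∈ face η i.1, u ∈ crossroads η → Rel v u)
    (i₀ := ⟨nearest η v, xv, hxv, by rw [hxv']⟩)
    (fun u hu _ => by
      rw [face_eq_singleton_of_mem_crossroads hvc, mem_singleton_iff] at hu
      rw [hu]; exact hrefl v)
    (by
      rintro i j hi ⟨x, -, hxi, hxj⟩ u hu huc
      have hun : face η (i.1 ∪ j.1) = face η i.1 ∩ face η j.1 := by
        simp only [face]; exact biInter_union _ _ _
      obtain ⟨t, ht, htc⟩ := exists_mem_crossroads (σ := i.1 ∪ j.1)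
        (union_subset (hιη i) (hιη j)) ((hιne i).mono subset_union_left)
        (hcpt.of_isClosed_subset (isClosed_face _)
          (by rw [hun]; exact inter_subset_left.trans (hιF i)))
        ⟨x₀ + x, by rw [hun]; exact ⟨hxi, hxj⟩⟩
      rw [hun] at ht
      refine htrans _ _ _ (hi t ht.1 htc) ?_
      have hlt : Module.finrank ℝ (vectorSpan ℝ (face η j.1)) < k := by
        obtain ⟨_, x, hx, rfl⟩ := j
        exact hlow x hx
      exact ih _ hlt j.1 (hιη j) (hιne j)
        (hcpt.of_isClosed_subset (isClosed_face _) (hιF j)) ((hιF j).trans hF₀) rfl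
        t ht.2 u hu htc huc)
  exact main ⟨nearest η w, xw, hxw, by rw [hxw']⟩ w (mem_face_nearest w) hwc

end LineOfSight
end

noncomputable section
namespace LineOfSight

variable {d : ℕ} {η : Config d}

theorem face_singleton (y : Space d) : face η {y} = cell η y := by simp [face]

theorem self_mem_cell (y : Space d) : y ∈ cell η y := fun z _ => by simp

/-- Every point of the ball of centre `c` and radius `R` has a nucleus within distance `b`. -/
def Covers (η : Config d) (c : Space d) (R b : ℝ) : Prop :=
  ∀ x ∈ Metric.closedBall c R, ∃ y ∈ η.carrier, dist x y ≤ b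

theorem Covers.dist_le {c : Space d} {R b : ℝ} (h : Covers η c R b) {x y : Space d}
    (hx : x ∈ Metric.closedBall c R) (hy : x ∈ cell η y) : dist x y ≤ b := by
  obtain ⟨z, hz, hxz⟩ := h x hx
  exact (hy z hz).trans hxz

theorem Covers.carrier_nonempty {c : Space d} {R b : ℝ} (h : Covers η c R b) (hR : 0 ≤ R) :
    η.carrier.Nonempty := by
  obtain ⟨y, hy, -⟩ := h c (by simpa using hR)
  exact ⟨y, hy⟩

theorem Covers.cell_subset {c : Space d} {R b t : ℝ} (h : Covers η c R b) (ht : t + 2 * b < R)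
    (hb : 0 ≤ b) {x y : Space d} (hx : x ∈ Metric.closedBall c t) (hxy : x ∈ cell η y) :
    cell η y ⊆ Metric.closedBall y b := by
  have hxb := h.dist_le (Metric.closedBall_subset_closedBall (by linarith) hx) hxy
  intro z hz
  rw [Metric.mem_closedBall] at hx ⊢
  by_contra! hlt
  set δ := R - (t + 2 * b) with hδ
  have hδ0 : 0 < δ := by rw [hδ]; linarith
  set l := min (dist z y) (b + δ) with hl
  have hlb : b < l := lt_min hlt (by linarith)
  have hl1 : l ≤ dist z y := min_le_left _ _
  have hl2 : l ≤ b + δ := min_le_right _ _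
  have hzy : 0 < dist z y := by linarith
  have hwcell : AffineMap.lineMap y z (l / dist z y) ∈ cell η y :=
    convex_cell.lineMap_mem (self_mem_cell y) hz ⟨by positivity, by rw [div_le_one hzy]; exact hl1⟩
  have hwd : dist (AffineMap.lineMap y z (l / dist z y)) y = l := by
    rw [dist_lineMap_left, Real.norm_of_nonneg (by positivity), dist_comm y z]
    field_simp
  have := h.dist_le (x := AffineMap.lineMap y z (l / dist z y)) (by
    rw [Metric.mem_closedBall]
    have h1 := dist_triangle (AffineMap.lineMap y z (l / dist z y)) y c
    have h2 := dist_triangle y x c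
    rw [dist_comm y x] at h2
    linarith) hwcell
  linarith

theorem Covers.cell_subset_closedBall {c : Space d} {R b t : ℝ} (h : Covers η c R b)
    (ht : t + 2 * b < R) (hb : 0 ≤ b) {x y : Space d} (hx : x ∈ Metric.closedBall c t)
    (hxy : x ∈ cell η y) : cell η y ⊆ Metric.closedBall c (t + 2 * b) := by
  intro z hz
  have h1 := h.cell_subset ht hb hx hxy hz
  have h2 := h.dist_le (Metric.closedBall_subset_closedBall (by linarith) hx) hxy
  rw [Metric.mem_closedBall] at *
  have h3 := dist_triangle z y c
  have h4 := dist_triangle y x c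
  rw [dist_comm y x] at h4
  linarith

theorem Covers.isCompact_face {c : Space d} {R b t : ℝ} (h : Covers η c R b)
    (ht : t + 2 * b < R) (hb : 0 ≤ b) {x : Space d} (hx : x ∈ Metric.closedBall c t) {σ : Set (Space d)}
    (hne : σ.Nonempty) (hxσ : x ∈ face η σ) : IsCompact (face η σ) := by
  obtain ⟨y, hy⟩ := hne
  have : face η σ ⊆ Metric.closedBall y b := fun z hz =>
    h.cell_subset ht hb hx (mem_face.1 hxσ y hy) (mem_face.1 hz y hy)
  exact (isCompact_closedBall y b).of_isClosed_subset (isClosed_face σ) this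

/-- The crossroads of the cells that meet the ball of centre `c` and radius `t`. -/
def hubs (η : Config d) (c : Space d) (t : ℝ) : Set (Space d) :=
  {v | v ∈ crossroads η ∧ ∃ y ∈ η.carrier, v ∈ cell η y ∧
    (Metric.closedBall c t ∩ cell η y).Nonempty}

theorem Covers.hubs_subset {c : Space d} {R b t : ℝ} (h : Covers η c R b)
    (ht : t + 2 * b < R) (hb : 0 ≤ b) : hubs η c t ⊆ Metric.closedBall c (t + 2 * b) := by
  rintro v ⟨-, y, hy, hv, x, hx, hxy⟩
  exact h.cell_subset_closedBall ht hb hx hxy hv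

theorem Covers.exists_mem_hubs {c : Space d} {R b t : ℝ} (h : Covers η c R b)
    (ht : t + 2 * b < R) (hb : 0 ≤ b) {x : Space d} (hx : x ∈ Metric.closedBall c t) :
    ∃ v ∈ hubs η c t, dist v x ≤ 2 * b ∧ ∀ c' t', x ∈ Metric.closedBall c' t' →
      v ∈ hubs η c' t' := by
  have ht0 : 0 ≤ t := dist_nonneg.trans (Metric.mem_closedBall.1 hx)
  obtain ⟨y, hy⟩ := nearest_nonempty (h.carrier_nonempty (by linarith)) x
  have hcpt := h.isCompact_face ht hb hx (singleton_nonempty y) (by rw [face_singleton]; exact hy.2)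
  obtain ⟨v, hv, hvc⟩ := exists_mem_crossroads (singleton_subset_iff.2 hy.1)
    (singleton_nonempty y) hcpt ⟨x, by rw [face_singleton]; exact hy.2⟩
  rw [face_singleton] at hv
  refine ⟨v, ⟨hvc, y, hy.1, hv, x, hx, hy.2⟩, ?_, fun c' t' hx' => ⟨hvc, y, hy.1, hv, x, hx', hy.2⟩⟩
  have h1 := h.cell_subset ht hb hx hy.2 hv
  have h2 := h.dist_le (Metric.closedBall_subset_closedBall (by linarith) hx) hy.2
  rw [Metric.mem_closedBall] at h1
  rw [dist_comm x y] at h2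
  linarith [dist_triangle v y x]

/-- All crossroads of the cells meeting a ball are connected through nearby streets. -/
theorem Covers.rel_of_mem_hubs {c : Space d} {R b t : ℝ} (h : Covers η c R b)
    (ht : t + 2 * b < R) (hb : 0 ≤ b) {Rel : Space d → Space d → Prop}
    (hrefl : ∀ v, Rel v v) (htrans : ∀ u v w, Rel u v → Rel v w → Rel u w)
    (hstreet : ∀ e ∈ streets η, e ⊆ Metric.closedBall c (t + 2 * b) → ∀ v ∈ e, ∀ w ∈ e,
      v ∈ crossroads η → w ∈ crossroads η → Rel v w) {v w : Space d}
    (hv : v ∈ hubs η c t) (hw : w ∈ hubs η c t) : Rel v w := by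
  obtain ⟨hvc, y, hy, hvy, hyt⟩ := hv
  obtain ⟨hwc, z, hz, hwz, hzt⟩ := hw
  set ι : Type := {y : Space d // y ∈ η.carrier ∧ (Metric.closedBall c t ∩ cell η y).Nonempty}
  have ht0 : 0 ≤ t := by
    obtain ⟨x, hx, -⟩ := hyt
    exact dist_nonneg.trans (Metric.mem_closedBall.1 hx)
  have hη := h.carrier_nonempty (by linarith)
  have hcell : ∀ i : ι, ∀ u ∈ cell η i.1, ∀ u' ∈ cell η i.1, u ∈ crossroads η →
      u' ∈ crossroads η → Rel u u' := by
    rintro ⟨y, hy, x, hx, hxy⟩ u hu u' hu' huc hu'c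
    rw [← face_singleton] at hu hu' hxy
    refine rel_of_mem_face hrefl htrans hstreet _ {y} (singleton_subset_iff.2 hy)
      (singleton_nonempty y) (h.isCompact_face ht hb hx (singleton_nonempty y) hxy) ?_ rfl u hu u' hu'
      huc hu'c
    rw [face_singleton] at hxy ⊢
    exact h.cell_subset_closedBall ht hb hx hxy
  have : Finite ι := by
    refine ((η.finite_inter_of_isBounded
      (Metric.isBounded_closedBall (x := c) (r := t + 2 * b))).subset ?_).to_subtype
    rintro u ⟨hu, x, hx, hxu⟩
    exact ⟨hu, h.cell_subset_closedBall ht hb hx hxu (self_mem_cell u)⟩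
  refine forall_of_isPreconnected_of_cover (convex_closedBall c t).isPreconnected
    (C := fun i : ι => cell η i.1) (fun i => isClosed_cell)
    (fun x hx => ?_) (fun i => i.2.2) (p := fun i => ∀ u ∈ cell η i.1, u ∈ crossroads η → Rel v u)
    (i₀ := ⟨y, hy, hyt⟩) (fun u hu huc => hcell ⟨y, hy, hyt⟩ v hvy u hu hvc huc)
    ?_ ⟨z, hz, hzt⟩ w hwz hwc
  · obtain ⟨u, hu⟩ := nearest_nonempty hη x
    exact mem_iUnion.2 ⟨⟨u, hu.1, x, hx, hu.2⟩, hu.2⟩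
  · rintro i j hi ⟨x, hxt, hxi, hxj⟩ u hu huc
    have hmem : x ∈ face η {i.1, j.1} := by
      rw [mem_face]
      rintro _ (rfl | rfl)
      exacts [hxi, hxj]
    obtain ⟨q, hq, hqc⟩ := exists_mem_crossroads (σ := {i.1, j.1})
      (by rintro _ (rfl | rfl); exacts [i.2.1, j.2.1]) ⟨i.1, by simp⟩
      (h.isCompact_face ht hb hxt ⟨i.1, by simp⟩ hmem) ⟨x, hmem⟩
    rw [mem_face] at hq
    exact htrans _ _ _ (hi q (hq _ (by simp)) hqc) (hcell j q (hq _ (by simp)) u hu hqc huc)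

/-- Every nonempty face is an intersection of at most `d + 1` cells. -/
theorem exists_face_eq_range {σ : Set (Space d)} (hσ : σ ⊆ η.carrier) (hne : σ.Nonempty)
    (hF : (face η σ).Nonempty) :
    ∃ f : Fin (d + 1) → Space d, range f ⊆ σ ∧ face η σ = face η (range f) := by
  obtain ⟨t, htσ, hspan, hind⟩ := exists_affineIndependent ℝ (Space d) σ
  have htne : t.Nonempty := by
    rw [← affineSpan_nonempty ℝ, hspan, affineSpan_nonempty]; exact hne
  obtain ⟨x₀, hx₀⟩ := hF
  have hx₀σ := (subset_nearest_iff hσ).2 hx₀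
  have htfin : t.Finite := (nearest_finite x₀).subset (htσ.trans hx₀σ)
  have : Fintype t := htfin.fintype
  have hcard : Fintype.card t ≤ d + 1 := by
    have := hind.card_le_finrank_succ
    refine this.trans (Nat.add_le_add_right ?_ 1)
    refine (Submodule.finrank_le _).trans ?_
    simp
  have hface : face η σ = face η t := by
    refine subset_antisymm (face_anti htσ) fun x hx => ?_
    have htx := (subset_nearest_iff (htσ.trans hσ)).2 hx
    have horth := sub_mem_orthogonal htne htx (htσ.trans hx₀σ)
    have hvs : vectorSpan ℝ t = vectorSpan ℝ σ := by
      rw [← direction_affineSpan, hspan, direction_affineSpan]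
    rw [hvs] at horth
    obtain ⟨y₀, hy₀⟩ := htne
    refine (subset_nearest_iff hσ).1 fun y hy => mem_nearest_of_dist_le (htx hy₀) (hσ hy) ?_
    exact (equidistant_of_inner_eq_zero (dist_eq_of_mem_nearest (hx₀σ hy) (hx₀σ (htσ hy₀)))
      (inner_eq_zero_of_mem_orthogonal horth hy (htσ hy₀))).le
  obtain ⟨g, hg⟩ : ∃ g : t → Fin (d + 1), Function.Injective g := by
    have e := Fintype.equivFin t
    exact ⟨fun x => Fin.castLE hcard (e x), (Fin.castLE_injective hcard).comp e.injective⟩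
  have : Nonempty t := htne.to_subtype
  have hrange : range (fun i => ((Function.invFun g i : t) : Space d)) = t := by
    ext x
    constructor
    · rintro ⟨i, rfl⟩; exact Subtype.coe_prop _
    · intro hx
      refine ⟨g ⟨x, hx⟩, ?_⟩
      change ((Function.invFun g (g ⟨x, hx⟩) : t) : Space d) = x
      rw [Function.leftInverse_invFun hg]
  exact ⟨_, by rw [hrange]; exact htσ, by rw [hrange]; exact hface⟩

theorem countable_streets : (streets η).Countable := by
  have : Countable η.carrier := η.countable.to_subtype
  refine (countable_range fun f : Fin (d + 1) → η.carrier =>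
    face η (range fun i => (f i : Space d))).mono ?_
  rintro F ⟨hF, -, σ, hσ, hne, rfl⟩
  obtain ⟨f, hf, heq⟩ := exists_face_eq_range hσ hne hF
  exact ⟨fun i => ⟨f i, hσ (hf ⟨i, rfl⟩)⟩, heq.symm⟩

/-- The number of streets meeting a ball is bounded in terms of the number of nuclei nearby. -/
theorem Covers.encard_streets_le {c : Space d} {R b t : ℝ} (h : Covers η c R b) (ht : t ≤ R)
    {n : ℕ} (hn : Config.count (Metric.closedBall c (t + b)) η ≤ n) :
    {e | e ∈ streets η ∧ (Metric.closedBall c t ∩ e).Nonempty}.encard ≤ (n ^ (d + 1) : ℕ) := by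
  set A := η.carrier ∩ Metric.closedBall c (t + b) with hA
  have hAfin : A.Finite := η.finite_inter_of_isBounded Metric.isBounded_closedBall
  have : Fintype A := hAfin.fintype
  have hsub : {e | e ∈ streets η ∧ (Metric.closedBall c t ∩ e).Nonempty} ⊆
      range fun f : Fin (d + 1) → A => face η (range fun i => (f i : Space d)) := by
    rintro F ⟨⟨hF, -, σ, hσ, hne, rfl⟩, x, hx, hxF⟩
    obtain ⟨f, hf, heq⟩ := exists_face_eq_range hσ hne hF
    refine ⟨fun i => ⟨f i, hσ (hf ⟨i, rfl⟩), ?_⟩, heq.symm⟩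
    have h1 := h.dist_le (Metric.closedBall_subset_closedBall ht hx)
      (mem_face.1 hxF _ (hf ⟨i, rfl⟩))
    rw [Metric.mem_closedBall] at *
    rw [dist_comm] at h1
    linarith [dist_triangle (f i) x c]
  have hcard : Fintype.card A ≤ n := by
    have : A.encard ≤ n := hn
    rw [← hAfin.cast_ncard_eq, Nat.cast_le, ← Nat.card_coe_set_eq, Nat.card_eq_fintype_card] at this
    exact this
  refine (encard_le_encard hsub).trans ?_
  rw [← image_univ]
  refine (encard_image_le _ _).trans ?_
  rw [encard_univ, ENat.card_eq_coe_fintype_card, Nat.cast_le, Fintype.card_fun, Fintype.card_fin]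
  exact Nat.pow_le_pow_left hcard _

/-- A compact convex set of dimension one is a segment. -/
theorem exists_eq_segment {e : Set (Space d)} (hc : IsCompact e) (hconv : Convex ℝ e)
    (h1 : Module.finrank ℝ (vectorSpan ℝ e) = 1) : ∃ v w, v ≠ w ∧ e = segment ℝ v w := by
  have hne : e.Nonempty := by
    by_contra hn
    rw [not_nonempty_iff_eq_empty] at hn
    rw [hn, vectorSpan_empty, finrank_bot] at h1
    exact zero_ne_one h1
  obtain ⟨v, hv, w, hw, hmax'⟩ : ∃ v ∈ e, ∃ w ∈ e, ∀ x ∈ e, ∀ y ∈ e, dist x y ≤ dist v w := by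
    have hcont : ContinuousOn (fun p : Space d × Space d => dist p.1 p.2) (e ×ˢ e) := by fun_prop
    obtain ⟨p, hp, hmax⟩ := (hc.prod hc).exists_isMaxOn (hne.prod hne) hcont
    exact ⟨p.1, hp.1, p.2, hp.2, fun x hx y hy => isMaxOn_iff.1 hmax (x, y) (mk_mem_prod hx hy)⟩
  have hvw : v ≠ w := by
    rintro rfl
    have : e.Subsingleton := fun x hx y hy => by
      have := hmax' x hx y hy
      rw [dist_self] at this
      exact dist_le_zero.1 this
    rw [← vectorSpan_eq_bot_iff_subsingleton ℝ (V := Space d)] at this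
    rw [this, finrank_bot] at h1
    exact zero_ne_one h1
  refine ⟨v, w, hvw, subset_antisymm (fun x hx => ?_) (hconv.segment_subset hv hw)⟩
  have hcol : Collinear ℝ {x, v, w} := by
    refine Collinear.subset ?_ (collinear_iff_finrank_le_one.2 h1.le)
    rintro _ (rfl | rfl | rfl) <;> assumption
  rw [← affineSegment_eq_segment]
  rcases hcol.wbtw_or_wbtw_or_wbtw with h | h | h
  · have h2 := h.dist_add_dist
    have h3 := hmax' x hx w hw
    have : x = v := dist_le_zero.1 (by linarith)
    rw [this]; exact left_mem_affineSegment ℝ v w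
  · have h2 := h.dist_add_dist
    have h3 := hmax' v hv x hx
    rw [dist_comm w x] at h2
    have : x = w := dist_le_zero.1 (by linarith)
    rw [this]; exact right_mem_affineSegment ℝ v w
  · exact h.symm

theorem convex_of_mem_facets {k : ℕ} {F : Set (Space d)} (hF : F ∈ facets k η) : Convex ℝ F := by
  obtain ⟨-, -, σ, -, -, rfl⟩ := hF
  exact convex_face σ

theorem isClosed_of_mem_facets {k : ℕ} {F : Set (Space d)} (hF : F ∈ facets k η) :
    IsClosed F := by
  obtain ⟨-, -, σ, -, -, rfl⟩ := hF
  exact isClosed_face σ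

theorem mem_crossroads_of_street_eq_segment {v w : Space d} (h : segment ℝ v w ∈ streets η) :
    v ∈ crossroads η := by
  obtain ⟨-, -, σ, hσ, hne, heq⟩ := h
  refine mem_crossroads_of_mem_extremePoints hσ hne ?_
  change segment ℝ v w = face η σ at heq
  rw [← heq]
  refine ⟨left_mem_segment ℝ v w, ?_⟩
  intro x hx y hy hxy
  rw [← affineSegment_eq_segment] at hx hy
  obtain ⟨s, hs, rfl⟩ := hx
  obtain ⟨t, ht, rfl⟩ := hy
  obtain ⟨a, b, ha, hb, hab, hv⟩ := hxy
  rcases eq_or_ne v w with rfl | hvw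
  · simp
  have hst : (a * s + b * t) • (w - v) = 0 := by
    rw [AffineMap.lineMap_apply_module', AffineMap.lineMap_apply_module'] at hv
    have h2 : a • (s • (w - v) + v) + b • (t • (w - v) + v) =
      (a * s + b * t) • (w - v) + (a + b) • v := by module
    rw [h2, hab, one_smul] at hv
    exact add_eq_right.1 hv
  rw [smul_eq_zero, sub_eq_zero] at hst
  have h0 := hst.resolve_right (Ne.symm hvw)
  have hs0 : s = 0 := by
    have h3 := mul_nonneg ha.le hs.1
    have h4 := mul_nonneg hb.le ht.1
    have : a * s = 0 := by linarith
    exact (mul_eq_zero.1 this).resolve_left ha.ne'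
  simp [hs0]

/-- A compact street is a segment between two crossroads. -/
theorem exists_street_eq_segment {e : Set (Space d)} (he : e ∈ streets η) (hc : IsCompact e) :
    ∃ v w, v ≠ w ∧ e = segment ℝ v w ∧ v ∈ crossroads η ∧ w ∈ crossroads η := by
  obtain ⟨v, w, hvw, rfl⟩ := exists_eq_segment hc (convex_of_mem_facets he) he.2.1
  refine ⟨v, w, hvw, rfl, mem_crossroads_of_street_eq_segment he, ?_⟩
  rw [segment_symm] at he
  exact mem_crossroads_of_street_eq_segment he

end LineOfSight
end

noncomputable section
namespace LineOfSight

variable {d : ℕ}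

/-! ### Measurability of counts -/

theorem measurable_count {B : Set (Space d)} (hB : MeasurableSet B) :
    Measurable (Config.count B) := by
  have h : MeasurableSpace.comap (Config.count B) inferInstance ≤
      (inferInstance : MeasurableSpace (Config d)) :=
    le_iSup (fun B : {B : Set (Space d) // MeasurableSet B} =>
      MeasurableSpace.comap (Config.count (B : Set (Space d))) inferInstance) ⟨B, hB⟩
  exact (comap_measurable _).mono h le_rfl

theorem count_eq_sum {ι : Type*} [Fintype ι] {C : ι → Set (Space d)}
    (hC : Pairwise fun i j => Disjoint (C i) (C j)) (η : Config d) :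
    Config.count (⋃ i, C i) η = ∑ i, Config.count (C i) η := by
  rw [Config.count, inter_iUnion, encard_iUnion_of_finite, finsum_eq_sum_of_fintype]
  · rfl
  · exact fun i j hij => (hC hij).mono inter_subset_right inter_subset_right

theorem count_mono {B C : Set (Space d)} (h : B ⊆ C) (η : Config d) :
    Config.count B η ≤ Config.count C η :=
  encard_le_encard (inter_subset_inter_right _ h)

theorem count_eq_zero {B : Set (Space d)} {η : Config d} :
    Config.count B η = 0 ↔ ∀ x ∈ η.carrier, x ∉ B := by
  rw [Config.count, encard_eq_zero, eq_empty_iff_forall_notMem]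
  simp only [mem_inter_iff, not_and]

theorem count_ne_top {B : Set (Space d)} (hB : Bornology.IsBounded B) (η : Config d) :
    Config.count B η ≠ ⊤ := by
  rw [Config.count, encard_ne_top_iff]
  exact η.finite_inter_of_isBounded hB

theorem count_eq_iSup (B : Set (Space d)) (η : Config d) :
    Config.count B η = ⨆ n : ℕ, Config.count (B ∩ Metric.closedBall 0 n) η := by
  refine le_antisymm ?_ (iSup_le fun n => count_mono inter_subset_left η)
  refine ENat.forall_natCast_le_iff_le.1 fun k hk => ?_
  obtain ⟨s, hs, hsk⟩ := exists_subset_encard_eq hk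
  have hfin : s.Finite := finite_of_encard_eq_coe hsk
  obtain ⟨R, hR⟩ := hfin.isBounded.subset_closedBall (0 : Space d)
  obtain ⟨n, hn⟩ := exists_nat_ge R
  refine le_trans ?_ (le_iSup _ n)
  rw [← hsk]
  exact encard_le_encard fun x hx =>
    ⟨(hs hx).1, (hs hx).2, Metric.closedBall_subset_closedBall hn (hR hx)⟩

/-! ### The `σ`-algebra of a region -/

/-- The `σ`-algebra generated by the counts of bounded Borel subsets of `N`. -/
@[reducible] def regionSigma (N : Set (Space d)) : MeasurableSpace (Config d) :=
  ⨆ B : {B : Set (Space d) // MeasurableSet B ∧ Bornology.IsBounded B ∧ B ⊆ N},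
    MeasurableSpace.comap (Config.count (B : Set (Space d))) inferInstance

theorem regionSigma_le (N : Set (Space d)) :
    regionSigma N ≤ (inferInstance : MeasurableSpace (Config d)) :=
  iSup_le fun B => (measurable_count B.2.1).comap_le

theorem regionSigma_mono {N N' : Set (Space d)} (h : N ⊆ N') :
    regionSigma N ≤ regionSigma N' :=
  iSup_le fun B => le_iSup_of_le (ι := {B : Set (Space d) // MeasurableSet B ∧
    Bornology.IsBounded B ∧ B ⊆ N'}) ⟨B.1, B.2.1, B.2.2.1, B.2.2.2.trans h⟩ le_rfl

theorem measurable_count_regionSigma {N B : Set (Space d)} (hB : MeasurableSet B)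
    (hBN : B ⊆ N) : Measurable[regionSigma N] (Config.count B) := by
  have h : Config.count B = fun η => ⨆ n : ℕ, Config.count (B ∩ Metric.closedBall 0 n) η :=
    funext (count_eq_iSup B)
  have hn : ∀ n : ℕ, Measurable[regionSigma N]
      (Config.count (B ∩ Metric.closedBall (0 : Space d) n)) := fun n => by
    have hle : MeasurableSpace.comap (Config.count (B ∩ Metric.closedBall (0 : Space d) n))
        inferInstance ≤ regionSigma N :=
      le_iSup (fun B : {B : Set (Space d) // MeasurableSet B ∧ Bornology.IsBounded B ∧ B ⊆ N} =>
        MeasurableSpace.comap (Config.count (B : Set (Space d))) inferInstance)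
        ⟨_, hB.inter Metric.isClosed_closedBall.measurableSet,
          Metric.isBounded_closedBall.subset inter_subset_right, inter_subset_left.trans hBN⟩
    exact (comap_measurable _).mono hle le_rfl
  rw [h]
  intro s _
  have hle : ∀ k : ℕ∞, MeasurableSet[regionSigma N]
      {η | (⨆ n : ℕ, Config.count (B ∩ Metric.closedBall (0 : Space d) n) η) ≤ k} := fun k => by
    have : {η : Config d | (⨆ n : ℕ, Config.count (B ∩ Metric.closedBall (0 : Space d) n) η) ≤ k} =
        ⋂ n : ℕ, Config.count (B ∩ Metric.closedBall (0 : Space d) n) ⁻¹' Iic k := by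
      ext η; simp
    rw [this]
    exact MeasurableSet.iInter fun n => hn n trivial
  have hsing : ∀ k : ℕ∞, MeasurableSet[regionSigma N]
      {η | (⨆ n : ℕ, Config.count (B ∩ Metric.closedBall (0 : Space d) n) η) = k} := fun k => by
    have : {η : Config d | (⨆ n : ℕ, Config.count (B ∩ Metric.closedBall (0 : Space d) n) η) = k} =
        {η : Config d | (⨆ n : ℕ, Config.count (B ∩ Metric.closedBall (0 : Space d) n) η) ≤ k} \
          ⋃ j : Iio k,
          {η : Config d | (⨆ n : ℕ, Config.count (B ∩ Metric.closedBall (0 : Space d) n) η) ≤ j} := by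
      ext η
      simp only [mem_ofPred_eq, mem_sdiff, mem_iUnion, not_exists, not_le]
      constructor
      · intro h
        exact ⟨h.le, fun j => h ▸ j.2⟩
      · rintro ⟨h1, h2⟩
        by_contra hne
        exact absurd (h2 ⟨_, lt_of_le_of_ne h1 hne⟩) (lt_irrefl _)
    rw [this]
    exact (hle k).diff (MeasurableSet.iUnion fun j => hle j)
  have hs : (fun η : Config d => ⨆ n : ℕ, Config.count (B ∩ Metric.closedBall (0 : Space d) n) η) ⁻¹' s =
      ⋃ k : s, {η | (⨆ n : ℕ, Config.count (B ∩ Metric.closedBall (0 : Space d) n) η) = k} := by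
    ext η; simp
  rw [hs]
  exact MeasurableSet.iUnion fun k => hsing k

theorem regionSigma_univ :
    regionSigma (univ : Set (Space d)) = (inferInstance : MeasurableSpace (Config d)) :=
  le_antisymm (regionSigma_le _)
    (iSup_le fun B => (measurable_count_regionSigma B.2 (subset_univ _)).comap_le)

/-- The cylinder events over bounded Borel subsets of `N`. -/
def cylinders (N : Set (Space d)) : Set (Set (Config d)) :=
  piiUnionInter (fun B : {B : Set (Space d) // MeasurableSet B ∧ Bornology.IsBounded B ∧ B ⊆ N} =>
    {s | MeasurableSet[MeasurableSpace.comap (Config.count (B : Set (Space d))) inferInstance] s})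
    univ

theorem isPiSystem_cylinders (N : Set (Space d)) : IsPiSystem (cylinders N) :=
  isPiSystem_piiUnionInter _ (fun _ => @MeasurableSpace.isPiSystem_measurableSet _ (_)) _

theorem generateFrom_cylinders (N : Set (Space d)) :
    regionSigma N = MeasurableSpace.generateFrom (cylinders N) := by
  refine Eq.trans ?_ (generateFrom_piiUnionInter_measurableSet
    (fun B : {B : Set (Space d) // MeasurableSet B ∧ Bornology.IsBounded B ∧ B ⊆ N} =>
      MeasurableSpace.comap (Config.count (B : Set (Space d))) inferInstance) univ).symm
  simp [regionSigma]

/-- A cylinder event is an event about the counts of finitely many disjoint sets. -/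
theorem exists_disjoint_of_mem_cylinders {N : Set (Space d)} {E : Set (Config d)}
    (hE : E ∈ cylinders N) : ∃ (ι : Type) (_ : Fintype ι) (C : ι → Set (Space d)),
      (Pairwise fun i j => Disjoint (C i) (C j)) ∧ (∀ i, MeasurableSet (C i)) ∧
      (∀ i, Bornology.IsBounded (C i)) ∧ (∀ i, C i ⊆ N) ∧
      ∃ A : Set (ι → ℕ∞), E = (fun η i => Config.count (C i) η) ⁻¹' A := by
  classical
  obtain ⟨t, -, f, hf, rfl⟩ := hE
  have hf' : ∀ B : t, ∃ A : Set ℕ∞, Config.count (B.1 : Set (Space d)) ⁻¹' A = f B := fun B => by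
    obtain ⟨A, -, hA⟩ := hf B B.2
    exact ⟨A, hA⟩
  choose A hA using hf'
  let e := t.equivFin
  let D : Fin t.card → Set (Space d) := fun i => ((e.symm i).1 : Set (Space d))
  let C : (Fin t.card → Bool) → Set (Space d) := fun g =>
    (⋃ i, D i) ∩ ⋂ i, if g i then D i else (D i)ᶜ
  have hmem : ∀ g x, x ∈ C g ↔ (∃ i, x ∈ D i) ∧ ∀ i, (x ∈ D i ↔ g i = true) := fun g x => by
    simp only [C, mem_inter_iff, mem_iUnion, mem_iInter]
    refine and_congr_right fun _ => forall_congr' fun i => ?_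
    by_cases hg : g i <;> simp [hg]
  have hdisj : Pairwise fun g g' => Disjoint (C g) (C g') := fun g g' hne => by
    refine Set.disjoint_left.2 ?_
    intro x hx hx'
    refine hne (funext fun i => ?_)
    have h1 := ((hmem g x).1 hx).2 i
    have h2 := ((hmem g' x).1 hx').2 i
    rw [h1] at h2
    cases hg : g i <;> cases hg' : g' i <;> simp_all
  have hDm : ∀ i, MeasurableSet (D i) := fun i => (e.symm i).1.2.1
  have hDb : ∀ i, Bornology.IsBounded (D i) := fun i => (e.symm i).1.2.2.1
  have hDN : ∀ i, D i ⊆ N := fun i => (e.symm i).1.2.2.2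
  have hcount : ∀ η : Config d, ∀ i, Config.count (D i) η =
      ∑ g : Fin t.card → Bool, if g i then Config.count (C g) η else 0 := fun η i => by
    have hD : D i = ⋃ g : Fin t.card → Bool, if g i then C g else ∅ := by
      ext x
      simp only [mem_iUnion]
      constructor
      · intro hx
        refine ⟨fun j => decide (x ∈ D j), ?_⟩
        rw [if_pos (by simpa using hx), hmem]
        exact ⟨⟨i, hx⟩, fun j => by simp⟩
      · rintro ⟨g, hg⟩
        by_cases h : g i
        · rw [if_pos h, hmem] at hg
          exact (hg.2 i).2 h
        · rw [if_neg h] at hg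
          exact hg.elim
    rw [hD, count_eq_sum]
    · refine Finset.sum_congr rfl fun g _ => ?_
      by_cases h : g i
      · simp [h]
      · simp [h, Config.count]
    · intro g g' hne
      refine (hdisj hne).mono ?_ ?_ <;> split_ifs <;> simp
  refine ⟨Fin t.card → Bool, inferInstance, C, hdisj, fun g => ?_, fun g => ?_, fun g => ?_,
    {c | ∀ i, (∑ g : Fin t.card → Bool, if g i then c g else 0) ∈ A (e.symm i)}, ?_⟩
  · refine (MeasurableSet.iUnion hDm).inter (MeasurableSet.iInter fun i => ?_)
    split_ifs
    exacts [hDm i, (hDm i).compl]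
  · exact (Bornology.isBounded_iUnion.2 hDb).subset inter_subset_left
  · exact inter_subset_left.trans (iUnion_subset hDN)
  · ext η
    simp only [mem_iInter, mem_preimage, mem_ofPred_eq]
    constructor
    · intro h i
      have := h _ (e.symm i).2
      rw [← hA (e.symm i)] at this
      rw [← hcount]
      exact this
    · intro h B hB
      have := h (e ⟨B, hB⟩)
      rw [← hcount] at this
      have h2 := hA ⟨B, hB⟩
      simp only [D, Equiv.symm_apply_apply] at this
      rw [← h2]
      exact this

/-! ### Poisson laws -/

section Poisson

variable {m : Measure (Space d)} {Q : Measure (Config d)}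

theorem IsPoissonLaw.iIndepFun_count (hQ : IsPoissonLaw m Q) {ι : Type*} [Countable ι]
    {C : ι → Set (Space d)} (hC : Pairwise fun i j => Disjoint (C i) (C j))
    (hm : ∀ i, MeasurableSet (C i)) : iIndepFun (fun i => Config.count (C i)) Q := by
  classical
  obtain ⟨g, hg⟩ := exists_injective_nat ι
  have h := hQ.indep (fun n => ⋃ i : {i // g i = n}, C i) (fun n => MeasurableSet.iUnion fun i => hm i)
    (fun n k hnk => by
      simp only [disjoint_iUnion_left, disjoint_iUnion_right]
      rintro ⟨i, rfl⟩ ⟨j, rfl⟩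
      refine hC fun hij => hnk ?_
      exact congrArg g hij)
  have h2 := h.precomp hg
  have : (fun i => Config.count (⋃ j : {j // g j = g i}, C j)) = fun i => Config.count (C i) := by
    funext i
    congr 1
    ext x
    simp only [mem_iUnion]
    constructor
    · rintro ⟨⟨j, hj⟩, hx⟩
      rwa [← hg hj]
    · intro hx
      exact ⟨⟨i, rfl⟩, hx⟩
  rwa [this] at h2

theorem IsPoissonLaw.indep_regionSigma (hQ : IsPoissonLaw m Q) {N N' : Set (Space d)}
    (hN : Disjoint N N') : Indep (regionSigma N) (regionSigma N') Q := by
  classical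
  have := hQ.isProbabilityMeasure
  refine IndepSets.indep (regionSigma_le N) (regionSigma_le N') (isPiSystem_cylinders N)
    (isPiSystem_cylinders N') (generateFrom_cylinders N) (generateFrom_cylinders N') ?_
  rw [IndepSets_iff]
  intro E E' hE hE'
  obtain ⟨ι, _, C, hCd, hCm, -, hCN, A, rfl⟩ := exists_disjoint_of_mem_cylinders hE
  obtain ⟨ι', _, C', hCd', hCm', -, hCN', A', rfl⟩ := exists_disjoint_of_mem_cylinders hE'
  have hind := hQ.iIndepFun_count (C := Sum.elim C C') (by
    rintro (i | i) (j | j) hij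
    · exact hCd fun h => hij (by rw [h])
    · exact hN.mono (hCN i) (hCN' j)
    · exact hN.symm.mono (hCN' i) (hCN j)
    · exact hCd' fun h => hij (by rw [h])) (by rintro (i | i); exacts [hCm i, hCm' i])
  have h2 := hind.indepFun_finset (Finset.univ.image Sum.inl) (Finset.univ.image Sum.inr) (by
    rw [Finset.disjoint_left]
    intro x hx hx'
    simp only [Finset.mem_image, Finset.mem_univ, true_and] at hx hx'
    obtain ⟨i, rfl⟩ := hx
    obtain ⟨j, hj⟩ := hx'
    cases hj) (fun i => measurable_count (by rcases i with i | i; exacts [hCm i, hCm' i]))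
  have h3 := h2.measure_inter_preimage_eq_mul
    ((fun c i => c ⟨Sum.inl i, by simp⟩) ⁻¹' A) ((fun c i => c ⟨Sum.inr i, by simp⟩) ⁻¹' A')
    (to_countable _).measurableSet (to_countable _).measurableSet
  exact h3

/-- Events about pairwise disjoint regions are independent. -/
theorem IsPoissonLaw.measure_biInter_eq_prod (hQ : IsPoissonLaw m Q) {ι : Type*} (T : Finset ι)
    {N : ι → Set (Space d)} (hN : (T : Set ι).PairwiseDisjoint N) {A : ι → Set (Config d)}
    (hA : ∀ i ∈ T, MeasurableSet[regionSigma (N i)] (A i)) :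
    Q (⋂ i ∈ T, A i) = ∏ i ∈ T, Q (A i) := by
  classical
  have := hQ.isProbabilityMeasure
  induction T using Finset.induction_on with
  | empty => simp
  | insert i T hi ih =>
    rw [Finset.prod_insert hi, Finset.set_biInter_insert]
    have hind := hQ.indep_regionSigma (N := N i) (N' := ⋃ j ∈ T, N j) (by
      rw [disjoint_iUnion₂_right]
      intro j hj
      exact hN (by simp) (by simp [hj]) (fun h => hi (h ▸ hj)))
    rw [(Indep_iff _ _ _).1 hind _ _ (hA i (by simp))
      (T.measurableSet_biInter fun j hj => regionSigma_mono (subset_biUnion_of_mem (u := N) hj) _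
        (hA j (by simp [hj]))), ih (hN.subset (by simp)) fun j hj => hA j (by simp [hj])]

theorem IsPoissonLaw.map_count_eq {Q' : Measure (Config d)} (hQ : IsPoissonLaw m Q)
    (hQ' : IsPoissonLaw m Q') {B : Set (Space d)} (hB : MeasurableSet B)
    (hb : Bornology.IsBounded B) (hfin : m B ≠ ∞) :
    Q.map (Config.count B) = Q'.map (Config.count B) := by
  refine Measure.ext_of_singleton fun k => ?_
  rw [Measure.map_apply (measurable_count hB) trivial,
    Measure.map_apply (measurable_count hB) trivial]
  induction k using ENat.recTopCoe with
  | top =>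
    have : Config.count B ⁻¹' {⊤} = ∅ := by
      ext η; simpa using count_ne_top hb η
    rw [this, measure_empty, measure_empty]
  | coe k =>
    have : Config.count B ⁻¹' {(k : ℕ∞)} = {η | Config.count B η = k} := rfl
    rw [this, hQ.count_law B hB hfin, hQ'.count_law B hB hfin]

/-- The law of a Poisson point process is determined by its mean measure. -/
theorem IsPoissonLaw.unique {Q' : Measure (Config d)} (hQ : IsPoissonLaw m Q)
    (hQ' : IsPoissonLaw m Q') (hfin : ∀ B, Bornology.IsBounded B → m B ≠ ∞) : Q = Q' := by
  have := hQ.isProbabilityMeasure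
  have := hQ'.isProbabilityMeasure
  refine ext_of_generate_finite (cylinders univ)
    (regionSigma_univ.symm.trans (generateFrom_cylinders univ)) (isPiSystem_cylinders univ) ?_
    (by simp)
  intro E hE
  obtain ⟨ι, _, C, hCd, hCm, hCb, -, A, rfl⟩ := exists_disjoint_of_mem_cylinders hE
  have hmeas : Measurable fun η i => Config.count (C i) η :=
    measurable_pi_lambda _ fun i => measurable_count (hCm i)
  have hA : MeasurableSet A := (to_countable A).measurableSet
  rw [← Measure.map_apply hmeas hA, ← Measure.map_apply hmeas hA,
    (hQ.iIndepFun_count hCd hCm).map_fun_eq_pi_map fun i => (measurable_count (hCm i)).aemeasurable,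
    (hQ'.iIndepFun_count hCd hCm).map_fun_eq_pi_map
      fun i => (measurable_count (hCm i)).aemeasurable]
  congr 2
  funext i
  exact hQ.map_count_eq hQ' (hCm i) (hCb i) (hfin _ (hCb i))

theorem IsPoissonLaw.measure_count_eq_zero (hQ : IsPoissonLaw m Q) {B : Set (Space d)}
    (hB : MeasurableSet B) (hfin : m B ≠ ∞) :
    Q {η | Config.count B η = 0} = ENNReal.ofReal (Real.exp (-(m B).toReal)) := by
  simpa using hQ.count_law B hB hfin 0

end Poisson

end LineOfSight
end

noncomputable section
namespace LineOfSight

variable {d : ℕ} {η : Config d}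

/-! ### Measurability of geometric events -/

theorem exists_denseSeq_closedBall {E : Type*} [MetricSpace E] [TopologicalSpace.SeparableSpace E]
    [Nonempty E] {O : Set E} (hO : IsOpen O) {x : E} (hx : x ∈ O) :
    ∃ j m : ℕ, Metric.closedBall (TopologicalSpace.denseSeq E j) (1 / (m + 1)) ⊆ O ∧
      x ∈ Metric.closedBall (TopologicalSpace.denseSeq E j) (1 / (m + 1)) := by
  obtain ⟨ε, hε, hball⟩ := Metric.isOpen_iff.1 hO x hx
  obtain ⟨m, hm⟩ := exists_nat_one_div_lt (half_pos hε)
  obtain ⟨j, hj⟩ := (TopologicalSpace.denseRange_denseSeq E).exists_dist_lt x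
    (Nat.one_div_pos_of_nat (α := ℝ) (n := m))
  refine ⟨j, m, fun y hy => hball ?_, by rw [Metric.mem_closedBall]; exact hj.le⟩
  rw [Metric.mem_closedBall] at hy
  rw [Metric.mem_ball]
  rw [dist_comm] at hj
  linarith [dist_triangle y (TopologicalSpace.denseSeq E j) x]

theorem measurableSet_count_ne_zero {B : Set (Space d)} (hB : MeasurableSet B) :
    MeasurableSet {η : Config d | Config.count B η ≠ 0} :=
  (measurable_count hB) (MeasurableSet.of_discrete (s := {0}ᶜ))

theorem count_ne_zero {B : Set (Space d)} :
    Config.count B η ≠ 0 ↔ ∃ x ∈ η.carrier, x ∈ B := by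
  rw [Ne, count_eq_zero]; push Not; rfl

/-- The event that some point of a compact set has nearest nuclei in each of the given balls. -/
theorem measurableSet_exists_nearest {n : ℕ} {K : Set (Space d)} (hK : IsCompact K)
    (q : Fin (n + 1) → Space d) (r : ℝ) :
    MeasurableSet {η : Config d | ∃ x ∈ K, ∀ i, ∃ y ∈ nearest η x, y ∈ Metric.closedBall (q i) r} := by
  classical
  set D := TopologicalSpace.denseSeq (Space d) with hD
  set A : ℕ → ℕ → Set (Config d) := fun m j => {η | ∀ s : ℚ, Config.count (Metric.ball (D j) s) η ≠ 0 →
    ∀ i, Config.count (Metric.closedBall (D j) (s + 1 / (m + 1)) ∩ Metric.closedBall (q i) r) η ≠ 0}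
    with hA
  have hAm : ∀ m j, MeasurableSet (A m j) := fun m j => by
    have : A m j = ⋂ s : ℚ, ({η | Config.count (Metric.ball (D j) s) η ≠ 0}ᶜ ∪ ⋂ i, {η |
        Config.count (Metric.closedBall (D j) (s + 1 / (m + 1)) ∩
          Metric.closedBall (q i) r) η ≠ 0}) := by
      ext η
      simp only [hA, mem_ofPred_eq, mem_iInter, mem_union, mem_compl_iff]
      exact forall_congr' fun s => imp_iff_not_or
    rw [this]
    refine MeasurableSet.iInter fun s => MeasurableSet.union
      (measurableSet_count_ne_zero Metric.isOpen_ball.measurableSet).compl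
      (MeasurableSet.iInter fun i => measurableSet_count_ne_zero
        (Metric.isClosed_closedBall.inter Metric.isClosed_closedBall).measurableSet)
  have hset : {η : Config d | ∃ x ∈ K, ∀ i, ∃ y ∈ nearest η x, y ∈ Metric.closedBall (q i) r} =
      {η | Config.count univ η ≠ 0} ∩
        ⋂ m : ℕ, ⋃ j : {j // ∃ x ∈ K, dist x (D j) ≤ 1 / (m + 1 : ℝ)}, A m j := by
    ext η
    simp only [mem_ofPred_eq, mem_inter_iff, mem_iInter, mem_iUnion]
    constructor
    · rintro ⟨x, hx, h⟩
      refine ⟨?_, fun m => ?_⟩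
      · obtain ⟨y, hy, -⟩ := h 0
        exact count_ne_zero.2 ⟨y, hy.1, mem_univ y⟩
      · have hpos : (0 : ℝ) < 1 / (m + 1) := Nat.one_div_pos_of_nat
        obtain ⟨j, hj⟩ := (TopologicalSpace.denseRange_denseSeq (Space d)).exists_dist_lt x
          (half_pos hpos)
        refine ⟨⟨j, x, hx, (hj.trans (half_lt_self hpos)).le⟩, fun s hs i => ?_⟩
        obtain ⟨z, hz, hzs⟩ := count_ne_zero.1 hs
        obtain ⟨y, hy, hyi⟩ := h i
        refine count_ne_zero.2 ⟨y, hy.1, ?_, hyi⟩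
        rw [Metric.mem_ball] at hzs
        rw [Metric.mem_closedBall]
        have h1 := hy.2 z hz
        have h2 := dist_triangle y x (D j)
        have h3 := dist_triangle x (D j) z
        rw [dist_comm y x] at h2
        rw [dist_comm (D j) z] at h3
        change dist x (D j) < _ at hj
        change dist z (D j) < _ at hzs
        change dist y (D j) ≤ _
        linarith
    · rintro ⟨hne, h⟩
      choose j hj using h
      choose x hxK hx using fun m => (j m).2
      obtain ⟨x₀, hx₀, φ, hφ, hlim⟩ := hK.tendsto_subseq hxK
      refine ⟨x₀, hx₀, fun i => ?_⟩
      have hη : η.carrier.Nonempty := by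
        obtain ⟨y, hy, -⟩ := count_ne_zero.1 hne
        exact ⟨y, hy⟩
      obtain ⟨z, hz⟩ := nearest_nonempty hη x₀
      by_contra! hcon
      have hfin : (η.carrier ∩ Metric.closedBall (q i) r).Finite :=
        η.finite_inter_of_isBounded Metric.isBounded_closedBall
      have hgap : ∀ y ∈ η.carrier ∩ Metric.closedBall (q i) r, dist x₀ z < dist x₀ y := by
        rintro y ⟨hy, hyi⟩
        by_contra! hle
        exact hcon y (mem_nearest_of_dist_le hz hy hle) hyi
      obtain ⟨δ, hδ, hδ'⟩ : ∃ δ > 0, ∀ y ∈ η.carrier ∩ Metric.closedBall (q i) r,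
          dist x₀ z + δ ≤ dist x₀ y := by
        rcases (η.carrier ∩ Metric.closedBall (q i) r).eq_empty_or_nonempty with he | hne'
        · exact ⟨1, one_pos, by simp [he]⟩
        obtain ⟨y, hy, hmin⟩ := exists_min_image _ (fun y => dist x₀ y) hfin hne'
        exact ⟨dist x₀ y - dist x₀ z, sub_pos.2 (hgap y hy), fun w hw => by
          have := hmin w hw; linarith⟩
      have hev : ∀ᶠ m in Filter.atTop, dist (x (φ m)) x₀ < δ / 8 :=
        (Metric.tendsto_nhds.1 hlim) _ (by positivity)
      have hev2 : ∀ᶠ m in Filter.atTop, 1 / ((φ m : ℝ) + 1) < δ / 8 :=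
        (tendsto_one_div_add_atTop_nhds_zero_nat.comp hφ.tendsto_atTop).eventually_lt_const
          (by positivity)
      obtain ⟨m, hm1, hm2⟩ := (hev.and hev2).exists
      have hm3 := hx (φ m)
      have hA' := hj (φ m)
      set p := D (j (φ m)) with hp
      obtain ⟨s, hs1, hs2⟩ := exists_rat_btwn (show dist z p < dist z p + δ / 8 by linarith)
      have hcount := hA' s (count_ne_zero.2 ⟨z, hz.1, by rw [Metric.mem_ball]; exact hs1⟩) i
      obtain ⟨y, hy, hyp, hyi⟩ := count_ne_zero.1 hcount
      rw [Metric.mem_closedBall] at hyp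
      have h1 := hδ' y ⟨hy, hyi⟩
      have h2 := dist_triangle x₀ p y
      have h3 := dist_triangle z x₀ p
      have h4 := dist_triangle x₀ (x (φ m)) p
      rw [dist_comm p y] at h2
      rw [dist_comm z x₀] at h3
      rw [dist_comm x₀ (x (φ m))] at h4
      change dist y p ≤ _ at hyp
      linarith
  rw [hset]
  exact (measurableSet_count_ne_zero MeasurableSet.univ).inter
    (MeasurableSet.iInter fun m => MeasurableSet.iUnion fun j => hAm m j)

theorem mem_skeleton_iff {k : ℕ} {x : Space d} (hη : η.carrier.Nonempty) :
    x ∈ skeleton η k ↔ ∃ f : Fin (k + 1) → Space d, AffineIndependent ℝ f ∧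
      ∀ i, f i ∈ nearest η x := by
  constructor
  · intro hx
    obtain ⟨t, htσ, hspan, hind⟩ := exists_affineIndependent ℝ (Space d) (nearest η x)
    have : Fintype t := ((nearest_finite x).subset htσ).fintype
    have htne : t.Nonempty := by
      rw [← affineSpan_nonempty ℝ, hspan, affineSpan_nonempty]; exact nearest_nonempty hη x
    have : Nonempty t := htne.to_subtype
    have hvs : vectorSpan ℝ (range ((↑) : t → Space d)) = vectorSpan ℝ (nearest η x) := by
      rw [Subtype.range_coe, ← direction_affineSpan, hspan, direction_affineSpan]
    have hcard : k + 1 ≤ Fintype.card t := by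
      have h1 : Module.finrank ℝ (vectorSpan ℝ (nearest η x)) + 1 = Fintype.card t := by
        rw [← hvs]; exact hind.finrank_vectorSpan_add_one
      have : k ≤ _ := hx
      omega
    let g : Fin (k + 1) ↪ t := (Fin.castLEEmb hcard).trans (Fintype.equivFin t).symm.toEmbedding
    exact ⟨fun i => g i, hind.comp_embedding g, fun i => htσ (g i).2⟩
  · rintro ⟨f, hf, hfx⟩
    have h1 := hf.finrank_vectorSpan (n := k) (by simp)
    change k ≤ _
    rw [← h1]
    exact Submodule.finrank_mono (vectorSpan_mono ℝ (range_subset_iff.2 hfx))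

theorem isOpen_affineIndependent (n : ℕ) :
    IsOpen {f : Fin n → Space d | AffineIndependent ℝ f} :=
  isOpen_setOfPred_affineIndependent

theorem measurableSet_inter_skeleton_nonempty {K : Set (Space d)} (hK : IsCompact K) {k : ℕ} :
    MeasurableSet {η : Config d | η.carrier.Nonempty ∧ (K ∩ skeleton η k).Nonempty} := by
  set D := TopologicalSpace.denseSeq (Fin (k + 1) → Space d) with hD
  have : {η : Config d | η.carrier.Nonempty ∧ (K ∩ skeleton η k).Nonempty} =
      ⋃ j : ℕ, ⋃ m : ℕ, ⋃ _ : Metric.closedBall (D j) (1 / (m + 1)) ⊆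
        {f : Fin (k + 1) → Space d | AffineIndependent ℝ f},
        {η | ∃ x ∈ K, ∀ i, ∃ y ∈ nearest η x, y ∈ Metric.closedBall (D j i) (1 / (m + 1))} := by
    ext η
    simp only [mem_iUnion, mem_ofPred_eq]
    constructor
    · rintro ⟨hη, x, hxK, hx⟩
      obtain ⟨f, hf, hfx⟩ := (mem_skeleton_iff hη).1 hx
      obtain ⟨j, m, hsub, hmem⟩ := exists_denseSeq_closedBall (isOpen_affineIndependent (k + 1)) hf
      refine ⟨j, m, hsub, x, hxK, fun i => ⟨f i, hfx i, ?_⟩⟩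
      rw [Metric.mem_closedBall] at hmem ⊢
      exact (dist_le_pi_dist f _ i).trans hmem
    · rintro ⟨j, m, hsub, x, hxK, h⟩
      choose f hf hfj using h
      have hη : η.carrier.Nonempty := ⟨f 0, (hf 0).1⟩
      refine ⟨hη, x, hxK, (mem_skeleton_iff hη).2 ⟨f, hsub ?_, hf⟩⟩
      rw [Metric.mem_closedBall, dist_pi_le_iff (by positivity)]
      exact hfj
  rw [this]
  exact MeasurableSet.iUnion fun j => MeasurableSet.iUnion fun m => MeasurableSet.iUnion fun _ =>
    measurableSet_exists_nearest hK _ _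

theorem measurableSet_exists_affineIndependent {K : Set (Space d)} (hK : IsCompact K) (n k : ℕ) :
    MeasurableSet {η : Config d | η.carrier.Nonempty ∧ ∃ f : Fin n → Space d,
      AffineIndependent ℝ f ∧ ∀ i, f i ∈ K ∩ skeleton η k} := by
  set D := TopologicalSpace.denseSeq (Fin n → Space d) with hD
  have : {η : Config d | η.carrier.Nonempty ∧ ∃ f : Fin n → Space d,
      AffineIndependent ℝ f ∧ ∀ i, f i ∈ K ∩ skeleton η k} =
      {η | Config.count univ η ≠ 0} ∩ ⋃ j : ℕ, ⋃ m : ℕ,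
        ⋃ _ : Metric.closedBall (D j) (1 / (m + 1)) ⊆
          {f : Fin n → Space d | AffineIndependent ℝ f},
        ⋂ i, {η | η.carrier.Nonempty ∧
          ((K ∩ Metric.closedBall (D j i) (1 / (m + 1))) ∩ skeleton η k).Nonempty} := by
    ext η
    simp only [mem_iUnion, mem_ofPred_eq, mem_inter_iff, mem_iInter, count_ne_zero]
    constructor
    · rintro ⟨hη, f, hf, h⟩
      obtain ⟨j, m, hsub, hmem⟩ := exists_denseSeq_closedBall (isOpen_affineIndependent n) hf
      refine ⟨hη.imp fun y hy => ⟨hy, mem_univ y⟩, j, m, hsub, fun i => ⟨hη, f i, ⟨(h i).1, ?_⟩, (h i).2⟩⟩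
      rw [Metric.mem_closedBall] at hmem ⊢
      exact (dist_le_pi_dist f _ i).trans hmem
    · rintro ⟨⟨y, hy, -⟩, j, m, hsub, h⟩
      choose _ f hf hfj using h
      refine ⟨⟨y, hy⟩, f, hsub ?_, fun i => ⟨(hf i).1, hfj i⟩⟩
      rw [Metric.mem_closedBall, dist_pi_le_iff (by positivity)]
      exact fun i => (hf i).2
  rw [this]
  exact (measurableSet_count_ne_zero MeasurableSet.univ).inter <|
    MeasurableSet.iUnion fun j => MeasurableSet.iUnion fun m => MeasurableSet.iUnion fun _ =>
      MeasurableSet.iInter fun i => measurableSet_inter_skeleton_nonempty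
        (hK.inter_right Metric.isClosed_closedBall)

end LineOfSight
end

noncomputable section
namespace LineOfSight

variable {d : ℕ}

/-! ### Restriction and rescaling of configurations -/

/-- The points of `η` in `N`. -/
def Config.restrict (N : Set (Space d)) (η : Config d) : Config d where
  carrier := η.carrier ∩ N
  finite_inter_closedBall R := (η.finite_inter_closedBall R).subset
    (inter_subset_inter_left _ inter_subset_left)

theorem measurable_to_config {α : Type*} {mα : MeasurableSpace α} {f : α → Config d}
    (h : ∀ B, MeasurableSet B → Measurable fun x => Config.count B (f x)) : Measurable f := by
  refine Measurable.of_comap_le ?_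
  change MeasurableSpace.comap f (⨆ B : {B : Set (Space d) // MeasurableSet B},
    MeasurableSpace.comap (Config.count (B : Set (Space d))) inferInstance) ≤ mα
  rw [MeasurableSpace.comap_iSup]
  refine iSup_le fun B => ?_
  rw [MeasurableSpace.comap_comp]
  exact (h B B.2).comap_le

theorem count_restrict (N B : Set (Space d)) (η : Config d) :
    Config.count B (η.restrict N) = Config.count (B ∩ N) η := by
  rw [Config.count, Config.count, Config.restrict, inter_assoc, inter_comm N B]

theorem measurable_restrict {N : Set (Space d)} (hN : MeasurableSet N) :
    Measurable[regionSigma N] (Config.restrict N) := by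
  refine measurable_to_config fun B hB => ?_
  simp only [count_restrict]
  exact measurable_count_regionSigma (hB.inter hN) inter_subset_right

/-- An event unaffected by removing the points outside `N` belongs to the `σ`-algebra of `N`. -/
theorem measurableSet_regionSigma_of_restrict {N : Set (Space d)} (hN : MeasurableSet N)
    {E : Set (Config d)} (hE : MeasurableSet E) (h : ∀ η, η.restrict N ∈ E ↔ η ∈ E) :
    MeasurableSet[regionSigma N] E := by
  have : E = Config.restrict N ⁻¹' E := by ext η; exact (h η).symm
  rw [this]
  exact measurable_restrict hN hE

theorem nearest_restrict {N : Set (Space d)} {η : Config d} {x : Space d} {b : ℝ}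
    (hcov : ∃ y ∈ η.carrier, dist x y ≤ b) (hN : Metric.closedBall x b ⊆ N) :
    nearest (η.restrict N) x = nearest η x := by
  obtain ⟨y₀, hy₀, hb⟩ := hcov
  have hy₀N : y₀ ∈ η.carrier ∩ N := ⟨hy₀, hN (by rwa [Metric.mem_closedBall, dist_comm])⟩
  ext y
  constructor
  · rintro ⟨hy, h⟩
    refine ⟨hy.1, fun z hz => ?_⟩
    by_cases hzb : dist x z ≤ b
    · exact h z ⟨hz, hN (by rwa [Metric.mem_closedBall, dist_comm])⟩
    · exact (h y₀ hy₀N).trans (hb.trans (not_le.1 hzb).le)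
  · rintro ⟨hy, h⟩
    refine ⟨⟨hy, hN ?_⟩, fun z hz => h z hz.1⟩
    rw [Metric.mem_closedBall, dist_comm]
    exact (h y₀ hy₀).trans hb

/-- The configuration seen from `c` in units of `a`. -/
def Config.rescale (c : Space d) (a : ℝ) (ha : 0 < a) (η : Config d) : Config d where
  carrier := (fun u => c + a • u) ⁻¹' η.carrier
  finite_inter_closedBall R := by
    have hinj : Function.Injective fun u : Space d => c + a • u := fun u v h => by
      simpa [ha.ne'] using h
    refine Finite.of_finite_image (f := fun u => c + a • u) ?_ hinj.injOn
    refine (η.finite_inter_of_isBounded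
      (Metric.isBounded_closedBall (x := c) (r := a * R))).subset ?_
    rintro _ ⟨u, ⟨hu, huR⟩, rfl⟩
    refine ⟨hu, ?_⟩
    rw [mem_closedBall_zero_iff] at huR
    rw [Metric.mem_closedBall, dist_eq_norm, add_sub_cancel_left, norm_smul,
      Real.norm_of_nonneg ha.le]
    exact mul_le_mul_of_nonneg_left huR ha.le

variable {c : Space d} {a : ℝ} {ha : 0 < a} {η : Config d}

theorem mem_rescale {u : Space d} : u ∈ (η.rescale c a ha).carrier ↔ c + a • u ∈ η.carrier :=
  Iff.rfl

theorem dist_add_smul (ha : 0 < a) (u v : Space d) :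
    dist (c + a • u) (c + a • v) = a * dist u v := by
  rw [dist_add_left, dist_smul₀, Real.norm_of_nonneg ha.le]

theorem add_smul_surjective (ha : 0 < a) : Function.Surjective fun u : Space d => c + a • u :=
  fun x => ⟨a⁻¹ • (x - c), by simp [smul_smul, mul_inv_cancel₀ ha.ne']⟩

theorem count_rescale (ha : 0 < a) (B : Set (Space d)) :
    Config.count B (η.rescale c a ha) = Config.count ((fun x => a⁻¹ • (x - c)) ⁻¹' B) η := by
  have hinj : Function.Injective fun u : Space d => c + a • u := fun u v h => by
    simpa [ha.ne'] using h
  rw [Config.count, Config.count, ← hinj.injOn.encard_image (s := (η.rescale c a ha).carrier ∩ B)]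
  congr 1
  ext x
  constructor
  · rintro ⟨u, ⟨hu, huB⟩, rfl⟩
    refine ⟨hu, ?_⟩
    simpa [smul_smul, inv_mul_cancel₀ ha.ne'] using huB
  · rintro ⟨hx, hxB⟩
    have : c + a • (a⁻¹ • (x - c)) = x := by simp [smul_smul, mul_inv_cancel₀ ha.ne']
    exact ⟨a⁻¹ • (x - c), ⟨by rw [mem_rescale, this]; exact hx, hxB⟩, this⟩

theorem measurable_rescale (N : Set (Space d)) (ha : 0 < a) :
    Measurable[regionSigma ((fun x => a⁻¹ • (x - c)) ⁻¹' N), regionSigma N]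
      (Config.rescale c a ha) := by
  refine Measurable.of_comap_le ?_
  rw [regionSigma, MeasurableSpace.comap_iSup]
  refine iSup_le fun B => ?_
  rw [MeasurableSpace.comap_comp]
  refine Measurable.comap_le ?_
  have : Config.count (B : Set (Space d)) ∘ Config.rescale c a ha =
      Config.count ((fun x => a⁻¹ • (x - c)) ⁻¹' B) := funext fun η => count_rescale ha _
  rw [this]
  exact measurable_count_regionSigma ((by fun_prop : Measurable fun x : Space d => a⁻¹ • (x - c)) B.2.1)
    (preimage_mono B.2.2.2)

theorem measurable_rescale' (ha : 0 < a) : Measurable (Config.rescale c a ha) := by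
  have := measurable_rescale (c := c) (univ : Set (Space d)) ha
  rwa [preimage_univ, regionSigma_univ] at this

theorem mem_nearest_rescale (ha : 0 < a) {u v : Space d} :
    v ∈ nearest (η.rescale c a ha) u ↔ c + a • v ∈ nearest η (c + a • u) := by
  constructor
  · rintro ⟨hv, h⟩
    refine ⟨hv, fun z hz => ?_⟩
    obtain ⟨w, rfl⟩ := add_smul_surjective (c := c) ha z
    simp only [dist_add_smul ha]
    exact mul_le_mul_of_nonneg_left (h w hz) ha.le
  · rintro ⟨hv, h⟩
    refine ⟨hv, fun w hw => ?_⟩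
    have := h _ hw
    simp only [dist_add_smul ha] at this
    exact le_of_mul_le_mul_left this ha

theorem mem_skeleton_rescale (ha : 0 < a) {u : Space d} {k : ℕ} :
    u ∈ skeleton (η.rescale c a ha) k ↔ c + a • u ∈ skeleton η k := by
  have himg : nearest η (c + a • u) = (fun v => c + a • v) '' nearest (η.rescale c a ha) u := by
    ext z
    constructor
    · intro hz
      obtain ⟨w, rfl⟩ := add_smul_surjective (c := c) ha z
      exact ⟨w, (mem_nearest_rescale ha).2 hz, rfl⟩
    · rintro ⟨w, hw, rfl⟩
      exact (mem_nearest_rescale ha).1 hw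
  have hspan : vectorSpan ℝ (nearest η (c + a • u)) =
      (vectorSpan ℝ (nearest (η.rescale c a ha) u)).map
        (LinearEquiv.smulOfNeZero ℝ (Space d) a ha.ne' : Space d →ₗ[ℝ] Space d) := by
    rw [himg, vectorSpan_def, vectorSpan_def, Submodule.map_span]
    congr 1
    ext z
    constructor
    · rintro ⟨_, ⟨p, hp, rfl⟩, _, ⟨q, hq, rfl⟩, rfl⟩
      exact ⟨p -ᵥ q, ⟨p, hp, q, hq, rfl⟩, by simp [smul_sub]⟩
    · rintro ⟨_, ⟨p, hp, q, hq, rfl⟩, rfl⟩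
      exact ⟨_, ⟨p, hp, rfl⟩, _, ⟨q, hq, rfl⟩, by simp [smul_sub]⟩
  change k ≤ Module.finrank ℝ (vectorSpan ℝ (nearest (η.rescale c a ha) u)) ↔
    k ≤ Module.finrank ℝ (vectorSpan ℝ (nearest η (c + a • u)))
  rw [hspan, LinearEquiv.finrank_map_eq]

theorem volume_preimage_rescale (ha : 0 < a) (B : Set (Space d)) :
    volume ((fun x : Space d => a⁻¹ • (x - c)) ⁻¹' B) = ENNReal.ofReal (a ^ d) * volume B := by
  have : (fun x : Space d => a⁻¹ • (x - c)) ⁻¹' B =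
      (fun x => x + -c) ⁻¹' ((fun x => a⁻¹ • x) ⁻¹' B) := by
    ext x; simp [sub_eq_add_neg]
  rw [this, measure_preimage_add_right, Measure.addHaar_preimage_smul _ (inv_ne_zero ha.ne')]
  rw [finrank_euclideanSpace_fin, inv_pow, inv_inv, abs_of_pos (by positivity)]

theorem IsPoissonLaw.map_rescale {L : ℝ≥0∞} {Q : Measure (Config d)} (ha : 0 < a)
    (hQ : IsPoissonLaw (L • (volume : Measure (Space d))) Q) (c : Space d) :
    IsPoissonLaw ((L * ENNReal.ofReal (a ^ d)) • (volume : Measure (Space d)))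
      (Q.map (Config.rescale c a ha)) := by
  have hm := measurable_rescale' (c := c) ha
  have hφ : Measurable fun x : Space d => a⁻¹ • (x - c) := by fun_prop
  have hvol : ∀ B, ((L * ENNReal.ofReal (a ^ d)) • (volume : Measure (Space d))) B =
      (L • (volume : Measure (Space d))) ((fun x : Space d => a⁻¹ • (x - c)) ⁻¹' B) := fun B => by
    rw [Measure.smul_apply, Measure.smul_apply, volume_preimage_rescale ha, smul_eq_mul,
      smul_eq_mul, mul_assoc]
  have := hQ.isProbabilityMeasure
  have := Measure.isProbabilityMeasure_map (μ := Q) hm.aemeasurable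
  refine ⟨this, fun B hB hfin k => ?_, fun B hB hd => ?_⟩
  · have hS : MeasurableSet {η : Config d | Config.count B η = k} :=
      measurable_count hB (MeasurableSet.of_discrete (s := {(k : ℕ∞)}))
    rw [hvol] at hfin ⊢
    rw [Measure.map_apply hm hS, ← hQ.count_law _ (hφ hB) hfin]
    congr 1
    ext η
    simp only [mem_preimage, mem_ofPred_eq, count_rescale]
  · rw [iIndepFun_iff_map_fun_eq_infinitePi_map fun i => measurable_count (hB i)]
    have h2 := hQ.indep (fun i => (fun x : Space d => a⁻¹ • (x - c)) ⁻¹' B i) (fun i => hφ (hB i))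
      (fun i j hij => (hd hij).preimage _)
    rw [iIndepFun_iff_map_fun_eq_infinitePi_map fun i => measurable_count (hφ (hB i))] at h2
    have hcomp : ∀ i, Config.count (B i) ∘ Config.rescale c a ha =
        Config.count ((fun x => a⁻¹ • (x - c)) ⁻¹' B i) := fun i => funext fun η => count_rescale ha _
    rw [Measure.map_map (measurable_pi_lambda _ fun i => measurable_count (hB i)) hm]
    have : ((fun ω i => Config.count (B i) ω) ∘ Config.rescale c a ha) =
        fun ω i => Config.count ((fun x => a⁻¹ • (x - c)) ⁻¹' B i) ω := by
      funext η i
      exact count_rescale ha _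
    rw [this, h2]
    congr 1
    funext i
    rw [Measure.map_map (measurable_count (hB i)) hm, hcomp]

theorem smul_volume_ne_top {L : ℝ≥0∞} (hL : L ≠ ∞) (B : Set (Space d))
    (hB : Bornology.IsBounded B) : (L • (volume : Measure (Space d))) B ≠ ∞ := by
  rw [Measure.smul_apply, smul_eq_mul]
  exact ENNReal.mul_ne_top hL hB.measure_lt_top.ne

end LineOfSight
end

noncomputable section
namespace LineOfSight

variable {d : ℕ} {η : Config d}

/-! ### Regular blocks -/

/-- The balls of radius `δ` around the points of `T` all contain nuclei. -/
def occupied (T : Finset (Space d)) (δ : ℝ) : Set (Config d) :=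
  {η | ∀ g ∈ T, Config.count (Metric.ball g δ) η ≠ 0}

/-- Some ball of radius `r` near the origin contains `n` affinely independent points of the
`k`-th skeleton. -/
def spreadAt (d n k j : ℕ) (r : ℝ) : Set (Config d) :=
  {η | η.carrier.Nonempty ∧ ∃ f : Fin n → Space d, AffineIndependent ℝ f ∧
    ∀ i, f i ∈ Metric.closedBall (TopologicalSpace.denseSeq (Space d) j) r ∩ skeleton η k}

/-- The indices of the dense sequence that belong to the ball of radius `7`. -/
def nearIndex (d : ℕ) : Set ℕ :=
  {j | TopologicalSpace.denseSeq (Space d) j ∈ Metric.closedBall 0 7}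

/-- Two crossroads are close to each other. -/
def closeCrossroads (d : ℕ) (r : ℝ) : Set (Config d) :=
  ⋃ j ∈ nearIndex d, spreadAt d 2 d j r

/-- Away from crossroads, the skeleton is not locally contained in a line. -/
def closeStreets (d : ℕ) (β κ : ℝ) : Set (Config d) :=
  ⋃ j ∈ nearIndex d, spreadAt d 3 (d - 1) j κ \ spreadAt d 1 d j β

theorem measurableSet_occupied (T : Finset (Space d)) (δ : ℝ) :
    MeasurableSet (occupied T δ) := by
  have : occupied T δ = ⋂ g ∈ T, {η | Config.count (Metric.ball g δ) η ≠ 0} := by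
    ext; simp [occupied]
  rw [this]
  exact T.measurableSet_biInter fun g _ =>
    measurableSet_count_ne_zero Metric.isOpen_ball.measurableSet

theorem measurableSet_spreadAt (n k j : ℕ) (r : ℝ) : MeasurableSet (spreadAt d n k j r) :=
  measurableSet_exists_affineIndependent (isCompact_closedBall _ _) n k

theorem measurableSet_closeCrossroads (r : ℝ) : MeasurableSet (closeCrossroads d r) :=
  MeasurableSet.biUnion (to_countable _) fun _ _ => measurableSet_spreadAt _ _ _ _

theorem measurableSet_closeStreets (β κ : ℝ) : MeasurableSet (closeStreets d β κ) :=
  MeasurableSet.biUnion (to_countable _) fun _ _ =>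
    (measurableSet_spreadAt _ _ _ _).diff (measurableSet_spreadAt _ _ _ _)

theorem spreadAt_mono {n k j : ℕ} {r r' : ℝ} (h : r ≤ r') :
    spreadAt d n k j r ⊆ spreadAt d n k j r' := by
  rintro η ⟨hη, f, hf, hfi⟩
  exact ⟨hη, f, hf, fun i => ⟨Metric.closedBall_subset_closedBall h (hfi i).1, (hfi i).2⟩⟩

theorem closeCrossroads_mono {r r' : ℝ} (h : r ≤ r') :
    closeCrossroads d r ⊆ closeCrossroads d r' :=
  iUnion₂_mono fun _ _ => spreadAt_mono h

theorem closeStreets_mono {β r r' : ℝ} (h : r ≤ r') :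
    closeStreets d β r ⊆ closeStreets d β r' :=
  iUnion₂_mono fun _ _ => sdiff_subset_sdiff_left (spreadAt_mono h)

theorem exists_notMem_closeCrossroads (hd : 0 < d) (η : Config d) :
    ∃ r > 0, η ∉ closeCrossroads d r := by
  choose ε hε h using exists_forall_crossroads_eq (η := η)
  obtain ⟨δ, hδ, hleb⟩ := lebesgue_number_lemma_of_metric
    (isCompact_closedBall (0 : Space d) 7) (c := fun q => Metric.ball q (ε q))
    (fun q => Metric.isOpen_ball) fun q _ => mem_iUnion.2 ⟨q, Metric.mem_ball_self (hε q)⟩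
  refine ⟨δ / 2, half_pos hδ, fun hmem => ?_⟩
  simp only [closeCrossroads, mem_iUnion] at hmem
  obtain ⟨j, hj, -, f, hf, hfi⟩ := hmem
  obtain ⟨q, hq⟩ := hleb _ hj
  have heq : ∀ i, f i = q := fun i => by
    refine h q (f i) (hq ?_) ?_
    · have := (hfi i).1
      rw [Metric.mem_closedBall] at this
      rw [Metric.mem_ball]
      linarith
    · rw [crossroads_eq_skeleton hd]; exact (hfi i).2
  exact absurd (hf.injective ((heq 0).trans (heq 1).symm)) (by decide)

theorem exists_notMem_closeStreets (hd : 0 < d) {β : ℝ} (hβ : 0 < β) (η : Config d) :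
    ∃ κ > 0, η ∉ closeStreets d β κ := by
  have : ∀ q : Space d, ∃ ε > 0, (q ∉ crossroads η →
      Collinear ℝ (skeleton η (d - 1) ∩ Metric.ball q ε)) ∧ (q ∈ crossroads η → ε ≤ β) := by
    intro q
    by_cases hq : q ∈ crossroads η
    · exact ⟨β, hβ, fun h => absurd hq h, fun _ => le_rfl⟩
    · obtain ⟨ε, hε, h⟩ := exists_collinear_skeleton hd hq
      exact ⟨ε, hε, fun _ => h, fun h => absurd h hq⟩
  choose ε hε h h' using this
  obtain ⟨δ, hδ, hleb⟩ := lebesgue_number_lemma_of_metric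
    (isCompact_closedBall (0 : Space d) 7) (c := fun q => Metric.ball q (ε q))
    (fun q => Metric.isOpen_ball) fun q _ => mem_iUnion.2 ⟨q, Metric.mem_ball_self (hε q)⟩
  refine ⟨δ / 2, half_pos hδ, fun hmem => ?_⟩
  simp only [closeStreets, mem_iUnion] at hmem
  obtain ⟨j, hj, ⟨hη, f, hf, hfi⟩, hno⟩ := hmem
  obtain ⟨q, hq⟩ := hleb _ hj
  have hfree : q ∉ crossroads η := fun hqc => by
    refine hno ⟨hη, fun _ => q, affineIndependent_of_subsingleton ℝ _, fun _ => ⟨?_, ?_⟩⟩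
    · have := hq (Metric.mem_ball_self hδ)
      rw [Metric.mem_ball, dist_comm] at this
      exact (this.trans_le (h' q hqc)).le
    · rwa [← crossroads_eq_skeleton hd]
  rw [affineIndependent_iff_not_collinear] at hf
  refine hf ((h q hfree).subset ?_)
  rintro _ ⟨i, rfl⟩
  refine ⟨(hfi i).2, hq ?_⟩
  have := (hfi i).1
  rw [Metric.mem_closedBall] at this
  rw [Metric.mem_ball]
  linarith

theorem exists_measure_le_of_antitone {α : Type*} [MeasurableSpace α] (μ : Measure α)
    [IsFiniteMeasure μ] {S : ℝ → Set α} (hm : ∀ r, MeasurableSet (S r))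
    (hmono : ∀ r r', r ≤ r' → S r ⊆ S r') (hlim : ∀ x, ∃ r > 0, x ∉ S r) {ε : ℝ≥0∞} (hε : 0 < ε)
    {b : ℝ} (hb : 0 < b) : ∃ r > 0, r ≤ b ∧ μ (S r) ≤ ε := by
  have hlim' := tendsto_measure_iInter_atTop (μ := μ) (s := fun n : ℕ => S (1 / (n + 1)))
    (fun n => (hm _).nullMeasurableSet)
    (fun n k hnk => hmono _ _ (one_div_le_one_div_of_le (by positivity) (by
      have : (n : ℝ) ≤ k := by exact_mod_cast hnk
      linarith))) ⟨0, measure_ne_top _ _⟩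
  have hempty : (⋂ n : ℕ, S (1 / ((n : ℝ) + 1))) = ∅ := by
    refine eq_empty_iff_forall_notMem.2 fun x hx => ?_
    obtain ⟨r, hr, hxr⟩ := hlim x
    obtain ⟨n, hn⟩ := exists_nat_one_div_lt hr
    exact hxr (hmono _ _ hn.le (mem_iInter.1 hx n))
  rw [hempty, measure_empty] at hlim'
  obtain ⟨n, hn⟩ := ((hlim'.eventually (gt_mem_nhds hε)).and
    (tendsto_one_div_add_atTop_nhds_zero_nat.eventually (gt_mem_nhds hb))).exists
  exact ⟨_, Nat.one_div_pos_of_nat, hn.2.le, hn.1.le⟩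

/-- The block at the origin, in units of the block scale, is not regular. -/
def irregular (T : Finset (Space d)) (r κ : ℝ) : Set (Config d) :=
  (occupied T 1)ᶜ ∪ (closeCrossroads d (2 * r) ∪ closeStreets d (r / 8) (2 * κ))

theorem measurableSet_irregular (T : Finset (Space d)) (r κ : ℝ) :
    MeasurableSet (irregular T r κ) :=
  (measurableSet_occupied T 1).compl.union
    ((measurableSet_closeCrossroads _).union (measurableSet_closeStreets _ _))

/-- For a given intensity, the separation scales can be chosen so that separation fails with small
probability. -/
theorem exists_separation (hd : 0 < d) {L : ℝ≥0∞} (hL : L ≠ ∞) {ε : ℝ≥0∞} (hε : 0 < ε) {b : ℝ}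
    (hb : 0 < b) : ∃ r κ : ℝ, 0 < r ∧ r ≤ b ∧ 0 < κ ∧ κ ≤ r / 8 ∧ ∀ Q : Measure (Config d),
      IsPoissonLaw (L • (volume : Measure (Space d))) Q →
      Q (closeCrossroads d (2 * r) ∪ closeStreets d (r / 8) (2 * κ)) ≤ ε := by
  by_cases hex : ∃ Q : Measure (Config d), IsPoissonLaw (L • (volume : Measure (Space d))) Q
  · obtain ⟨Q, hQ⟩ := hex
    have := hQ.isProbabilityMeasure
    have hε2 : 0 < ε / 2 := ENNReal.half_pos hε.ne'
    obtain ⟨r, hr, hrb, h1⟩ := exists_measure_le_of_antitone Q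
      (measurableSet_closeCrossroads (d := d)) (fun _ _ => closeCrossroads_mono)
      (exists_notMem_closeCrossroads hd) hε2 (b := 2 * b) (by positivity)
    obtain ⟨κ, hκ, hκr, h2⟩ := exists_measure_le_of_antitone Q
      (measurableSet_closeStreets (d := d) (r / 2 / 8)) (fun _ _ => closeStreets_mono)
      (exists_notMem_closeStreets hd (β := r / 2 / 8) (by positivity)) hε2 (b := r / 8)
      (by positivity)
    refine ⟨r / 2, κ / 2, half_pos hr, by linarith, half_pos hκ, by linarith, fun Q' hQ' => ?_⟩
    rw [hQ'.unique hQ (smul_volume_ne_top hL), mul_div_cancel₀ _ two_ne_zero,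
      mul_div_cancel₀ _ two_ne_zero]
    calc _ ≤ Q (closeCrossroads d r) + Q (closeStreets d (r / 2 / 8) κ) := measure_union_le _ _
      _ ≤ ε / 2 + ε / 2 := add_le_add h1 h2
      _ = ε := ENNReal.add_halves ε
  · exact ⟨b, b / 8, hb, le_rfl, by positivity, le_rfl, fun Q hQ => absurd ⟨Q, hQ⟩ hex⟩

theorem covers_of_mem_occupied {T : Finset (Space d)} {M δ : ℝ}
    (hT : Metric.closedBall (0 : Space d) M ⊆ ⋃ g ∈ T, Metric.ball g δ) {c : Space d} {a : ℝ}
    (ha : 0 < a) (h : η.rescale c a ha ∈ occupied T δ) : Covers η c (M * a) (2 * δ * a) := by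
  intro x hx
  obtain ⟨u, rfl⟩ := add_smul_surjective (c := c) ha x
  rw [Metric.mem_closedBall, dist_eq_norm, add_sub_cancel_left, norm_smul,
    Real.norm_of_nonneg ha.le, mul_comm M, mul_le_mul_iff_right₀ ha] at hx
  obtain ⟨g, hg, hug⟩ := mem_iUnion₂.1 (hT (mem_closedBall_zero_iff.2 hx))
  obtain ⟨y, hy, hyg⟩ := count_ne_zero.1 (h g hg)
  refine ⟨_, mem_rescale.1 hy, ?_⟩
  rw [dist_add_smul ha, mul_comm _ a, mul_le_mul_iff_right₀ ha]
  rw [Metric.mem_ball] at hug hyg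
  rw [dist_comm] at hyg
  linarith [dist_triangle u g y]

theorem restrict_mem_irregular {T : Finset (Space d)}
    (hT : Metric.closedBall (0 : Space d) 8 ⊆ ⋃ g ∈ T, Metric.ball g 1)
    (hT' : ∀ g ∈ T, g ∈ Metric.closedBall (0 : Space d) 8) {r κ : ℝ} (hr : r ≤ 1 / 2)
    (hκ : κ ≤ 1 / 2) (η : Config d) :
    η.restrict (Metric.closedBall 0 10) ∈ irregular T r κ ↔ η ∈ irregular T r κ := by
  have hocc : η.restrict (Metric.closedBall 0 10) ∈ occupied T 1 ↔ η ∈ occupied T 1 := by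
    refine forall₂_congr fun g hg => ?_
    rw [count_restrict, inter_eq_left.2]
    refine Metric.ball_subset_closedBall.trans (Metric.closedBall_subset_closedBall' ?_)
    have := hT' g hg
    rw [Metric.mem_closedBall] at this
    linarith
  by_cases ho : η ∈ occupied T 1
  · have hcov : ∀ x ∈ Metric.closedBall (0 : Space d) 8, ∃ y ∈ η.carrier, dist x y ≤ 2 := by
      intro x hx
      obtain ⟨g, hg, hxg⟩ := mem_iUnion₂.1 (hT hx)
      obtain ⟨y, hy, hyg⟩ := count_ne_zero.1 (ho g hg)
      rw [Metric.mem_ball] at hxg hyg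
      rw [dist_comm] at hyg
      exact ⟨y, hy, by linarith [dist_triangle x g y]⟩
    have hnear : ∀ x ∈ Metric.closedBall (0 : Space d) 8,
        nearest (η.restrict (Metric.closedBall 0 10)) x = nearest η x := fun x hx =>
      nearest_restrict (hcov x hx) (Metric.closedBall_subset_closedBall' (by
        rw [Metric.mem_closedBall] at hx; linarith))
    have hsk : ∀ k, ∀ x ∈ Metric.closedBall (0 : Space d) 8,
        (x ∈ skeleton (η.restrict (Metric.closedBall 0 10)) k ↔ x ∈ skeleton η k) := by
      intro k x hx
      have h1 : vectorSpan ℝ (nearest (η.restrict (Metric.closedBall 0 10)) x) =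
          vectorSpan ℝ (nearest η x) := congrArg _ (hnear x hx)
      change k ≤ Module.finrank ℝ _ ↔ k ≤ Module.finrank ℝ _
      rw [h1]
    have h0 : (0 : Space d) ∈ Metric.closedBall (0 : Space d) 8 := by simp
    have hne : η.carrier.Nonempty := by
      obtain ⟨y, hy, -⟩ := hcov 0 h0
      exact ⟨y, hy⟩
    have hne' : (η.restrict (Metric.closedBall 0 10)).carrier.Nonempty := by
      obtain ⟨y, hy⟩ := nearest_nonempty hne 0
      rw [← hnear 0 h0] at hy
      exact ⟨y, hy.1⟩
    have hspread : ∀ n k, ∀ j ∈ nearIndex d, ∀ s ≤ 1,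
        (η.restrict (Metric.closedBall 0 10) ∈ spreadAt d n k j s ↔ η ∈ spreadAt d n k j s) := by
      intro n k j hj s hs
      refine and_congr (iff_of_true hne' hne) (exists_congr fun f => and_congr_right fun _ =>
        forall_congr' fun i => and_congr_right fun hi => hsk k _ ?_)
      refine Metric.closedBall_subset_closedBall' ?_ hi
      have : dist (TopologicalSpace.denseSeq (Space d) j) 0 ≤ 7 := hj
      linarith
    simp only [irregular, closeCrossroads, closeStreets, mem_union, mem_compl_iff, hocc, mem_iUnion,
      mem_sdiff]
    refine or_congr Iff.rfl (or_congr ?_ ?_)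
    · exact exists₂_congr fun j hj => hspread _ _ j hj _ (by linarith)
    · exact exists₂_congr fun j hj => and_congr (hspread _ _ j hj _ (by linarith))
        (not_congr (hspread _ _ j hj _ (by linarith)))
  · exact iff_of_true (Or.inl fun h => ho (hocc.1 h)) (Or.inl ho)

theorem measure_iInter_irregular_le {Q : Measure (Config d)} {L : ℝ≥0∞}
    (hQ : IsPoissonLaw (L • (volume : Measure (Space d))) Q) {T : Finset (Space d)}
    (hT : Metric.closedBall (0 : Space d) 8 ⊆ ⋃ g ∈ T, Metric.ball g 1)
    (hT' : ∀ g ∈ T, g ∈ Metric.closedBall (0 : Space d) 8) {r κ : ℝ} (hr : r ≤ 1 / 2)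
    (hκ : κ ≤ 1 / 2) {a : ℝ} (ha : 0 < a) {ι : Type*} (I : Finset ι) (c : ι → Space d)
    (hc : ∀ i ∈ I, ∀ j ∈ I, i ≠ j → 20 * a < dist (c i) (c j)) {ε : ℝ≥0∞}
    (hε : ∀ i ∈ I, Q {η | η.rescale (c i) a ha ∈ irregular T r κ} ≤ ε) :
    Q (⋂ i ∈ I, {η | η.rescale (c i) a ha ∈ irregular T r κ}) ≤ ε ^ I.card := by
  rw [hQ.measure_biInter_eq_prod I
    (N := fun i => (fun x => a⁻¹ • (x - c i)) ⁻¹' Metric.closedBall 0 10)]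
  · exact Finset.prod_le_pow_card _ _ _ hε
  · intro i hi j hj hij
    refine Set.disjoint_left.2 fun x hx hx' => ?_
    have key : ∀ c : Space d, a⁻¹ • (x - c) ∈ Metric.closedBall (0 : Space d) 10 →
        dist x c ≤ 10 * a := fun c h => by
      rw [mem_closedBall_zero_iff, norm_smul, norm_inv, Real.norm_of_nonneg ha.le,
        inv_mul_le_iff₀ ha] at h
      rw [dist_eq_norm]; linarith
    have h1 := key _ hx
    have h2 := key _ hx'
    have h3 := hc i hi j hj hij
    rw [dist_comm x] at h1
    linarith [dist_triangle (c i) x (c j)]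
  · intro i _
    exact measurable_rescale _ ha (measurableSet_regionSigma_of_restrict
      Metric.isClosed_closedBall.measurableSet (measurableSet_irregular T r κ)
      (restrict_mem_irregular hT hT' hr hκ))

theorem collinear_of_forall_triple {s : Set (Space d)}
    (h : ∀ p₁ ∈ s, ∀ p₂ ∈ s, ∀ p₃ ∈ s, Collinear ℝ {p₁, p₂, p₃}) : Collinear ℝ s := by
  rcases s.subsingleton_or_nontrivial with hs | ⟨p₁, h1, p₂, h2, hne⟩
  · rcases hs.eq_empty_or_singleton with rfl | ⟨x, rfl⟩
    exacts [collinear_empty ℝ _, collinear_singleton ℝ x]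
  rw [collinear_iff_of_mem h1]
  refine ⟨p₂ -ᵥ p₁, fun p h3 => ?_⟩
  obtain ⟨w, hw⟩ := (collinear_iff_of_mem (p₀ := p₁) (by simp)).1 (h p₁ h1 p₂ h2 p h3)
  obtain ⟨s, hs⟩ := hw p₂ (by simp)
  obtain ⟨t, ht⟩ := hw p (by simp)
  have hs0 : s ≠ 0 := by
    rintro rfl
    exact hne (by simp [hs])
  refine ⟨t * s⁻¹, ?_⟩
  rw [ht, hs]
  simp [smul_smul, hs0]

theorem collinear_triple_add_smul (c : Space d) (a : ℝ) {p₁ p₂ p₃ : Space d}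
    (h : Collinear ℝ {p₁, p₂, p₃}) : Collinear ℝ {c + a • p₁, c + a • p₂, c + a • p₃} := by
  obtain ⟨p, v, hv⟩ := (collinear_iff_exists_forall_eq_smul_vadd _).1 h
  refine (collinear_iff_exists_forall_eq_smul_vadd _).2 ⟨c + a • p, a • v, ?_⟩
  have key : ∀ x ∈ ({p₁, p₂, p₃} : Set (Space d)), ∃ r : ℝ, c + a • x = r • a • v +ᵥ (c + a • p) :=
    fun x hx => by
      obtain ⟨r, rfl⟩ := hv x hx
      refine ⟨r, ?_⟩
      simp only [vadd_eq_add]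
      module
  rintro _ (rfl | rfl | rfl)
  exacts [key p₁ (by simp), key p₂ (by simp), key p₃ (by simp)]

/-- The deterministic properties of a regular block of centre `c` and scale `a`. -/
structure IsRegular (η : Config d) (c : Space d) (a r κ : ℝ) : Prop where
  covers : Covers η c (8 * a) (2 * a)
  eq_of_mem_crossroads : ∀ u ∈ Metric.closedBall c (6 * a), ∀ v ∈ crossroads η,
    ∀ w ∈ crossroads η, v ∈ Metric.closedBall u (r * a) → w ∈ Metric.closedBall u (r * a) → v = w
  collinear : ∀ u ∈ Metric.closedBall c (6 * a),
    (∀ v ∈ crossroads η, v ∉ Metric.closedBall u (r * a / 4)) →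
      Collinear ℝ (skeleton η (d - 1) ∩ Metric.closedBall u (κ * a))

theorem isRegular_of_rescale_notMem_irregular (hd : 0 < d) {T : Finset (Space d)}
    (hT : Metric.closedBall (0 : Space d) 8 ⊆ ⋃ g ∈ T, Metric.ball g 1) {r κ : ℝ} (hr : 0 < r)
    (hκ : 0 < κ) {c : Space d} {a : ℝ} (ha : 0 < a)
    (h : η.rescale c a ha ∉ irregular T r κ) : IsRegular η c a r κ := by
  simp only [irregular, mem_union, mem_compl_iff, not_or, not_not] at h
  obtain ⟨hocc, hcr, hst⟩ := h
  have hcov := covers_of_mem_occupied hT ha hocc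
  rw [mul_one] at hcov
  have hne : (η.rescale c a ha).carrier.Nonempty := by
    obtain ⟨y, hy⟩ := hcov.carrier_nonempty (by positivity)
    obtain ⟨u, rfl⟩ := add_smul_surjective (c := c) ha y
    exact ⟨u, hy⟩
  have hscale : ∀ {u v : Space d} {s : ℝ}, c + a • v ∈ Metric.closedBall (c + a • u) (s * a) ↔
      dist v u ≤ s := fun {u v s} => by
    rw [Metric.mem_closedBall, dist_add_smul ha, mul_comm s, mul_le_mul_iff_right₀ ha]
  have hball : ∀ {u : Space d}, c + a • u ∈ Metric.closedBall c (6 * a) → dist u 0 ≤ 6 :=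
    fun {u} hu => by
      rw [← hscale]
      simpa using hu
  refine ⟨hcov, fun u hu v hv w hw hvu hwu => ?_, fun u hu hfree => ?_⟩
  · obtain ⟨u, rfl⟩ := add_smul_surjective (c := c) ha u
    obtain ⟨v, rfl⟩ := add_smul_surjective (c := c) ha v
    obtain ⟨w, rfl⟩ := add_smul_surjective (c := c) ha w
    rw [crossroads_eq_skeleton hd] at hv hw
    simp only [hscale] at hvu hwu
    obtain ⟨j, hj⟩ := (TopologicalSpace.denseRange_denseSeq (Space d)).exists_dist_lt u
      (lt_min hr one_pos)
    have hj1 := hj.trans_le (min_le_left _ _)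
    have hj2 := hj.trans_le (min_le_right _ _)
    by_contra hne'
    refine hcr (mem_iUnion₂.2 ⟨j, ?_, hne, ![v, w], ?_, ?_⟩)
    · change dist _ _ ≤ 7
      rw [dist_comm] at hj2
      linarith [dist_triangle (TopologicalSpace.denseSeq (Space d) j) u 0, hball hu]
    · exact affineIndependent_of_ne ℝ fun h => hne' (by rw [h])
    · have hmem : ∀ x : Space d, c + a • x ∈ skeleton η d → dist x u ≤ r → x ∈
          Metric.closedBall (TopologicalSpace.denseSeq (Space d) j) (2 * r) ∩
            skeleton (η.rescale c a ha) d := fun x hx hxu =>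
        ⟨by rw [Metric.mem_closedBall]
            linarith [dist_triangle x u (TopologicalSpace.denseSeq (Space d) j)],
          (mem_skeleton_rescale ha).2 hx⟩
      intro i
      fin_cases i
      exacts [hmem v hv hvu, hmem w hw hwu]
  · obtain ⟨u, rfl⟩ := add_smul_surjective (c := c) ha u
    obtain ⟨j, hj⟩ := (TopologicalSpace.denseRange_denseSeq (Space d)).exists_dist_lt u
      (lt_min (lt_min (show 0 < r / 8 by positivity) hκ) one_pos)
    have hj1 := hj.trans_le ((min_le_left _ _).trans (min_le_left _ _))
    have hj2 := hj.trans_le ((min_le_left _ _).trans (min_le_right _ _))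
    have hj3 := hj.trans_le (min_le_right _ _)
    have hjn : j ∈ nearIndex d := by
      change dist _ _ ≤ 7
      rw [dist_comm] at hj3
      linarith [dist_triangle (TopologicalSpace.denseSeq (Space d) j) u 0, hball hu]
    by_contra hcol
    have hex : ∃ p₁ ∈ skeleton η (d - 1) ∩ Metric.closedBall (c + a • u) (κ * a),
        ∃ p₂ ∈ skeleton η (d - 1) ∩ Metric.closedBall (c + a • u) (κ * a),
        ∃ p₃ ∈ skeleton η (d - 1) ∩ Metric.closedBall (c + a • u) (κ * a),
        ¬ Collinear ℝ {p₁, p₂, p₃} := by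
      by_contra! hall
      exact hcol (collinear_of_forall_triple hall)
    obtain ⟨p₁, h1, p₂, h2, p₃, h3, hnc⟩ := hex
    obtain ⟨p₁, rfl⟩ := add_smul_surjective (c := c) ha p₁
    obtain ⟨p₂, rfl⟩ := add_smul_surjective (c := c) ha p₂
    obtain ⟨p₃, rfl⟩ := add_smul_surjective (c := c) ha p₃
    have hmem : ∀ x : Space d,
        c + a • x ∈ skeleton η (d - 1) ∩ Metric.closedBall (c + a • u) (κ * a) → x ∈
        Metric.closedBall (TopologicalSpace.denseSeq (Space d) j) (2 * κ) ∩
          skeleton (η.rescale c a ha) (d - 1) := fun x hx => by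
      refine ⟨?_, (mem_skeleton_rescale ha).2 hx.1⟩
      have := hscale.1 hx.2
      rw [Metric.mem_closedBall]
      linarith [dist_triangle x u (TopologicalSpace.denseSeq (Space d) j)]
    refine hst (mem_iUnion₂.2 ⟨j, hjn, ⟨hne, ![p₁, p₂, p₃], ?_, ?_⟩, ?_⟩)
    · rw [affineIndependent_iff_not_collinear_set]
      intro hcol3
      refine hnc ?_
      exact collinear_triple_add_smul c a hcol3
    · intro i
      fin_cases i
      exacts [hmem p₁ h1, hmem p₂ h2, hmem p₃ h3]
    · rintro ⟨-, f, -, hf⟩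
      obtain ⟨hf1, hf2⟩ := hf 0
      rw [mem_skeleton_rescale ha, ← crossroads_eq_skeleton hd] at hf2
      refine hfree _ hf2 ?_
      rw [show r * a / 4 = (r / 4) * a by ring, hscale]
      rw [Metric.mem_closedBall] at hf1
      rw [dist_comm] at hj1
      linarith [dist_triangle (f 0) (TopologicalSpace.denseSeq (Space d) j) u]

end LineOfSight
end

noncomputable section
namespace LineOfSight

/-! ### Clusters of the square lattice -/

/-- Adjacency in the square lattice. -/
def LatticeAdj (z w : ℤ × ℤ) : Prop :=
  (z.1 = w.1 ∧ (w.2 = z.2 + 1 ∨ z.2 = w.2 + 1)) ∨ (z.2 = w.2 ∧ (w.1 = z.1 + 1 ∨ z.1 = w.1 + 1))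

/-- Two lattice points whose coordinates differ by at most one. -/
def LatticeNear (z w : ℤ × ℤ) : Prop :=
  |z.1 - w.1| ≤ 1 ∧ |z.2 - w.2| ≤ 1

/-- The sites that can be reached from the origin through `𝒢`. -/
def cluster (𝒢 : Set (ℤ × ℤ)) : Set (ℤ × ℤ) :=
  {z | Relation.ReflTransGen (fun u v => v ∈ 𝒢 ∧ LatticeAdj u v) 0 z}

open Classical in
/-- The indicator modulo two of the lattice edges between `C` and `A`. -/
def edgeParity (C A : Set (ℤ × ℤ)) (u v : ℤ × ℤ) : ZMod 2 :=
  if (u ∈ C ∧ v ∈ A) ∨ (u ∈ A ∧ v ∈ C) then 1 else 0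

/-- The number modulo two of edges between `C` and `A` among the `n` vertical edges below height
`N` in the column of abscissa `x`. -/
def columnParity (C A : Set (ℤ × ℤ)) (N : ℤ) (x : ℤ) (n : ℕ) : ZMod 2 :=
  ∑ i ∈ Finset.range n, edgeParity C A (x, N - i - 1) (x, N - i)

theorem edgeParity_eq_zero {C A : Set (ℤ × ℤ)} {u v : ℤ × ℤ} (hu : u ∉ C) (hv : v ∉ C) :
    edgeParity C A u v = 0 := by
  rw [edgeParity, if_neg]
  tauto

theorem edgeParity_eq_zero' {C A : Set (ℤ × ℤ)} (hCA : Disjoint C A) {u v : ℤ × ℤ} (hu : u ∈ C)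
    (hv : v ∈ C) : edgeParity C A u v = 0 := by
  rw [edgeParity, if_neg]
  have := Set.disjoint_left.1 hCA hu
  have := Set.disjoint_left.1 hCA hv
  tauto

theorem zmod_two_add_self (x : ZMod 2) : x + x = 0 := CharTwo.add_self_eq_zero x

open Classical in
/-- Every unit square has an even number of edges between `C` and `A`. -/
theorem edgeParity_square {C A : Set (ℤ × ℤ)} (hCA : Disjoint C A)
    (hA : ∀ p ∈ A, ∀ u ∈ C, ∀ v ∉ C, LatticeAdj u v → LatticeNear p v → v ∈ A) (x y : ℤ) :
    edgeParity C A (x, y) (x + 1, y) + edgeParity C A (x, y) (x, y + 1) +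
      edgeParity C A (x + 1, y) (x + 1, y + 1) + edgeParity C A (x, y + 1) (x + 1, y + 1) = 0 := by
  set corners : Set (ℤ × ℤ) := {p | (p.1 = x ∨ p.1 = x + 1) ∧ (p.2 = y ∨ p.2 = y + 1)} with hc
  have hnear : ∀ p ∈ corners, ∀ q ∈ corners, LatticeNear p q := by
    rintro ⟨p1, p2⟩ ⟨h1, h2⟩ ⟨q1, q2⟩ ⟨h3, h4⟩
    simp only at h1 h2 h3 h4
    constructor <;> rw [abs_le] <;> constructor <;> simp only <;> omega
  have h00 : (x, y) ∈ corners := ⟨Or.inl rfl, Or.inl rfl⟩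
  have h10 : (x + 1, y) ∈ corners := ⟨Or.inr rfl, Or.inl rfl⟩
  have h01 : (x, y + 1) ∈ corners := ⟨Or.inl rfl, Or.inr rfl⟩
  have h11 : (x + 1, y + 1) ∈ corners := ⟨Or.inr rfl, Or.inr rfl⟩
  by_cases hex : ∃ p ∈ corners, p ∈ A
  · obtain ⟨p, hp, hpA⟩ := hex
    have key : ∀ u ∈ corners, ∀ v ∈ corners, LatticeAdj u v → LatticeAdj v u →
        edgeParity C A u v = (if u ∈ C then 1 else 0) + (if v ∈ C then 1 else 0) := by
      intro u hu v hv huv hvu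
      have h3 : u ∈ C → v ∉ C → LatticeAdj u v → LatticeNear p v → v ∈ A :=
        fun h h' => hA p hpA u h v h'
      have h4 : v ∈ C → u ∉ C → LatticeAdj v u → LatticeNear p u → u ∈ A :=
        fun h h' => hA p hpA v h u h'
      have hpu := hnear p hp u hu
      have hpv := hnear p hp v hv
      by_cases huC : u ∈ C <;> by_cases hvC : v ∈ C
      · rw [edgeParity_eq_zero' hCA huC hvC, if_pos huC, if_pos hvC, zmod_two_add_self]
      · rw [edgeParity, if_pos (Or.inl ⟨huC, h3 huC hvC huv hpv⟩), if_pos huC, if_neg hvC, add_zero]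
      · rw [edgeParity, if_pos (Or.inr ⟨h4 hvC huC hvu hpu, hvC⟩), if_neg huC, if_pos hvC, zero_add]
      · rw [edgeParity_eq_zero huC hvC, if_neg huC, if_neg hvC, add_zero]
    rw [key _ h00 _ h10 (by simp [LatticeAdj]) (by simp [LatticeAdj]),
      key _ h00 _ h01 (by simp [LatticeAdj]) (by simp [LatticeAdj]),
      key _ h10 _ h11 (by simp [LatticeAdj]) (by simp [LatticeAdj]),
      key _ h01 _ h11 (by simp [LatticeAdj]) (by simp [LatticeAdj])]
    generalize (if ((x, y) : ℤ × ℤ) ∈ C then (1 : ZMod 2) else 0) = a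
    generalize (if ((x + 1, y) : ℤ × ℤ) ∈ C then (1 : ZMod 2) else 0) = b
    generalize (if ((x, y + 1) : ℤ × ℤ) ∈ C then (1 : ZMod 2) else 0) = c
    generalize (if ((x + 1, y + 1) : ℤ × ℤ) ∈ C then (1 : ZMod 2) else 0) = e
    revert a b c e
    decide
  · push Not at hex
    have key : ∀ u ∈ corners, ∀ v ∈ corners, edgeParity C A u v = 0 := fun u hu v hv => by
      have := hex u hu
      have := hex v hv
      rw [edgeParity, if_neg]
      tauto
    rw [key _ h00 _ h10, key _ h00 _ h01, key _ h10 _ h11, key _ h01 _ h11]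
    simp

theorem columnParity_add {C A : Set (ℤ × ℤ)} (hCA : Disjoint C A)
    (hA : ∀ p ∈ A, ∀ u ∈ C, ∀ v ∉ C, LatticeAdj u v → LatticeNear p v → v ∈ A) {N : ℤ}
    (hN : ∀ z ∈ C, z.2 < N) (x : ℤ) (n : ℕ) :
    columnParity C A N x n + columnParity C A N (x + 1) n =
      edgeParity C A (x, N - n) (x + 1, N - n) := by
  induction n with
  | zero =>
    rw [edgeParity_eq_zero (fun h => absurd (hN _ h) (by simp)) (fun h => absurd (hN _ h) (by simp))]
    simp [columnParity]
  | succ n ih =>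
    have hsq := edgeParity_square hCA hA x (N - n - 1)
    rw [sub_add_cancel] at hsq
    rw [columnParity, columnParity, Finset.sum_range_succ, Finset.sum_range_succ, ← columnParity,
      ← columnParity]
    have : N - ((n + 1 : ℕ) : ℤ) = N - n - 1 := by push_cast; ring
    rw [this]
    revert hsq ih
    generalize edgeParity C A (x, N - n - 1) (x + 1, N - n - 1) = a
    generalize edgeParity C A (x, N - n - 1) (x, N - n) = b
    generalize edgeParity C A (x + 1, N - n - 1) (x + 1, N - n) = c
    generalize edgeParity C A (x, N - n) (x + 1, N - n) = e
    generalize columnParity C A N x n = p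
    generalize columnParity C A N (x + 1) n = q
    revert a b c e p q
    decide

/-- If the cluster of the origin is finite, the rightmost and the leftmost boundary sites of the
axis belong to the same `*`-connected component of the boundary. -/
theorem mem_of_starConnected {C A : Set (ℤ × ℤ)} (hCA : Disjoint C A)
    (hA : ∀ p ∈ A, ∀ u ∈ C, ∀ v ∉ C, LatticeAdj u v → LatticeNear p v → v ∈ A)
    (hfin : C.Finite)
    (hconn : ∀ z ∈ C, Relation.ReflTransGen (fun u v => u ∈ C ∧ v ∈ C ∧ LatticeAdj u v) 0 z)
    {k l : ℤ} (hk : (k - 1, 0) ∈ C) (hk' : ∀ x, k ≤ x → (x, 0) ∉ C) (hl : (l + 1, 0) ∈ C)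
    (hl' : ∀ x ≤ l, (x, 0) ∉ C) (hkA : (k, 0) ∈ A) : (l, 0) ∈ A := by
  obtain ⟨N, hN⟩ : ∃ N : ℤ, ∀ z ∈ C, |z.1| < N ∧ z.2 < N := by
    obtain ⟨M, hM⟩ := (hfin.image fun z : ℤ × ℤ => |z.1| + |z.2|).bddAbove
    refine ⟨M + 1, fun z hz => ?_⟩
    have h := hM ⟨z, hz, rfl⟩
    simp only at h
    have h1 := abs_nonneg z.1
    have h2 := abs_nonneg z.2
    have h3 := le_abs_self z.2
    constructor <;> omega
  have hN2 : ∀ z ∈ C, z.2 < N := fun z hz => (hN z hz).2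
  set f : ℤ × ℤ → ZMod 2 := fun z => columnParity C A N z.1 (N - z.2).toNat with hf
  have hhor : ∀ x y : ℤ, y ≤ N → f (x, y) + f (x + 1, y) = edgeParity C A (x, y) (x + 1, y) := by
    intro x y hy
    have := columnParity_add hCA hA hN2 x (N - y).toNat
    rwa [Int.toNat_of_nonneg (by omega), sub_sub_cancel] at this
  have hver : ∀ x y : ℤ, y + 1 ≤ N → f (x, y) = f (x, y + 1) + edgeParity C A (x, y) (x, y + 1) := by
    intro x y hy
    have : (N - y).toNat = (N - (y + 1)).toNat + 1 := by omega
    simp only [hf]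
    rw [this, columnParity, Finset.sum_range_succ, ← columnParity,
      Int.toNat_of_nonneg (by omega : 0 ≤ N - (y + 1)), sub_sub_cancel]
    congr 2
    simp
  have hadd : ∀ a b : ZMod 2, a + b = 0 → a = b := by decide
  have hadj : ∀ u v, u ∈ C → v ∈ C → LatticeAdj u v → f u = f v := by
    rintro ⟨u1, u2⟩ ⟨v1, v2⟩ hu hv h
    have hu2 := hN2 _ hu
    have hv2 := hN2 _ hv
    simp only [LatticeAdj] at h hu2 hv2
    rcases h with ⟨rfl, rfl | rfl⟩ | ⟨rfl, rfl | rfl⟩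
    · rw [hver _ _ hv2.le, edgeParity_eq_zero' hCA hu hv, add_zero]
    · rw [hver _ _ hu2.le, edgeParity_eq_zero' hCA hv hu, add_zero]
    · exact hadd _ _ ((hhor _ _ hu2.le).trans (edgeParity_eq_zero' hCA hu hv))
    · exact (hadd _ _ ((hhor _ _ hu2.le).trans (edgeParity_eq_zero' hCA hv hu))).symm
  have hconst : ∀ z ∈ C, f z = f 0 := by
    intro z hz
    have := hconn z hz
    clear hz
    induction this with
    | refl => rfl
    | tail _ h ih => rw [← hadj _ _ h.1 h.2.1 h.2.2, ih]
  have hN0 : 0 ≤ N := by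
    have := (hN _ hk).1
    have := abs_nonneg (k - 1)
    simp only at *
    omega
  have hcol : ∀ x : ℤ, (∀ y, (x, y) ∉ C) → f (x, 0) = 0 := fun x hx => by
    simp only [hf, columnParity]
    exact Finset.sum_eq_zero fun i _ => edgeParity_eq_zero (hx _) (hx _)
  have hout : ∀ x : ℤ, N ≤ |x| → f (x, 0) = 0 := fun x hx =>
    hcol x fun y hy => absurd (hN _ hy).1 (not_lt.2 hx)
  have hright : f (k, 0) = 0 := by
    have hkN : k ≤ N := by
      have := (abs_lt.1 (hN _ hk).1).2
      simp only at this
      omega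
    have hind : ∀ n : ℕ, f (k, 0) = f (k + n, 0) := by
      intro n
      induction n with
      | zero => simp
      | succ n ih =>
        have h := hhor (k + n) 0 hN0
        rw [edgeParity_eq_zero (hk' _ (by omega)) (hk' _ (by omega))] at h
        rw [ih, hadd _ _ h]
        push_cast
        rw [add_assoc]
    rw [hind (N - k).toNat, Int.toNat_of_nonneg (by omega), add_sub_cancel]
    exact hout N (le_abs_self N)
  have hleft : f (l, 0) = 0 := by
    have hlN : -N ≤ l := by
      have := (abs_lt.1 (hN _ hl).1).1
      simp only at this
      omega
    have hind : ∀ n : ℕ, f (l, 0) = f (l - n, 0) := by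
      intro n
      induction n with
      | zero => simp
      | succ n ih =>
        have h := hhor (l - n - 1) 0 hN0
        rw [edgeParity_eq_zero (hl' _ (by omega)) (hl' _ (by omega)), sub_add_cancel] at h
        rw [ih, ← hadd _ _ h]
        push_cast
        rw [sub_add_eq_sub_sub]
    rw [hind (l + N).toNat, Int.toNat_of_nonneg (by omega)]
    exact hout _ (by rw [show l - (l + N) = -N by ring, abs_neg]; exact le_abs_self N)
  by_contra hlA
  have h1 := hhor (k - 1) 0 hN0
  have h2 := hhor l 0 hN0
  rw [sub_add_cancel, hright, edgeParity, if_pos (Or.inl ⟨hk, hkA⟩), hconst _ hk] at h1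
  rw [hleft, edgeParity, if_neg (by have := hl' l le_rfl; tauto), hconst _ hl] at h2
  rw [zero_add] at h2
  rw [h2] at h1
  exact absurd h1 (by decide)

/-- The graph of `*`-adjacent sites of a set. -/
def starGraph (B : Set (ℤ × ℤ)) : SimpleGraph (ℤ × ℤ) where
  Adj u v := u ≠ v ∧ LatticeNear u v ∧ u ∈ B ∧ v ∈ B
  symm := ⟨fun u v h => ⟨h.1.symm, by
    have := h.2.1
    simp only [LatticeNear, abs_sub_comm v.1, abs_sub_comm v.2]
    exact this, h.2.2.2, h.2.2.1⟩⟩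
  loopless := ⟨fun _ h => h.1 rfl⟩

theorem le_length_of_walk {B : Set (ℤ × ℤ)} {u v : ℤ × ℤ} (p : (starGraph B).Walk u v) :
    u.1 - v.1 ≤ p.length := by
  induction p with
  | nil => simp
  | cons h p ih =>
    have := (abs_le.1 h.2.1.1).2
    rw [SimpleGraph.Walk.length_cons]
    push_cast
    omega

/-- If the cluster of the origin is finite, there is a self-avoiding `*`-path of `k` sites outside
`𝒢` that starts at `(k, 0)`, for some `k ≥ 1`. -/
theorem exists_starPath_of_finite_cluster {𝒢 : Set (ℤ × ℤ)} (hfin : (cluster 𝒢).Finite) :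
    ∃ k : ℕ, 1 ≤ k ∧ ∃ w : ℕ → ℤ × ℤ, w 0 = ((k : ℤ), 0) ∧
      (∀ i, i + 1 < k → LatticeNear (w i) (w (i + 1))) ∧ InjOn w (Iio k) ∧ ∀ i < k, w i ∉ 𝒢 := by
  set C := cluster 𝒢 with hC
  have h0 : (0 : ℤ × ℤ) ∈ C := Relation.ReflTransGen.refl
  have hrow : {x : ℤ | (x, (0 : ℤ)) ∈ C}.Finite :=
    hfin.preimage (f := fun x : ℤ => (x, (0 : ℤ))) fun x _ y _ h => congrArg Prod.fst h
  obtain ⟨xr, hxr, hmax⟩ := exists_max_image _ id hrow ⟨0, h0⟩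
  obtain ⟨xl, hxl, hmin⟩ := exists_min_image _ id hrow ⟨0, h0⟩
  have hxr0 : 0 ≤ xr := hmax 0 h0
  have hxl0 : xl ≤ 0 := hmin 0 h0
  have hstep : ∀ u ∈ C, ∀ v, LatticeAdj u v → v ∈ 𝒢 → v ∈ C := fun u hu v huv hv =>
    Relation.ReflTransGen.tail hu ⟨hv, huv⟩
  have hconn : ∀ z ∈ C, Relation.ReflTransGen (fun u v => u ∈ C ∧ v ∈ C ∧ LatticeAdj u v) 0 z := by
    intro z hz
    induction hz with
    | refl => exact Relation.ReflTransGen.refl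
    | tail h h' ih => exact ih.tail ⟨h, hstep _ h _ h'.2 h'.1, h'.2⟩
  set B : Set (ℤ × ℤ) := {v | v ∉ C ∧ ∃ u ∈ C, LatticeAdj u v} with hB
  have hB𝒢 : ∀ v ∈ B, v ∉ 𝒢 := fun v ⟨hv, u, hu, huv⟩ hv𝒢 => hv (hstep u hu v huv hv𝒢)
  have hkB : (xr + 1, (0 : ℤ)) ∈ B := by
    refine ⟨fun h => ?_, (xr, 0), hxr, by simp [LatticeAdj]⟩
    have := hmax _ h
    simp only [id] at this
    omega
  set A : Set (ℤ × ℤ) := {v | v ∈ B ∧ (starGraph B).Reachable (xr + 1, 0) v} with hA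
  have hlA : (xl - 1, (0 : ℤ)) ∈ A := by
    refine mem_of_starConnected (C := C) (A := A) (Set.disjoint_left.2 fun z hz hzA => hzA.1.1 hz)
      ?_ hfin hconn (k := xr + 1) (by rwa [add_sub_cancel_right]) (fun x hx h => ?_)
      (by rwa [sub_add_cancel]) (fun x hx h => ?_) ⟨hkB, SimpleGraph.Reachable.refl _⟩
    · intro p hp u hu v hv huv hpv
      have hvB : v ∈ B := ⟨hv, u, hu, huv⟩
      refine ⟨hvB, hp.2.trans ?_⟩
      rcases eq_or_ne p v with rfl | hne
      · exact SimpleGraph.Reachable.refl _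
      · exact SimpleGraph.Adj.reachable (G := starGraph B) ⟨hne, hpv, hp.1, hvB⟩
    · have := hmax _ h
      simp only [id] at this
      omega
    · have := hmin _ h
      simp only [id] at this
      omega
  obtain ⟨p, hp⟩ := hlA.2.exists_isPath
  have hlen := le_length_of_walk p
  simp only at hlen
  refine ⟨(xr + 1).toNat, by omega, p.getVert, ?_, fun i hi => ?_, ?_, fun i hi => ?_⟩
  · rw [SimpleGraph.Walk.getVert_zero, Int.toNat_of_nonneg (by omega)]
  · exact (p.adj_getVert_succ (by omega)).2.1
  · intro i hi j hj hij
    simp only [mem_Iio] at hi hj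
    exact hp.getVert_injOn (by simp only [mem_ofPred_eq]; omega)
      (by simp only [mem_ofPred_eq]; omega) hij
  · exact hB𝒢 _ (p.adj_getVert_succ (i := i) (by omega)).2.2.1

end LineOfSight
end

noncomputable section
namespace LineOfSight

/-! ### Peierls' argument -/

/-- The path that starts at `(k, 0)` and whose steps are given by `s`. -/
def starPath (k : ℕ) (s : Fin k → Fin 3 × Fin 3) : ℕ → ℤ × ℤ
  | 0 => ((k : ℤ), 0)
  | i + 1 => starPath k s i +
      if h : i < k then (((s ⟨i, h⟩).1 : ℤ) - 1, ((s ⟨i, h⟩).2 : ℤ) - 1) else 0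

theorem exists_starPath_eq {k : ℕ} {w : ℕ → ℤ × ℤ} (h0 : w 0 = ((k : ℤ), 0))
    (hw : ∀ i, i + 1 < k → LatticeNear (w i) (w (i + 1))) :
    ∃ s : Fin k → Fin 3 × Fin 3, ∀ i < k, starPath k s i = w i := by
  have hex : ∀ i : Fin k, ∃ q : Fin 3 × Fin 3, (i : ℕ) + 1 < k →
      w (i + 1) = w i + ((q.1 : ℤ) - 1, (q.2 : ℤ) - 1) := by
    intro i
    by_cases hi : (i : ℕ) + 1 < k
    · obtain ⟨h1, h2⟩ := hw i hi
      rw [abs_le] at h1 h2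
      refine ⟨(⟨((w (i + 1)).1 - (w i).1 + 1).toNat, by omega⟩,
        ⟨((w (i + 1)).2 - (w i).2 + 1).toNat, by omega⟩), fun _ => ?_⟩
      ext
      · simp only [Prod.fst_add]
        rw [Int.toNat_of_nonneg (by omega)]
        ring
      · simp only [Prod.snd_add]
        rw [Int.toNat_of_nonneg (by omega)]
        ring
    · exact ⟨0, fun h => absurd h hi⟩
  choose s hs using hex
  refine ⟨s, fun i => ?_⟩
  induction i with
  | zero => intro _; rw [h0]; rfl
  | succ i ih =>
    intro hi
    rw [starPath, ih (by omega), dif_pos (by omega : i < k), ← hs ⟨i, by omega⟩ hi]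

/-- Sites of `I` are at distance at least `m` from each other. -/
def Separated (m : ℕ) (I : Finset (ℤ × ℤ)) : Prop :=
  ∀ z ∈ I, ∀ w ∈ I, z ≠ w → (m : ℤ) ≤ |z.1 - w.1| ∨ (m : ℤ) ≤ |z.2 - w.2|

theorem measure_starPath_le {Ω : Type*} [MeasurableSpace Ω] {P : Measure Ω}
    {𝒢 : Ω → Set (ℤ × ℤ)} {bad : Fin 3 → ℤ × ℤ → Set Ω}
    (h𝒢 : ∀ ω z, z ∉ 𝒢 ω → ∃ t, ω ∈ bad t z) {m : ℕ} (hm : 0 < m) {δ : ℝ≥0∞} (hδ : δ ≤ 1)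
    (hbad : ∀ t, ∀ I : Finset (ℤ × ℤ), Separated m I →
      P (⋂ z ∈ I, bad t z) ≤ (δ ^ (3 * (m * m))) ^ I.card) {k : ℕ}
    (w : ℕ → ℤ × ℤ) (hw : InjOn w (Iio k)) :
    P {ω | ∀ i < k, w i ∉ 𝒢 ω} ≤ 3 * (2 ^ k * δ ^ k) := by
  classical
  have : NeZero m := ⟨hm.ne'⟩
  set 𝒮 : Finset (Finset ℕ) := (Finset.range k).powerset.filter fun S =>
    k ≤ 3 * (m * m) * S.card ∧ Separated m (S.image w) with h𝒮
  have hsub : {ω | ∀ i < k, w i ∉ 𝒢 ω} ⊆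
      ⋃ t : Fin 3, ⋃ S ∈ 𝒮, ⋂ z ∈ S.image w, bad t z := by
    intro ω hω
    have hlab : ∀ i, ∃ t, i < k → ω ∈ bad t (w i) := fun i => by
      by_cases hi : i < k
      · obtain ⟨t, ht⟩ := h𝒢 ω _ (hω i hi)
        exact ⟨t, fun _ => ht⟩
      · exact ⟨0, fun h => absurd h hi⟩
    choose t ht using hlab
    let lab : ℕ → Fin 3 × (ZMod m × ZMod m) := fun i => (t i, ((w i).1, (w i).2))
    obtain ⟨l, hl⟩ : ∃ l, k ≤ 3 * (m * m) * ((Finset.range k).filter fun i => lab i = l).card := by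
      by_contra! hlt
      have h1 := Finset.card_eq_sum_card_fiberwise (f := lab) (s := Finset.range k)
        (t := Finset.univ) (fun _ _ => Finset.mem_coe.2 (Finset.mem_univ _))
      rw [Finset.card_range] at h1
      have hcard : Fintype.card (Fin 3 × (ZMod m × ZMod m)) = 3 * (m * m) := by
        simp [ZMod.card]
      have h2 : 3 * (m * m) * k < 3 * (m * m) * k := by
        calc 3 * (m * m) * k = ∑ l : Fin 3 × (ZMod m × ZMod m),
              3 * (m * m) * ((Finset.range k).filter fun i => lab i = l).card := by
                rw [← Finset.mul_sum, ← h1]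
          _ < ∑ l : Fin 3 × (ZMod m × ZMod m), k :=
                Finset.sum_lt_sum_of_nonempty Finset.univ_nonempty fun l _ => hlt l
          _ = 3 * (m * m) * k := by rw [Finset.sum_const, Finset.card_univ, hcard, smul_eq_mul]
      exact lt_irrefl _ h2
    set S := (Finset.range k).filter fun i => lab i = l with hS
    refine mem_iUnion.2 ⟨l.1, mem_iUnion₂.2 ⟨S, ?_, ?_⟩⟩
    · refine Finset.mem_filter.2 ⟨Finset.mem_powerset.2 (Finset.filter_subset _ _), hl, ?_⟩
      intro z hz z' hz' hne
      obtain ⟨i, hi, rfl⟩ := Finset.mem_image.1 hz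
      obtain ⟨j, hj, rfl⟩ := Finset.mem_image.1 hz'
      have hij : lab i = lab j :=
        (Finset.mem_filter.1 hi).2.trans (Finset.mem_filter.1 hj).2.symm
      simp only [lab, Prod.mk.injEq] at hij
      obtain ⟨-, h1, h2⟩ := hij
      rw [ZMod.intCast_eq_intCast_iff_dvd_sub] at h1 h2
      by_contra! hlt
      rw [abs_sub_comm, abs_sub_comm (w i).2] at hlt
      have e1 := Int.eq_zero_of_abs_lt_dvd h1 hlt.1
      have e2 := Int.eq_zero_of_abs_lt_dvd h2 hlt.2
      exact hne (Prod.ext (by omega) (by omega))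
    · refine mem_iInter₂.2 fun z hz => ?_
      obtain ⟨i, hi, rfl⟩ := Finset.mem_image.1 hz
      obtain ⟨hik, hil⟩ := Finset.mem_filter.1 hi
      rw [← hil]
      exact ht i (Finset.mem_range.1 hik)
  have hterm : ∀ t : Fin 3, ∀ S ∈ 𝒮, P (⋂ z ∈ S.image w, bad t z) ≤ δ ^ k := fun t S hS => by
    obtain ⟨hSk, hcard, hsep⟩ := Finset.mem_filter.1 hS
    refine (hbad t _ hsep).trans ?_
    rw [Finset.card_image_of_injOn (hw.mono fun i hi => by
      simpa using Finset.mem_powerset.1 hSk hi), ← pow_mul]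
    exact pow_le_pow_right_of_le_one' hδ hcard
  calc P {ω | ∀ i < k, w i ∉ 𝒢 ω} ≤ P (⋃ t : Fin 3, ⋃ S ∈ 𝒮, ⋂ z ∈ S.image w, bad t z) :=
        measure_mono hsub
    _ ≤ ∑ t : Fin 3, P (⋃ S ∈ 𝒮, ⋂ z ∈ S.image w, bad t z) := measure_iUnion_fintype_le _ _
    _ ≤ ∑ t : Fin 3, ∑ S ∈ 𝒮, P (⋂ z ∈ S.image w, bad t z) :=
        Finset.sum_le_sum fun t _ => measure_biUnion_finset_le _ _
    _ ≤ ∑ t : Fin 3, ∑ S ∈ 𝒮, δ ^ k :=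
        Finset.sum_le_sum fun t _ => Finset.sum_le_sum fun S hS => hterm t S hS
    _ ≤ ∑ t : Fin 3, 2 ^ k * δ ^ k := by
        refine Finset.sum_le_sum fun t _ => ?_
        rw [Finset.sum_const, nsmul_eq_mul]
        gcongr
        have : 𝒮.card ≤ 2 ^ k := by
          refine (Finset.card_filter_le _ _).trans ?_
          rw [Finset.card_powerset, Finset.card_range]
        exact_mod_cast this
    _ = 3 * (2 ^ k * δ ^ k) := by simp

/-- Peierls' argument for a dependent site percolation: if separated sites are simultaneously bad
with a sufficiently small probability, the origin has an infinite good cluster with positive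
probability. No measurability is needed. -/
theorem measure_finite_cluster_lt_one {Ω : Type*} [MeasurableSpace Ω] {P : Measure Ω}
    {𝒢 : Ω → Set (ℤ × ℤ)} {bad : Fin 3 → ℤ × ℤ → Set Ω}
    (h𝒢 : ∀ ω z, z ∉ 𝒢 ω → ∃ t, ω ∈ bad t z) {m : ℕ} (hm : 0 < m)
    (hbad : ∀ t, ∀ I : Finset (ℤ × ℤ), Separated m I →
      P (⋂ z ∈ I, bad t z) ≤ (((1 / 144 : ℝ≥0∞)) ^ (3 * (m * m))) ^ I.card) :
    P {ω | 0 ∉ 𝒢 ω ∨ (cluster (𝒢 ω)).Finite} < 1 := by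
  classical
  set δ : ℝ≥0∞ := 1 / 144 with hδ
  have hδ1 : δ ≤ 1 := by
    rw [hδ]; exact ENNReal.div_le_of_le_mul (by norm_num)
  have hsub : {ω | (cluster (𝒢 ω)).Finite} ⊆ ⋃ k : ℕ, ⋃ s : Fin (k + 1) → Fin 3 × Fin 3,
      ⋃ _ : InjOn (starPath (k + 1) s) (Iio (k + 1)),
        {ω | ∀ i < k + 1, starPath (k + 1) s i ∉ 𝒢 ω} := by
    intro ω hω
    obtain ⟨k, hk, w, h0, hnear, hinj, hw⟩ := exists_starPath_of_finite_cluster hω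
    obtain ⟨k, rfl⟩ : ∃ j, k = j + 1 := ⟨k - 1, by omega⟩
    obtain ⟨s, hs⟩ := exists_starPath_eq h0 hnear
    refine mem_iUnion.2 ⟨k, mem_iUnion.2 ⟨s, mem_iUnion.2 ⟨?_, fun i hi => ?_⟩⟩⟩
    · intro i hi j hj hij
      rw [hs i hi, hs j hj] at hij
      exact hinj hi hj hij
    · rw [hs i hi]; exact hw i hi
  have hk : ∀ k : ℕ, P (⋃ s : Fin (k + 1) → Fin 3 × Fin 3,
      ⋃ _ : InjOn (starPath (k + 1) s) (Iio (k + 1)),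
        {ω | ∀ i < k + 1, starPath (k + 1) s i ∉ 𝒢 ω}) ≤ 3 * (1 / 8) ^ (k + 1) := fun k => by
    calc _ ≤ ∑ s : Fin (k + 1) → Fin 3 × Fin 3, P (⋃ _ : InjOn (starPath (k + 1) s) (Iio (k + 1)),
          {ω | ∀ i < k + 1, starPath (k + 1) s i ∉ 𝒢 ω}) := measure_iUnion_fintype_le _ _
      _ ≤ ∑ s : Fin (k + 1) → Fin 3 × Fin 3, 3 * (2 ^ (k + 1) * δ ^ (k + 1)) := by
          refine Finset.sum_le_sum fun s _ => ?_
          by_cases hinj : InjOn (starPath (k + 1) s) (Iio (k + 1))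
          · simp only [hinj, iUnion_true]
            exact measure_starPath_le h𝒢 hm hδ1 hbad _ hinj
          · simp [hinj]
      _ = 3 * (1 / 8) ^ (k + 1) := by
          rw [Finset.sum_const, Finset.card_univ, Fintype.card_fun, Fintype.card_prod,
            Fintype.card_fin, Fintype.card_fin, nsmul_eq_mul]
          push_cast
          rw [mul_left_comm, ← mul_pow, ← mul_pow]
          congr 2
          rw [hδ]
          rw [← ENNReal.toReal_eq_toReal_iff' (by finiteness) (by finiteness)]
          simp
          norm_num
  have hfin : P {ω | (cluster (𝒢 ω)).Finite} ≤ 3 * ((1 / 8) * (1 - 1 / 8)⁻¹) := by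
    calc P {ω | (cluster (𝒢 ω)).Finite} ≤ ∑' k : ℕ, 3 * (1 / 8 : ℝ≥0∞) ^ (k + 1) :=
          (measure_mono hsub).trans ((measure_iUnion_le _).trans (ENNReal.tsum_le_tsum hk))
      _ = 3 * ((1 / 8) * (1 - 1 / 8)⁻¹) := by
          simp_rw [pow_succ']
          rw [ENNReal.tsum_mul_left, ENNReal.tsum_mul_left, ENNReal.tsum_geometric]
  have hzero : P {ω | 0 ∉ 𝒢 ω} ≤ 3 * (2 * δ) := by
    have h := measure_starPath_le h𝒢 hm hδ1 hbad (k := 1) (fun _ => 0)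
      (fun i hi j hj _ => by simp only [mem_Iio, Nat.lt_one_iff] at hi hj; rw [hi, hj])
    simpa using h
  calc P {ω | 0 ∉ 𝒢 ω ∨ (cluster (𝒢 ω)).Finite}
      ≤ P {ω | 0 ∉ 𝒢 ω} + P {ω | (cluster (𝒢 ω)).Finite} := measure_union_le _ _
    _ ≤ 3 * (2 * δ) + 3 * ((1 / 8) * (1 - 1 / 8)⁻¹) := add_le_add hzero hfin
    _ < 1 := by
        have h18 : (1 / 8 : ℝ≥0∞) = ENNReal.ofReal (1 / 8) := by
          rw [ENNReal.ofReal_div_of_pos (by norm_num)]; simp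
        have h144 : δ = ENNReal.ofReal (1 / 144) := by
          rw [hδ, ENNReal.ofReal_div_of_pos (by norm_num)]; simp
        rw [h18, h144, ← ENNReal.ofReal_one, ← ENNReal.ofReal_sub _ (by norm_num),
          ← ENNReal.ofReal_inv_of_pos (by norm_num), ← ENNReal.ofReal_mul (by norm_num),
          show (3 : ℝ≥0∞) = ENNReal.ofReal 3 by simp, ← ENNReal.ofReal_mul (by norm_num),
          show (2 : ℝ≥0∞) = ENNReal.ofReal 2 by simp, ← ENNReal.ofReal_mul (by norm_num),
          ← ENNReal.ofReal_mul (by norm_num), ← ENNReal.ofReal_add (by norm_num) (by norm_num)]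
        exact (ENNReal.ofReal_lt_ofReal_iff (by norm_num)).2 (by norm_num)

end LineOfSight
end

noncomputable section
namespace LineOfSight

variable {d : ℕ} {η X Y : Config d}

/-! ### Open blocks -/

/-- The streets contain a segment of length `l` inside `B`. -/
def HasStreetSegment (η : Config d) (B : Set (Space d)) (l : ℝ) : Prop :=
  ∃ p q : Space d, dist p q = l ∧ segment ℝ p q ⊆ B ∩ ⋃₀ streets η

/-- The test balls of the block of centre `c` and scale `a`. -/
def testBall (c : Space d) (a κ : ℝ) (g : Space d) : Set (Space d) :=
  Metric.closedBall (c + a • g) (κ * a / 2)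

/-- A regular block all of whose test balls with a crossroad or a piece of street contain a relay,
respectively a user. -/
structure IsOpenBlock (η X Y : Config d) (W : Finset (Space d)) (c : Space d) (a r κ : ℝ) :
    Prop where
  regular : IsRegular η c a r κ
  user : ∀ g ∈ W, HasStreetSegment η (testBall c a κ g) (κ * a / 4) →
    Config.count (testBall c a κ g) X ≠ 0
  relay : ∀ g ∈ W, (crossroads η ∩ testBall c a κ g).Nonempty →
    Config.count (testBall c a κ g) Y ≠ 0

theorem exists_dist_le_of_net {W : Finset (Space d)} {κ : ℝ}
    (hW : Metric.closedBall (0 : Space d) 6 ⊆ ⋃ g ∈ W, Metric.closedBall g (κ / 4)) {c : Space d}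
    {a : ℝ} (ha : 0 < a) {x : Space d} (hx : x ∈ Metric.closedBall c (6 * a)) :
    ∃ g ∈ W, dist x (c + a • g) ≤ κ * a / 4 := by
  obtain ⟨u, rfl⟩ := add_smul_surjective (c := c) ha x
  rw [Metric.mem_closedBall, dist_eq_norm, add_sub_cancel_left, norm_smul,
    Real.norm_of_nonneg ha.le, mul_comm (6 : ℝ), mul_le_mul_iff_right₀ ha] at hx
  obtain ⟨g, hg, hug⟩ := mem_iUnion₂.1 (hW (mem_closedBall_zero_iff.2 hx))
  refine ⟨g, hg, ?_⟩
  rw [dist_add_smul ha]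
  rw [Metric.mem_closedBall] at hug
  nlinarith

variable {W : Finset (Space d)} {c : Space d} {a r κ : ℝ}

theorem IsOpenBlock.mem_relays (h : IsOpenBlock η X Y W c a r κ) (ha : 0 < a) (hκ : 0 < κ)
    (hκr : κ ≤ r / 8)
    (hW : Metric.closedBall (0 : Space d) 6 ⊆ ⋃ g ∈ W, Metric.closedBall g (κ / 4))
    (hY : Y.carrier ⊆ crossroads η) {v : Space d} (hv : v ∈ crossroads η)
    (hvc : v ∈ Metric.closedBall c (6 * a)) : v ∈ Y.carrier := by
  obtain ⟨g, hg, hvg⟩ := exists_dist_le_of_net hW ha hvc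
  have hκa : 0 < κ * a := by positivity
  obtain ⟨y, hy, hyg⟩ := count_ne_zero.1 (h.relay g hg ⟨v, hv, by
    rw [testBall, Metric.mem_closedBall]; linarith⟩)
  rw [testBall, Metric.mem_closedBall] at hyg
  have hra : κ * a ≤ r * a := by nlinarith
  rw [dist_comm] at hvg
  have := h.regular.eq_of_mem_crossroads v hvc y (hY hy) v hv
    (by rw [Metric.mem_closedBall]; linarith [dist_triangle y (c + a • g) v])
    (Metric.mem_closedBall_self (by linarith))
  rwa [← this]

/-- Near a point of a street that is not close to a crossroad there is a user on this street. -/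
theorem IsOpenBlock.exists_user (h : IsOpenBlock η X Y W c a r κ) (ha : 0 < a) (hκ : 0 < κ)
    (hκr : κ ≤ r / 8)
    (hW : Metric.closedBall (0 : Space d) 6 ⊆ ⋃ g ∈ W, Metric.closedBall g (κ / 4))
    (hX : X.carrier ⊆ skeleton η (d - 1)) {v w q : Space d} (he : segment ℝ v w ∈ streets η)
    (hq : q ∈ segment ℝ v w) (hqc : q ∈ Metric.closedBall c (6 * a))
    (hfree : ∀ u ∈ crossroads η, u ∉ Metric.closedBall q (r * a / 4)) :
    ∃ x ∈ X.carrier, x ∈ segment ℝ v w ∧ dist x q ≤ κ * a := by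
  have hκa : 0 < κ * a := by positivity
  have hκra : κ * a ≤ r * a / 8 := by nlinarith
  have hvc := mem_crossroads_of_street_eq_segment he
  have hwc : w ∈ crossroads η := by
    rw [segment_symm] at he; exact mem_crossroads_of_street_eq_segment he
  have hqv : r * a / 4 < dist v q := by simpa [Metric.mem_closedBall] using hfree v hvc
  have hqw : r * a / 4 < dist w q := by simpa [Metric.mem_closedBall] using hfree w hwc
  obtain ⟨g, hg, hqg⟩ := exists_dist_le_of_net hW ha hqc
  -- a piece of the street starting at `q`
  set t := κ * a / 4 / dist q v with ht
  have hdpos : 0 < dist q v := by rw [dist_comm]; linarith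
  have ht1 : t ∈ Icc (0 : ℝ) 1 := by
    refine ⟨by positivity, ?_⟩
    rw [ht, div_le_one hdpos, dist_comm]
    linarith
  set p := AffineMap.lineMap (k := ℝ) q v t with hp
  have hqp : dist q p = κ * a / 4 := by
    rw [hp, dist_left_lineMap, Real.norm_of_nonneg ht1.1, ht]
    field_simp
  have hpe : p ∈ segment ℝ v w :=
    (convex_segment v w).lineMap_mem hq (left_mem_segment ℝ v w) ht1
  have hsub : segment ℝ q p ⊆ testBall c a κ g ∩ ⋃₀ streets η := by
    refine subset_inter ?_ ?_
    · refine (convex_closedBall _ _).segment_subset ?_ ?_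
      · rw [Metric.mem_closedBall]; linarith
      · rw [Metric.mem_closedBall]
        rw [dist_comm] at hqp
        linarith [dist_triangle p q (c + a • g)]
    · exact ((convex_segment v w).segment_subset hq hpe).trans (subset_sUnion_of_mem he)
  obtain ⟨x, hx, hxg⟩ := count_ne_zero.1 (h.user g hg ⟨q, p, hqp, hsub⟩)
  rw [testBall, Metric.mem_closedBall] at hxg
  have hxq : dist x q ≤ κ * a := by
    rw [dist_comm] at hqg
    linarith [dist_triangle x (c + a • g) q]
  refine ⟨x, hx, ?_, hxq⟩
  have hcol : Collinear ℝ (skeleton η (d - 1) ∩ Metric.closedBall q (κ * a)) :=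
    h.regular.collinear q hqc hfree
  have hsk := facet_subset_skeleton he
  have hqS : q ∈ skeleton η (d - 1) ∩ Metric.closedBall q (κ * a) :=
    ⟨hsk hq, Metric.mem_closedBall_self hκa.le⟩
  have hpS : p ∈ skeleton η (d - 1) ∩ Metric.closedBall q (κ * a) :=
    ⟨hsk hpe, by rw [Metric.mem_closedBall, dist_comm]; linarith⟩
  have hxS : x ∈ skeleton η (d - 1) ∩ Metric.closedBall q (κ * a) := ⟨hX hx, hxq⟩
  have hne : q ≠ p := fun h => by rw [← h, dist_self] at hqp; linarith
  have hxl := hcol.mem_affineSpan_of_mem_of_ne hqS hpS hxS hne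
  have hseg : segment ℝ v w ⊆ (affineSpan ℝ {v, w} : Set (Space d)) := fun y hy => by
    rw [← affineSegment_eq_segment] at hy
    exact Wbtw.mem_affineSpan hy
  have hxvw : x ∈ affineSpan ℝ {v, w} :=
    affineSpan_pair_le_of_mem_of_mem (hseg hq) (hseg hpe) hxl
  have hcol3 : Collinear ℝ {x, v, w} := collinear_insert_of_mem_affineSpan_pair hxvw
  have hdq : dist v q + dist q w = dist v w := by
    rw [← affineSegment_eq_segment] at hq
    exact Wbtw.dist_add_dist hq
  rw [← affineSegment_eq_segment]
  rcases hcol3.wbtw_or_wbtw_or_wbtw with h1 | h1 | h1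
  · exfalso
    have h2 := h1.dist_add_dist
    have h3 := dist_triangle x q w
    have := dist_nonneg (x := x) (y := v)
    linarith
  · exfalso
    have h2 := h1.dist_add_dist
    have h3 := dist_triangle v q x
    have := dist_nonneg (x := w) (y := x)
    rw [dist_comm q x] at h3
    rw [dist_comm q w] at hdq
    linarith
  · exact h1.symm

/-- Equality or connectedness in the connectivity graph. -/
def Linked (R : ℝ≥0∞) (η X Y : Config d) (v w : Space d) : Prop :=
  v = w ∨ ∃ (hv : v ∈ X.carrier ∪ Y.carrier) (hw : w ∈ X.carrier ∪ Y.carrier),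
    (connectivityGraph R η X Y).Reachable ⟨v, hv⟩ ⟨w, hw⟩

theorem Linked.trans {R : ℝ≥0∞} {u v w : Space d} (h : Linked R η X Y u v)
    (h' : Linked R η X Y v w) : Linked R η X Y u w := by
  rcases h with rfl | ⟨hu, hv, h⟩
  · exact h'
  rcases h' with rfl | ⟨hv', hw, h'⟩
  · exact Or.inr ⟨hu, hv, h⟩
  · exact Or.inr ⟨hu, hw, h.trans h'⟩

theorem IsOpenBlock.linked_of_mem_street (h : IsOpenBlock η X Y W c a r κ) (ha : 0 < a)
    (hκ : 0 < κ) (hκr : κ ≤ r / 8)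
    (hW : Metric.closedBall (0 : Space d) 6 ⊆ ⋃ g ∈ W, Metric.closedBall g (κ / 4))
    (hX : X.carrier ⊆ skeleton η (d - 1)) (hY : Y.carrier ⊆ crossroads η) {R : ℝ≥0∞}
    (hR : ENNReal.ofReal (3 * r * a) ≤ R) {e : Set (Space d)} (he : e ∈ streets η)
    (hec : e ⊆ Metric.closedBall c (6 * a)) {v w : Space d} (hv : v ∈ e) (hw : w ∈ e)
    (hvc : v ∈ crossroads η) (hwc : w ∈ crossroads η) : Linked R η X Y v w := by
  have hr : 0 < r := by linarith
  have hra : 0 < r * a := by positivity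
  have hκa : 0 < κ * a := by positivity
  have hκra : κ * a ≤ r * a / 8 := by nlinarith
  obtain ⟨v', w', hvw', rfl, hv'c, hw'c⟩ := exists_street_eq_segment he
    ((isCompact_closedBall c (6 * a)).of_isClosed_subset (isClosed_of_mem_facets he) hec)
  have hrelay : ∀ u ∈ segment ℝ v' w', u ∈ crossroads η → u ∈ X.carrier ∪ Y.carrier :=
    fun u hu huc => Or.inr (h.mem_relays ha hκ hκr hW hY huc (hec hu))
  have hnear : ∀ x ∈ segment ℝ v' w', ∃ z ∈ X.carrier ∪ Y.carrier, z ∈ segment ℝ v' w' ∧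
      dist x z ≤ 3 / 2 * (r * a) := by
    intro x hx
    have hmove : ∀ u ∈ segment ℝ v' w', 3 / 4 * (r * a) ≤ dist x u →
        ∃ z ∈ X.carrier ∪ Y.carrier, z ∈ segment ℝ v' w' ∧ dist x z ≤ 3 / 2 * (r * a) := by
      intro u hu hxu
      set t := 3 / 4 * (r * a) / dist x u with ht
      have hpos : 0 < dist x u := by linarith
      have ht1 : t ∈ Icc (0 : ℝ) 1 := by
        refine ⟨by positivity, ?_⟩
        rwa [ht, div_le_one hpos]
      set x' := AffineMap.lineMap (k := ℝ) x u t with hx'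
      have hxx' : dist x x' = 3 / 4 * (r * a) := by
        rw [hx', dist_left_lineMap, Real.norm_of_nonneg ht1.1, ht]
        field_simp
      have hx'e : x' ∈ segment ℝ v' w' := (convex_segment v' w').lineMap_mem hx hu ht1
      have hfree : (∀ u ∈ crossroads η, u ∉ Metric.closedBall x (r * a / 4)) ∨
          ∀ u ∈ crossroads η, u ∉ Metric.closedBall x' (r * a / 4) := by
        by_contra! hcon
        obtain ⟨⟨p, hp, hpx⟩, q, hq, hqx⟩ := hcon
        rw [Metric.mem_closedBall] at hpx hqx
        have hpq := h.regular.eq_of_mem_crossroads x (hec hx) p hp q hq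
          (by rw [Metric.mem_closedBall]; linarith)
          (by rw [Metric.mem_closedBall]
              rw [dist_comm] at hxx'
              linarith [dist_triangle q x' x])
        subst hpq
        rw [dist_comm] at hpx
        linarith [dist_triangle x p x']
      rcases hfree with hf | hf
      · obtain ⟨z, hz, hze, hzx⟩ := h.exists_user ha hκ hκr hW hX he hx (hec hx) hf
        rw [dist_comm] at hzx
        exact ⟨z, Or.inl hz, hze, by linarith⟩
      · obtain ⟨z, hz, hze, hzx⟩ := h.exists_user ha hκ hκr hW hX he hx'e (hec hx'e) hf
        rw [dist_comm] at hzx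
        exact ⟨z, Or.inl hz, hze, by linarith [dist_triangle x x' z]⟩
    by_cases h1 : 3 / 4 * (r * a) ≤ dist x v'
    · exact hmove v' (left_mem_segment ℝ v' w') h1
    · exact ⟨v', hrelay v' (left_mem_segment ℝ v' w') hv'c, left_mem_segment ℝ v' w', by linarith⟩
  set ι : Type := {z : Space d // z ∈ X.carrier ∪ Y.carrier ∧ z ∈ segment ℝ v' w'}
  have hbdd : Bornology.IsBounded (segment ℝ v' w') := Metric.isBounded_closedBall.subset hec
  have : Finite ι := by
    refine Finite.to_subtype (s := {z | z ∈ X.carrier ∪ Y.carrier ∧ z ∈ segment ℝ v' w'}) ?_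
    refine ((X.finite_inter_of_isBounded hbdd).union (Y.finite_inter_of_isBounded hbdd)).subset ?_
    rintro z ⟨hz | hz, hze⟩
    exacts [Or.inl ⟨hz, hze⟩, Or.inr ⟨hz, hze⟩]
  refine forall_of_isPreconnected_of_cover (convex_segment v' w').isPreconnected
    (C := fun z : ι => Metric.closedBall z.1 (3 / 2 * (r * a)))
    (fun _ => Metric.isClosed_closedBall) (fun x hx => ?_)
    (fun z => ⟨z.1, z.2.2, Metric.mem_closedBall_self (by positivity)⟩)
    (p := fun z => Linked R η X Y v z.1) (i₀ := ⟨v, hrelay v hv hvc, hv⟩) (Or.inl rfl) ?_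
    ⟨w, hrelay w hw hwc, hw⟩
  · obtain ⟨z, hz, hze, hxz⟩ := hnear x hx
    exact mem_iUnion.2 ⟨⟨z, hz, hze⟩, hxz⟩
  · rintro ⟨z, hz, hze⟩ ⟨z', hz', hze'⟩ hlink ⟨x, -, hxz, hxz'⟩
    refine Linked.trans hlink ?_
    rcases eq_or_ne z z' with rfl | hne
    · exact Or.inl rfl
    refine Or.inr ⟨hz, hz', SimpleGraph.Adj.reachable ?_⟩
    refine ⟨fun h => hne (congrArg Subtype.val h), ⟨_, he, hze, hze'⟩, le_trans ?_ hR⟩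
    rw [edist_dist]
    refine ENNReal.ofReal_le_ofReal ?_
    simp only [Metric.mem_closedBall] at hxz hxz'
    rw [dist_comm] at hxz
    linarith [dist_triangle z x z']

theorem IsOpenBlock.linked_of_mem_hubs (h : IsOpenBlock η X Y W c a r κ) (ha : 0 < a)
    (hκ : 0 < κ) (hκr : κ ≤ r / 8)
    (hW : Metric.closedBall (0 : Space d) 6 ⊆ ⋃ g ∈ W, Metric.closedBall g (κ / 4))
    (hX : X.carrier ⊆ skeleton η (d - 1)) (hY : Y.carrier ⊆ crossroads η) {R : ℝ≥0∞}
    (hR : ENNReal.ofReal (3 * r * a) ≤ R) {v w : Space d} (hv : v ∈ hubs η c a)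
    (hw : w ∈ hubs η c a) : Linked R η X Y v w :=
  h.regular.covers.rel_of_mem_hubs (Rel := Linked R η X Y) (by linarith) (by positivity) (fun _ => Or.inl rfl)
    (fun _ _ _ => Linked.trans) (fun _ he hec _ hv _ hw hvc hwc =>
      h.linked_of_mem_street ha hκ hκr hW hX hY hR he
        (hec.trans (Metric.closedBall_subset_closedBall (by linarith))) hv hw hvc hwc) hv hw

theorem IsOpenBlock.mem_relays_of_mem_hubs (h : IsOpenBlock η X Y W c a r κ) (ha : 0 < a)
    (hκ : 0 < κ) (hκr : κ ≤ r / 8)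
    (hW : Metric.closedBall (0 : Space d) 6 ⊆ ⋃ g ∈ W, Metric.closedBall g (κ / 4))
    (hY : Y.carrier ⊆ crossroads η) {v : Space d} (hv : v ∈ hubs η c a) : v ∈ Y.carrier :=
  h.mem_relays ha hκ hκr hW hY hv.1 (Metric.closedBall_subset_closedBall (by linarith)
    (h.regular.covers.hubs_subset (by linarith) (by positivity) hv))

/-! ### The planar lattice of blocks -/

/-- The centre of the block with index `z`. -/
def blockCenter (hd : 2 ≤ d) (a : ℝ) (z : ℤ × ℤ) : Space d :=
  (a * z.1) • EuclideanSpace.single ⟨0, by omega⟩ (1 : ℝ) +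
    (a * z.2) • EuclideanSpace.single ⟨1, by omega⟩ (1 : ℝ)

theorem blockCenter_sub_apply_zero (hd : 2 ≤ d) (a : ℝ) (z w : ℤ × ℤ) :
    (blockCenter hd a z - blockCenter hd a w) ⟨0, by omega⟩ = a * (z.1 - w.1) := by
  simp [blockCenter, mul_sub]

theorem blockCenter_sub_apply_one (hd : 2 ≤ d) (a : ℝ) (z w : ℤ × ℤ) :
    (blockCenter hd a z - blockCenter hd a w) ⟨1, by omega⟩ = a * (z.2 - w.2) := by
  simp [blockCenter, mul_sub]

theorem mul_abs_le_dist_blockCenter (hd : 2 ≤ d) {a : ℝ} (ha : 0 < a) (z w : ℤ × ℤ) :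
    a * |z.1 - w.1| ≤ dist (blockCenter hd a z) (blockCenter hd a w) ∧
      a * |z.2 - w.2| ≤ dist (blockCenter hd a z) (blockCenter hd a w) := by
  rw [dist_eq_norm]
  have h1 := PiLp.norm_apply_le (blockCenter hd a z - blockCenter hd a w) ⟨0, by omega⟩
  have h2 := PiLp.norm_apply_le (blockCenter hd a z - blockCenter hd a w) ⟨1, by omega⟩
  rw [blockCenter_sub_apply_zero, norm_mul, Real.norm_of_nonneg ha.le, Real.norm_eq_abs] at h1
  rw [blockCenter_sub_apply_one, norm_mul, Real.norm_of_nonneg ha.le, Real.norm_eq_abs] at h2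
  push_cast
  exact ⟨h1, h2⟩

theorem dist_blockCenter_of_adj (hd : 2 ≤ d) {a : ℝ} (ha : 0 < a) {z w : ℤ × ℤ}
    (h : LatticeAdj z w) : dist (blockCenter hd a w) (blockCenter hd a z) = a := by
  rw [dist_eq_norm]
  obtain ⟨z1, z2⟩ := z
  obtain ⟨w1, w2⟩ := w
  simp only [LatticeAdj] at h
  have key : ∀ (b₁ b₂ c₁ c₂ : ℝ) (e f : Space d),
      b₁ • e + b₂ • f - (c₁ • e + c₂ • f) = (b₁ - c₁) • e + (b₂ - c₂) • f := by
    intros; module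
  rw [blockCenter, blockCenter, key]
  rcases h with ⟨rfl, rfl | rfl⟩ | ⟨rfl, rfl | rfl⟩ <;>
    · simp only [sub_self, zero_smul, zero_add, add_zero, ← mul_sub, norm_smul, PiLp.norm_single]
      push_cast
      simp [abs_of_pos ha]

/-- An infinite cluster of open blocks makes the connectivity graph percolate. -/
theorem percolates_of_infinite_cluster (hd : 2 ≤ d) (ha : 0 < a) (hκ : 0 < κ) (hκr : κ ≤ r / 8)
    (hW : Metric.closedBall (0 : Space d) 6 ⊆ ⋃ g ∈ W, Metric.closedBall g (κ / 4))
    (hX : X.carrier ⊆ skeleton η (d - 1)) (hY : Y.carrier ⊆ crossroads η) {R : ℝ≥0∞}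
    (hR : ENNReal.ofReal (3 * r * a) ≤ R) {𝒢 : Set (ℤ × ℤ)}
    (h𝒢 : ∀ z ∈ 𝒢, IsOpenBlock η X Y W (blockCenter hd a z) a r κ)
    (h0 : 0 ∈ 𝒢) (hinf : (cluster 𝒢).Infinite) : Percolates (connectivityGraph R η X Y) := by
  -- the hubs of neighbouring blocks intersect
  have hshare : ∀ z ∈ 𝒢, ∀ w, LatticeAdj z w → ∃ v ∈ hubs η (blockCenter hd a z) a,
      v ∈ hubs η (blockCenter hd a w) a := by
    intro z hz w hzw
    obtain ⟨v, hv, -, hall⟩ := (h𝒢 z hz).regular.covers.exists_mem_hubs (t := a)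
      (by linarith) (by positivity) (x := blockCenter hd a w)
      (by rw [Metric.mem_closedBall, dist_blockCenter_of_adj hd ha hzw])
    exact ⟨v, hv, hall _ a (by simpa using ha.le)⟩
  have hhub : ∀ z ∈ 𝒢, (hubs η (blockCenter hd a z) a).Nonempty := by
    intro z hz
    obtain ⟨v, hv, -⟩ := (h𝒢 z hz).regular.covers.exists_mem_hubs (t := a)
      (by linarith) (by positivity) (x := blockCenter hd a z) (by simpa using ha.le)
    exact ⟨v, hv⟩
  have hlink : ∀ z ∈ 𝒢, ∀ v ∈ hubs η (blockCenter hd a z) a,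
      ∀ w ∈ hubs η (blockCenter hd a z) a, Linked R η X Y v w := fun z hz v hv w hw =>
    (h𝒢 z hz).linked_of_mem_hubs ha hκ hκr hW hX hY hR hv hw
  have hcl : ∀ z ∈ cluster 𝒢, z ∈ 𝒢 := by
    intro z hz
    rcases Relation.ReflTransGen.cases_tail hz with h | ⟨y, -, h⟩
    · rwa [h]
    · exact h.1
  obtain ⟨v₀, hv₀⟩ := hhub 0 h0
  have hlink₀ : ∀ z ∈ cluster 𝒢, ∀ v ∈ hubs η (blockCenter hd a z) a, Linked R η X Y v₀ v := by
    intro z hz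
    induction hz with
    | refl => exact fun v hv => hlink 0 h0 v₀ hv₀ v hv
    | tail hy hyz ih =>
      intro v hv
      obtain ⟨u, huy, huz⟩ := hshare _ (hcl _ hy) _ hyz.2
      exact (ih u huy).trans (hlink _ hyz.1 u huz v hv)
  have hrelay : ∀ z ∈ 𝒢, ∀ v ∈ hubs η (blockCenter hd a z) a, v ∈ Y.carrier := fun z hz v hv =>
    (h𝒢 z hz).mem_relays_of_mem_hubs ha hκ hκr hW hY hv
  set S : Set (Space d) := ⋃ z ∈ cluster 𝒢, hubs η (blockCenter hd a z) a with hS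
  have hSinf : S.Infinite := by
    intro hfin
    obtain ⟨M, hM⟩ := hfin.isBounded.subset_closedBall (blockCenter hd a 0)
    have hdist : ∀ z ∈ cluster 𝒢,
        dist (blockCenter hd a z) (blockCenter hd a 0) ≤ M + 5 * a := by
      intro z hz
      obtain ⟨v, hv⟩ := hhub z (hcl z hz)
      have h1 : v ∈ Metric.closedBall (blockCenter hd a 0) M := hM (mem_iUnion₂.2 ⟨z, hz, hv⟩)
      have h2 := (h𝒢 z (hcl z hz)).regular.covers.hubs_subset (by linarith) (by positivity) hv
      rw [Metric.mem_closedBall] at h1 h2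
      rw [dist_comm] at h2
      linarith [dist_triangle (blockCenter hd a z) v (blockCenter hd a 0)]
    obtain ⟨N, hN⟩ := exists_nat_ge ((M + 5 * a) / a)
    rw [div_le_iff₀ ha] at hN
    refine hinf (((finite_Icc (-(N : ℤ)) N).prod (finite_Icc (-(N : ℤ)) N)).subset fun z hz => ?_)
    obtain ⟨h1, h2⟩ := mul_abs_le_dist_blockCenter hd ha z 0
    have h3 := hdist z hz
    have hbd : ∀ i : ℤ, a * |(i : ℝ)| ≤ M + 5 * a → i ∈ Icc (-(N : ℤ)) N := by
      intro i hi
      have : |(i : ℝ)| ≤ N := by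
        by_contra! hlt
        nlinarith
      rw [mem_Icc, ← abs_le]
      exact_mod_cast this
    refine mem_prod.2 ⟨hbd _ ?_, hbd _ ?_⟩
    · simp only [Prod.fst_zero, sub_zero] at h1
      push_cast at h1
      exact h1.trans h3
    · simp only [Prod.snd_zero, sub_zero] at h2
      push_cast at h2
      exact h2.trans h3
  have hv₀V : v₀ ∈ X.carrier ∪ Y.carrier := Or.inr (hrelay 0 h0 v₀ hv₀)
  refine ⟨(connectivityGraph R η X Y).connectedComponentMk ⟨v₀, hv₀V⟩, fun hfin => hSinf ?_⟩
  refine (hfin.image Subtype.val).subset fun v hv => ?_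
  obtain ⟨z, hz, hvz⟩ := mem_iUnion₂.1 hv
  refine ⟨⟨v, Or.inr (hrelay z (hcl z hz) v hvz)⟩, ?_, rfl⟩
  rw [SimpleGraph.ConnectedComponent.mem_supp_iff, SimpleGraph.ConnectedComponent.eq]
  rcases hlink₀ z hz v hvz with rfl | ⟨_, _, h⟩
  · rfl
  · exact h.symm

end LineOfSight
end

noncomputable section
namespace LineOfSight

variable {d : ℕ} {η : Config d}

/-! ### Bounds for users and relays -/

theorem measure_iInter_iUnion_le {Ω : Type*} [MeasurableSpace Ω] {P : Measure Ω} {ι γ : Type*}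
    (I : Finset ι) (W : Finset γ) (A : ι → γ → Set Ω) {q : ℝ≥0∞}
    (h : ∀ f : I → γ, (∀ i, f i ∈ W) → P (⋂ i : I, A i (f i)) ≤ q ^ I.card) :
    P (⋂ i ∈ I, ⋃ g ∈ W, A i g) ≤ (W.card * q) ^ I.card := by
  classical
  have hsub : (⋂ i ∈ I, ⋃ g ∈ W, A i g) ⊆
      ⋃ f ∈ Fintype.piFinset fun _ : I => W, ⋂ i : I, A i (f i) := by
    intro ω hω
    have hω' : ∀ i : I, ∃ g ∈ W, ω ∈ A i g := fun i => by
      simpa using mem_iInter₂.1 hω i i.2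
    choose f hf hfA using hω'
    exact mem_iUnion₂.2 ⟨f, Fintype.mem_piFinset.2 hf, mem_iInter.2 hfA⟩
  calc P (⋂ i ∈ I, ⋃ g ∈ W, A i g)
      ≤ ∑ f ∈ Fintype.piFinset fun _ : I => W, P (⋂ i : I, A i (f i)) :=
        (measure_mono hsub).trans (measure_biUnion_finset_le _ _)
    _ ≤ ∑ f ∈ Fintype.piFinset fun _ : I => W, q ^ I.card :=
        Finset.sum_le_sum fun f hf => h f (Fintype.mem_piFinset.1 hf)
    _ = (W.card * q) ^ I.card := by
        rw [Finset.sum_const, Fintype.card_piFinset, Finset.prod_const, Finset.card_univ, Fintype.card_coe, nsmul_eq_mul, mul_pow]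
        push_cast
        rfl

theorem streetMeasure_segment {p q : Space d} (h : segment ℝ p q ⊆ ⋃₀ streets η) :
    streetMeasure η (segment ℝ p q) = edist p q := by
  rw [streetMeasure, Measure.restrict_eq_self _ h, hausdorffMeasure_segment]

theorem isCompact_segment (p q : Space d) : IsCompact (segment ℝ p q) := by
  rw [segment_eq_image_lineMap]
  exact isCompact_Icc.image (AffineMap.lineMap_continuous)

theorem IsPoissonLaw.measure_forall_count_eq_zero_le {lam : ℝ≥0∞} {Q : Measure (Config d)}
    (hlam : lam ≠ ∞) (hQ : IsPoissonLaw (lam • streetMeasure η) Q) {ι : Type*} [Fintype ι]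
    {B : ι → Set (Space d)} (hB : Pairwise fun i j => Disjoint (B i) (B j)) {l : ℝ}
    (h : ∀ i, HasStreetSegment η (B i) l) :
    Q {X | ∀ i, Config.count (B i) X = 0} ≤
      ENNReal.ofReal (Real.exp (-(lam * ENNReal.ofReal l).toReal)) ^ Fintype.card ι := by
  choose p q hl hsub using h
  have hC : Pairwise fun i j => Disjoint (segment ℝ (p i) (q i)) (segment ℝ (p j) (q j)) :=
    fun i j hij => (hB hij).mono ((hsub i).trans inter_subset_left)
      ((hsub j).trans inter_subset_left)
  have hm : ∀ i, MeasurableSet (segment ℝ (p i) (q i)) :=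
    fun i => (isCompact_segment _ _).measurableSet
  have hmeas : ∀ i, (lam • streetMeasure η) (segment ℝ (p i) (q i)) = lam * ENNReal.ofReal l :=
    fun i => by
      rw [Measure.smul_apply, streetMeasure_segment ((hsub i).trans inter_subset_right),
        smul_eq_mul, edist_dist, hl]
  calc Q {X | ∀ i, Config.count (B i) X = 0}
      ≤ Q (⋂ i ∈ Finset.univ, Config.count (segment ℝ (p i) (q i)) ⁻¹' {0}) := by
        refine measure_mono fun X hX => mem_iInter₂.2 fun i _ => ?_
        have := count_mono ((hsub i).trans inter_subset_left) X
        rw [hX i] at this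
        exact le_antisymm this zero_le
    _ = ∏ i, Q (Config.count (segment ℝ (p i) (q i)) ⁻¹' {0}) :=
        (hQ.iIndepFun_count hC hm).measure_inter_preimage_eq_mul (sets := fun _ => {0})
          Finset.univ fun _ _ => trivial
    _ = _ := by
        have : ∀ i, Q (Config.count (segment ℝ (p i) (q i)) ⁻¹' {0}) =
            ENNReal.ofReal (Real.exp (-(lam * ENNReal.ofReal l).toReal)) := fun i => by
          rw [← hmeas i]
          refine hQ.measure_count_eq_zero (hm i) ?_
          rw [hmeas i]
          exact ENNReal.mul_ne_top hlam ENNReal.ofReal_ne_top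
        rw [Finset.prod_congr rfl fun i _ => this i, Finset.prod_const, Finset.card_univ]

theorem measurableSet_mem_carrier (v : Space d) : MeasurableSet {Y : Config d | v ∈ Y.carrier} := by
  have : {Y : Config d | v ∈ Y.carrier} = {Y | Config.count {v} Y ≠ 0} := by
    ext Y
    simp [count_ne_zero]
  rw [this]
  exact measurableSet_count_ne_zero (measurableSet_singleton v)

theorem IsBernoulliLaw.measure_forall_count_eq_zero_le {V : Set (Space d)} {p : ℝ} (hp : 0 ≤ p)
    {Q : Measure (Config d)} (hQ : IsBernoulliLaw V p Q) {ι : Type*} [Fintype ι]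
    {B : ι → Set (Space d)} (hB : Pairwise fun i j => Disjoint (B i) (B j))
    (h : ∀ i, (V ∩ B i).Nonempty) :
    Q {Y | ∀ i, Config.count (B i) Y = 0} ≤ ENNReal.ofReal (1 - p) ^ Fintype.card ι := by
  have := hQ.isProbabilityMeasure
  choose v hvV hvB using h
  have hinj : Function.Injective fun i => (⟨v i, hvV i⟩ : V) := fun i j hij => by
    by_contra hne
    have : v i = v j := congrArg Subtype.val hij
    exact Set.disjoint_left.1 (hB hne) (hvB i) (this ▸ hvB j)
  have hind := ((iIndepSet_iff_iIndep _ _).1 (hQ.indep.precomp hinj)).meas_iInter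
    (s := fun i => {Y : Config d | v i ∈ Y.carrier}ᶜ)
    (fun i => (MeasurableSpace.measurableSet_generateFrom (mem_singleton _)).compl)
  calc Q {Y | ∀ i, Config.count (B i) Y = 0} ≤ Q (⋂ i, {Y : Config d | v i ∈ Y.carrier}ᶜ) :=
        measure_mono fun Y hY => mem_iInter.2 fun i hi => count_eq_zero.1 (hY i) _ hi (hvB i)
    _ = ∏ i, Q {Y : Config d | v i ∈ Y.carrier}ᶜ := hind
    _ = _ := by
        have : ∀ i, Q {Y : Config d | v i ∈ Y.carrier}ᶜ = ENNReal.ofReal (1 - p) := fun i => by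
          rw [prob_compl_eq_one_sub (measurableSet_mem_carrier _), hQ.prob_mem _ (hvV i),
            ENNReal.ofReal_sub _ hp, ENNReal.ofReal_one]
        rw [Finset.prod_congr rfl fun i _ => this i, Finset.prod_const, Finset.card_univ]

section Model

variable {Ω : Type*} [MeasurableSpace Ω] {P : Measure Ω} {lamS : ℝ}
  {lam : ℝ≥0∞} {p : ℝ} {XS X Y : Ω → Config d}

theorem measure_rectangle_le [IsProbabilityMeasure P] {α β : Type*} [MeasurableSpace α] [MeasurableSpace β]
    {Z : Ω → α} (hZ : Measurable Z) {κ : Kernel α β} [IsMarkovKernel κ] {T : Ω → β}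
    (hT : ∀ E G, MeasurableSet E → MeasurableSet G →
      P (Z ⁻¹' E ∩ T ⁻¹' G) = ∫⁻ η in E, κ η G ∂(P.map Z))
    {E : Set α} {G : Set β} (hG : MeasurableSet G) {q : ℝ≥0∞}
    (h : ∀ᵐ η ∂(P.map Z), η ∈ E → κ η G ≤ q) : P {ω | Z ω ∈ E ∧ T ω ∈ G} ≤ q := by
  have : IsProbabilityMeasure (P.map Z) := Measure.isProbabilityMeasure_map hZ.aemeasurable
  have hE' : MeasurableSet {η | κ η G ≤ q} := κ.measurable_coe hG measurableSet_Iic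
  calc P {ω | Z ω ∈ E ∧ T ω ∈ G} ≤ P (Z ⁻¹' {η | κ η G ≤ q} ∩ T ⁻¹' G) := by
        refine measure_mono_ae ?_
        filter_upwards [ae_of_ae_map hZ.aemeasurable h] with ω hω hmem
        exact ⟨hω hmem.1, hmem.2⟩
    _ = ∫⁻ η in {η | κ η G ≤ q}, κ η G ∂(P.map Z) := hT _ _ hE' hG
    _ ≤ ∫⁻ η in {η | κ η G ≤ q}, q ∂(P.map Z) := setLIntegral_mono measurable_const fun η hη => hη
    _ ≤ q := by
        rw [setLIntegral_const]
        exact mul_le_of_le_one_right' prob_le_one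

theorem IsModel.measure_users_le [IsProbabilityMeasure P] (h : IsModel P lamS lam p XS X Y) {E G : Set (Config d)}
    (hG : MeasurableSet G) {q : ℝ≥0∞}
    (hq : ∀ η ∈ E, ∀ Q, IsPoissonLaw (lam • streetMeasure η) Q → Q G ≤ q) :
    P {ω | XS ω ∈ E ∧ X ω ∈ G} ≤ q := by
  obtain ⟨κX, κY, _, _, hX, -, hlaw⟩ := h.conditional_law
  have : IsProbabilityMeasure (P.map XS) :=
    Measure.isProbabilityMeasure_map h.measurable_nuclei.aemeasurable
  refine measure_rectangle_le h.measurable_nuclei (κ := κX) (fun E G hE hG => ?_) hG ?_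
  · have h1 := congrArg (fun μ => μ (E ×ˢ (G ×ˢ univ))) hlaw
    rw [Measure.map_apply (h.measurable_nuclei.prodMk
      (h.measurable_users.prodMk h.measurable_relays)) (hE.prod (hG.prod MeasurableSet.univ)),
      Measure.compProd_apply_prod hE (hG.prod MeasurableSet.univ)] at h1
    simp only [Kernel.prod_apply_prod, measure_univ, mul_one] at h1
    rw [← h1]
    congr 1
    ext ω
    simp
  · filter_upwards [hX] with η hη hE
    exact hq η hE _ hη

theorem IsModel.measure_relays_le [IsProbabilityMeasure P] (h : IsModel P lamS lam p XS X Y) {E G : Set (Config d)}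
    (hG : MeasurableSet G) {q : ℝ≥0∞}
    (hq : ∀ η ∈ E, ∀ Q, IsBernoulliLaw (crossroads η) p Q → Q G ≤ q) :
    P {ω | XS ω ∈ E ∧ Y ω ∈ G} ≤ q := by
  obtain ⟨κX, κY, _, _, -, hY, hlaw⟩ := h.conditional_law
  have : IsProbabilityMeasure (P.map XS) :=
    Measure.isProbabilityMeasure_map h.measurable_nuclei.aemeasurable
  refine measure_rectangle_le h.measurable_nuclei (κ := κY) (fun E G hE hG => ?_) hG ?_
  · have h1 := congrArg (fun μ => μ (E ×ˢ (univ ×ˢ G))) hlaw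
    rw [Measure.map_apply (h.measurable_nuclei.prodMk
      (h.measurable_users.prodMk h.measurable_relays)) (hE.prod (MeasurableSet.univ.prod hG)),
      Measure.compProd_apply_prod hE (MeasurableSet.univ.prod hG)] at h1
    simp only [Kernel.prod_apply_prod, measure_univ, one_mul] at h1
    rw [← h1]
    congr 1
    ext ω
    simp
  · filter_upwards [hY] with η hη hE
    exact hq η hE _ hη

theorem ae_subset_of_isClosed {Z T : Ω → Config d} {S : Config d → Set (Space d)}
    (hS : ∀ η, IsClosed (S η))
    (h : ∀ B, IsClosed B → P {ω | Z ω ∈ {η | Disjoint B (S η)} ∧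
      T ω ∈ {X | Config.count B X ≠ 0}} = 0) : ∀ᵐ ω ∂P, (T ω).carrier ⊆ S (Z ω) := by
  have hall : ∀ᵐ ω ∂P, ∀ j m : ℕ, ¬ (Disjoint (Metric.closedBall
      (TopologicalSpace.denseSeq (Space d) j) (1 / (m + 1))) (S (Z ω)) ∧
      Config.count (Metric.closedBall (TopologicalSpace.denseSeq (Space d) j) (1 / (m + 1)))
        (T ω) ≠ 0) := by
    rw [ae_all_iff]; intro j
    rw [ae_all_iff]; intro m
    have := h _ (Metric.isClosed_closedBall (x := TopologicalSpace.denseSeq (Space d) j)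
      (ε := 1 / (m + 1)))
    rw [ae_iff]
    simpa using this
  filter_upwards [hall] with ω hω x hx
  by_contra hxS
  obtain ⟨j, m, hsub, hxm⟩ := exists_denseSeq_closedBall (hS (Z ω)).isOpen_compl hxS
  exact hω j m ⟨Set.disjoint_left.2 fun y hy => hsub hy, count_ne_zero.2 ⟨x, hx, hxm⟩⟩

theorem IsModel.ae_users_subset [IsProbabilityMeasure P] (h : IsModel P lamS lam p XS X Y) :
    ∀ᵐ ω ∂P, (X ω).carrier ⊆ skeleton (XS ω) (d - 1) := by
  refine ae_subset_of_isClosed (Z := XS) (S := fun η => skeleton η (d - 1))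
    (fun η => isClosed_skeleton _) fun B hB => ?_
  refine le_antisymm (h.measure_users_le (measurableSet_count_ne_zero hB.measurableSet)
    fun η hη Q hQ => ?_) zero_le
  have := hQ.isProbabilityMeasure
  have hdis : B ∩ ⋃₀ streets η = ∅ :=
    (hη.mono_right (sUnion_subset fun e he => facet_subset_skeleton he)).inter_eq
  have h0 : (lam • streetMeasure η) B = 0 := by
    rw [Measure.smul_apply, streetMeasure, Measure.restrict_apply hB.measurableSet,
      hdis, measure_empty, smul_zero]
  have h1 := hQ.measure_count_eq_zero hB.measurableSet (by simp [h0])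
  rw [h0] at h1
  have h2 := prob_compl_eq_one_sub (μ := Q)
    (measurable_count hB.measurableSet (measurableSet_singleton 0))
  have h3 : Q (Config.count B ⁻¹' {0}) = 1 := h1.trans (by simp)
  rw [h3, tsub_self] at h2
  exact h2.le

theorem IsModel.ae_relays_subset [IsProbabilityMeasure P] (hd : 0 < d) (h : IsModel P lamS lam p XS X Y) :
    ∀ᵐ ω ∂P, (Y ω).carrier ⊆ crossroads (XS ω) := by
  refine ae_subset_of_isClosed (Z := XS) (S := crossroads)
    (fun η => by rw [crossroads_eq_skeleton hd]; exact isClosed_skeleton _) fun B hB => ?_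
  refine le_antisymm (h.measure_relays_le (measurableSet_count_ne_zero hB.measurableSet)
    fun η hη Q hQ => ?_) zero_le
  refine le_of_eq (measure_mono_null ?_ (ae_iff.1 hQ.subset))
  intro Z hZ hsub
  obtain ⟨x, hx, hxB⟩ := count_ne_zero.1 hZ
  exact Set.disjoint_left.1 hη hxB (hsub hx)

theorem IsModel.measure_biInter_users_le [IsProbabilityMeasure P] (h : IsModel P lamS lam p XS X Y) (hlam : lam ≠ ∞)
    {ι γ : Type*} (I : Finset ι) (W : Finset γ) (B : ι → γ → Set (Space d))
    (hBm : ∀ i g, MeasurableSet (B i g)) (hB : ∀ i ∈ I, ∀ j ∈ I, i ≠ j → ∀ g ∈ W, ∀ g' ∈ W,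
      Disjoint (B i g) (B j g')) (l : ℝ) :
    P (⋂ i ∈ I, ⋃ g ∈ W, {ω | HasStreetSegment (XS ω) (B i g) l ∧
      Config.count (B i g) (X ω) = 0}) ≤
      (W.card * ENNReal.ofReal (Real.exp (-(lam * ENNReal.ofReal l).toReal))) ^ I.card := by
  refine measure_iInter_iUnion_le I W _ fun f hf => ?_
  refine le_trans (measure_mono fun ω hω => ?_) (h.measure_users_le
    (E := {η | ∀ i : I, HasStreetSegment η (B i (f i)) l})
    (G := {X | ∀ i : I, Config.count (B i (f i)) X = 0}) ?_ fun η hη Q hQ => ?_)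
  · have := mem_iInter.1 hω
    exact ⟨fun i => (this i).1, fun i => (this i).2⟩
  · rw [ofPred_forall]
    exact MeasurableSet.iInter fun i =>
      measurable_count (hBm _ _) (measurableSet_singleton 0)
  · rw [← Fintype.card_coe I]
    exact hQ.measure_forall_count_eq_zero_le (ι := I) (B := fun i => B i (f i)) hlam (fun i j hij =>
      hB i i.2 j j.2 (fun h => hij (Subtype.ext h)) _ (hf i) _ (hf j)) hη

theorem IsModel.measure_biInter_relays_le [IsProbabilityMeasure P] (h : IsModel P lamS lam p XS X Y) (hp : 0 ≤ p)
    {ι γ : Type*} (I : Finset ι) (W : Finset γ) (B : ι → γ → Set (Space d))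
    (hBm : ∀ i g, MeasurableSet (B i g)) (hB : ∀ i ∈ I, ∀ j ∈ I, i ≠ j → ∀ g ∈ W, ∀ g' ∈ W,
      Disjoint (B i g) (B j g')) :
    P (⋂ i ∈ I, ⋃ g ∈ W, {ω | (crossroads (XS ω) ∩ B i g).Nonempty ∧
      Config.count (B i g) (Y ω) = 0}) ≤ (W.card * ENNReal.ofReal (1 - p)) ^ I.card := by
  refine measure_iInter_iUnion_le I W _ fun f hf => ?_
  refine le_trans (measure_mono fun ω hω => ?_) (h.measure_relays_le
    (E := {η | ∀ i : I, (crossroads η ∩ B i (f i)).Nonempty})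
    (G := {X | ∀ i : I, Config.count (B i (f i)) X = 0}) ?_ fun η hη Q hQ => ?_)
  · have := mem_iInter.1 hω
    exact ⟨fun i => (this i).1, fun i => (this i).2⟩
  · rw [ofPred_forall]
    exact MeasurableSet.iInter fun i =>
      measurable_count (hBm _ _) (measurableSet_singleton 0)
  · rw [← Fintype.card_coe I]
    exact hQ.measure_forall_count_eq_zero_le hp (fun i j hij =>
      hB i i.2 j j.2 (fun h => hij (Subtype.ext h)) _ (hf i) _ (hf j)) hη

end Model

end LineOfSight
end

noncomputable section
namespace LineOfSight

variable {d : ℕ}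

/-! ### Percolation of the block model -/

theorem Separated.lt_dist_blockCenter (hd : 2 ≤ d) {a : ℝ} (ha : 0 < a) {I : Finset (ℤ × ℤ)}
    (hI : Separated 21 I) {z w : ℤ × ℤ} (hz : z ∈ I) (hw : w ∈ I) (hne : z ≠ w) :
    20 * a < dist (blockCenter hd a z) (blockCenter hd a w) := by
  obtain ⟨h1, h2⟩ := mul_abs_le_dist_blockCenter hd ha z w
  rcases hI z hz w hw hne with h | h
  · have h' : (21 : ℝ) ≤ ((|z.1 - w.1| : ℤ) : ℝ) := by exact_mod_cast h
    push_cast at h' h1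
    nlinarith
  · have h' : (21 : ℝ) ≤ ((|z.2 - w.2| : ℤ) : ℝ) := by exact_mod_cast h
    push_cast at h' h2
    nlinarith

theorem disjoint_testBall {a κ : ℝ} (ha : 0 < a) (hκ : κ ≤ 1 / 2) {c c' g g' : Space d}
    (hc : 20 * a < dist c c') (hg : g ∈ Metric.closedBall (0 : Space d) 6)
    (hg' : g' ∈ Metric.closedBall (0 : Space d) 6) :
    Disjoint (testBall c a κ g) (testBall c' a κ g') := by
  refine Metric.closedBall_disjoint_closedBall ?_
  have key : ∀ (c g : Space d), g ∈ Metric.closedBall (0 : Space d) 6 →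
      dist c (c + a • g) ≤ 6 * a := fun c g h => by
    rw [mem_closedBall_zero_iff] at h
    rw [dist_eq_norm, sub_add_cancel_left, norm_neg, norm_smul, Real.norm_of_nonneg ha.le]
    nlinarith
  have h1 := key c g hg
  have h2 := key c' g' hg'
  rw [dist_comm] at h2
  have h3 := dist_triangle4 c (c + a • g) (c' + a • g') c'
  nlinarith

variable {Ω : Type*} [MeasurableSpace Ω] {P : Measure Ω} {lamS : ℝ} {lam : ℝ≥0∞} {p : ℝ}
  {XS X Y : Ω → Config d}

/-- Percolation with positive probability, given the bounds for the three ways in which a block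
fails to be open. -/
theorem IsModel.exists_percolates [IsProbabilityMeasure P] (h : IsModel P lamS lam p XS X Y)
    (hd : 2 ≤ d) (hlam : lam ≠ ∞) (hp : 0 ≤ p) {a r κ : ℝ} (ha : 0 < a) (hκ : 0 < κ)
    (hκr : κ ≤ r / 8) (hr : r ≤ 1 / 2) {T W : Finset (Space d)}
    (hT : Metric.closedBall (0 : Space d) 8 ⊆ ⋃ g ∈ T, Metric.ball g 1)
    (hT' : ∀ g ∈ T, g ∈ Metric.closedBall (0 : Space d) 8)
    (hW : Metric.closedBall (0 : Space d) 6 ⊆ ⋃ g ∈ W, Metric.closedBall g (κ / 4))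
    (hW' : ∀ g ∈ W, g ∈ Metric.closedBall (0 : Space d) 6) {R : ℝ≥0∞}
    (hR : ENNReal.ofReal (3 * r * a) ≤ R)
    (hgeo : ∀ c, (P.map XS) {η | η.rescale c a ha ∈ irregular T r κ} ≤
      (1 / 144) ^ (3 * (21 * 21)))
    (huser : W.card * ENNReal.ofReal (Real.exp (-(lam * ENNReal.ofReal (κ * a / 4)).toReal)) ≤
      (1 / 144) ^ (3 * (21 * 21)))
    (hrelay : W.card * ENNReal.ofReal (1 - p) ≤ (1 / 144) ^ (3 * (21 * 21))) :
    ∃ A : Set Ω, MeasurableSet A ∧ 0 < P A ∧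
      ∀ ω ∈ A, Percolates (connectivityGraph R (XS ω) (X ω) (Y ω)) := by
  have hκ1 : κ ≤ 1 / 2 := by linarith
  set 𝒢 : Ω → Set (ℤ × ℤ) := fun ω =>
    {z | IsOpenBlock (XS ω) (X ω) (Y ω) W (blockCenter hd a z) a r κ} with h𝒢
  set bad : Fin 3 → ℤ × ℤ → Set Ω := fun t z => ![
    {ω | (XS ω).rescale (blockCenter hd a z) a ha ∈ irregular T r κ},
    ⋃ g ∈ W, {ω | HasStreetSegment (XS ω) (testBall (blockCenter hd a z) a κ g) (κ * a / 4) ∧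
      Config.count (testBall (blockCenter hd a z) a κ g) (X ω) = 0},
    ⋃ g ∈ W, {ω | (crossroads (XS ω) ∩ testBall (blockCenter hd a z) a κ g).Nonempty ∧
      Config.count (testBall (blockCenter hd a z) a κ g) (Y ω) = 0}] t with hbad
  have hcover : ∀ ω z, z ∉ 𝒢 ω → ∃ t, ω ∈ bad t z := by
    intro ω z hz
    by_contra! hno
    have h0 := hno 0
    have h1 := hno 1
    have h2 := hno 2
    simp only [hbad, Matrix.cons_val_zero, Matrix.cons_val_one, Matrix.cons_val, mem_iUnion,
      not_exists] at h0 h1 h2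
    exact hz ⟨isRegular_of_rescale_notMem_irregular (by omega) hT (by linarith) hκ ha h0,
      fun g hg hs hc => h1 g hg ⟨hs, hc⟩, fun g hg hs hc => h2 g hg ⟨hs, hc⟩⟩
  have hdisj : ∀ I : Finset (ℤ × ℤ), Separated 21 I → ∀ i ∈ I, ∀ j ∈ I, i ≠ j → ∀ g ∈ W,
      ∀ g' ∈ W, Disjoint (testBall (blockCenter hd a i) a κ g)
        (testBall (blockCenter hd a j) a κ g') := fun I hI i hi j hj hij g hg g' hg' =>
    disjoint_testBall ha hκ1 (hI.lt_dist_blockCenter hd ha hi hj hij) (hW' g hg) (hW' g' hg')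
  have hmeas : ∀ (i : ℤ × ℤ) (g : Space d), MeasurableSet (testBall (blockCenter hd a i) a κ g) :=
    fun i g => Metric.isClosed_closedBall.measurableSet
  have hbound : ∀ t, ∀ I : Finset (ℤ × ℤ), Separated 21 I →
      P (⋂ z ∈ I, bad t z) ≤ (((1 / 144 : ℝ≥0∞)) ^ (3 * (21 * 21))) ^ I.card := by
    intro t I hI
    fin_cases t
    · have h1 := measure_iInter_irregular_le h.nuclei_law hT hT' hr hκ1 ha I
        (fun z => blockCenter hd a z)
        (fun i hi j hj hij => hI.lt_dist_blockCenter hd ha hi hj hij) (fun i _ => hgeo _)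
      have h2 : MeasurableSet (⋂ i ∈ I,
          {η : Config d | η.rescale (blockCenter hd a i) a ha ∈ irregular T r κ}) :=
        I.measurableSet_biInter fun i _ =>
          measurable_rescale' ha (measurableSet_irregular T r κ)
      rw [Measure.map_apply h.measurable_nuclei h2, preimage_iInter₂] at h1
      exact h1
    · exact (h.measure_biInter_users_le hlam I W _ hmeas (hdisj I hI) _).trans
        (pow_le_pow_left' huser _)
    · exact (h.measure_biInter_relays_le hp I W _ hmeas (hdisj I hI)).trans
        (pow_le_pow_left' hrelay _)
  have hlt := measure_finite_cluster_lt_one hcover (by norm_num) hbound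
  have hae : P {ω | ¬ ((X ω).carrier ⊆ skeleton (XS ω) (d - 1) ∧
      (Y ω).carrier ⊆ crossroads (XS ω))} = 0 :=
    ae_iff.1 (h.ae_users_subset.and (h.ae_relays_subset (by omega)))
  set F : Set Ω := {ω | 0 ∉ 𝒢 ω ∨ (cluster (𝒢 ω)).Finite} ∪ {ω | ¬ ((X ω).carrier ⊆
    skeleton (XS ω) (d - 1) ∧ (Y ω).carrier ⊆ crossroads (XS ω))} with hF
  have hFlt : P F < 1 := (measure_union_le _ _).trans_lt (by rwa [hae, add_zero])
  refine ⟨(toMeasurable P F)ᶜ, (measurableSet_toMeasurable P F).compl, ?_, fun ω hω => ?_⟩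
  · rw [prob_compl_eq_one_sub (measurableSet_toMeasurable P F), measure_toMeasurable]
    exact tsub_pos_of_lt hFlt
  · have hω' : ω ∉ F := fun hmem => hω (subset_toMeasurable P F hmem)
    simp only [hF, mem_union, mem_ofPred_eq, not_or, not_not] at hω'
    obtain ⟨⟨h0, hinf⟩, hX, hY⟩ := hω'
    exact percolates_of_infinite_cluster hd ha hκ hκr hW hX hY hR (𝒢 := 𝒢 ω)
      (fun z hz => hz) h0 hinf

end LineOfSight
end

noncomputable section
namespace LineOfSight

variable {d : ℕ} {η : Config d}

/-! ### Deterministic bounds for the street length -/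

theorem Covers.exists_street_apply_eq {c : Space d} {a : ℝ} (h : Covers η c (15 * a) (2 * a))
    (ha : 0 < a) (i : Fin d) {τ : ℝ} (hτ : |τ - c i| < 6 * a) :
    ∃ e ∈ streets η, e ⊆ Metric.closedBall c (14 * a) ∧ ∃ x ∈ e, x i = τ := by
  by_contra! hno
  have hle : 10 * a + 2 * (2 * a) < 15 * a := by linarith
  have hend : ∀ σ : ℝ, |σ| = 10 * a → ∃ v ∈ hubs η c (10 * a), |v i - (c i + σ)| ≤ 4 * a := by
    intro σ hσ
    obtain ⟨v, hv, hvx, -⟩ := h.exists_mem_hubs hle (by positivity)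
      (x := c + σ • EuclideanSpace.single i (1 : ℝ)) (by
        rw [Metric.mem_closedBall, dist_eq_norm, add_sub_cancel_left, norm_smul, PiLp.norm_single,
          Real.norm_eq_abs, hσ]
        simp)
    refine ⟨v, hv, ?_⟩
    have h1 := PiLp.norm_apply_le (v - (c + σ • EuclideanSpace.single i (1 : ℝ))) i
    rw [← dist_eq_norm] at h1
    simp only [PiLp.sub_apply, PiLp.add_apply, PiLp.smul_apply, PiLp.single_apply,
      if_true, smul_eq_mul, mul_one, Real.norm_eq_abs] at h1
    linarith
  obtain ⟨v, hv, hvi⟩ := hend (-(10 * a)) (by rw [abs_neg, abs_of_pos (by positivity)])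
  obtain ⟨w, hw, hwi⟩ := hend (10 * a) (abs_of_pos (by positivity))
  rw [abs_le] at hvi hwi
  rw [abs_lt] at hτ
  have hrel := h.rel_of_mem_hubs hle (by positivity) (Rel := fun v w => v i < τ ↔ w i < τ)
    (fun _ => Iff.rfl) (fun _ _ _ => Iff.trans) (fun e he hec v hv w hw _ _ => by
      have hec' : e ⊆ Metric.closedBall c (14 * a) :=
        hec.trans (Metric.closedBall_subset_closedBall (by linarith))
      have hpre := (convex_of_mem_facets he).isPreconnected
      have hcont : ContinuousOn (fun x : Space d => x i) e := by fun_prop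
      have key : ∀ v ∈ e, ∀ w ∈ e, v i < τ → w i < τ := fun v hv w hw hvτ => by
        by_contra! hwτ
        obtain ⟨x, hx, hxτ⟩ := hpre.intermediate_value hv hw hcont ⟨hvτ.le, hwτ⟩
        exact hno e he hec' x hx hxτ
      exact ⟨key v hv w hw, key w hw v hv⟩) hv hw
  have := hrel.1 (by linarith)
  linarith

theorem streetsAt_subset_streets (W : Set (Space d)) : streetsAt W η ⊆ streets η := fun _ h => h.1

theorem Covers.le_tsum_streetsAt (hd : 0 < d) {c : Space d} {a : ℝ}
    (h : Covers η c (15 * a) (2 * a)) (ha : 0 < a) {W : Set (Space d)}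
    (hW : Metric.closedBall c (14 * a) ⊆ W) :
    ENNReal.ofReal (12 * a) ≤ ∑' e : streetsAt W η,
      (Measure.hausdorffMeasure 1 : Measure (Space d)) (e : Set (Space d)) := by
  set i : Fin d := ⟨0, hd⟩
  have : Countable (streetsAt W η) :=
    (countable_streets.mono (streetsAt_subset_streets W)).to_subtype
  have hlip : LipschitzWith 1 fun x : Space d => x i := by
    refine LipschitzWith.of_dist_le_mul fun x y => ?_
    rw [NNReal.coe_one, one_mul, dist_eq_norm, dist_eq_norm]
    exact PiLp.norm_apply_le (x - y) i
  have hsub : Ioo (c i - 6 * a) (c i + 6 * a) ⊆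
      ⋃ e : streetsAt W η, (fun x : Space d => x i) '' (e : Set (Space d)) := by
    intro τ hτ
    obtain ⟨e, he, hec, x, hx, hxτ⟩ := h.exists_street_apply_eq ha i (τ := τ)
      (by rw [abs_lt]; constructor <;> linarith [hτ.1, hτ.2])
    obtain ⟨v, w, -, rfl, -⟩ := exists_street_eq_segment he
      ((isCompact_closedBall c (14 * a)).of_isClosed_subset (isClosed_of_mem_facets he) hec)
    exact mem_iUnion.2 ⟨⟨_, he, v, w, rfl, hW (hec (midpoint_mem_segment v w))⟩, x, hx, hxτ⟩
  calc ENNReal.ofReal (12 * a) = volume (Ioo (c i - 6 * a) (c i + 6 * a)) := by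
        rw [Real.volume_Ioo]; congr 1; ring
    _ ≤ ∑' e : streetsAt W η, volume ((fun x : Space d => x i) '' (e : Set (Space d))) :=
        (measure_mono hsub).trans (measure_iUnion_le _)
    _ ≤ _ := by
        refine ENNReal.tsum_le_tsum fun e => ?_
        have := hlip.hausdorffMeasure_image_le (d := 1) zero_le_one (e : Set (Space d))
        simpa [hausdorffMeasure_real] using this

theorem Covers.subset_closedBall_of_mem_streets {c : Space d} {R b t : ℝ} (h : Covers η c R b)
    (ht : t + 2 * b < R) (hb : 0 ≤ b) {e : Set (Space d)} (he : e ∈ streets η) {x : Space d}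
    (hx : x ∈ Metric.closedBall c t) (hxe : x ∈ e) : e ⊆ Metric.closedBall c (t + 2 * b) := by
  obtain ⟨-, -, σ, -, ⟨y, hy⟩, rfl⟩ := he
  exact (biInter_subset_of_mem hy).trans
    (h.cell_subset_closedBall ht hb hx (mem_iInter₂.1 hxe y hy))

theorem Covers.encard_streetsAt_le {c : Space d} {R b t : ℝ} (h : Covers η c R b)
    (ht : t ≤ R) {W : Set (Space d)}
    (hW : W ⊆ Metric.closedBall c t) {n : ℕ}
    (hn : Config.count (Metric.closedBall c (t + b)) η ≤ n) :
    (streetsAt W η).encard ≤ (n ^ (d + 1) : ℕ) := by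
  refine (encard_le_encard ?_).trans (h.encard_streets_le ht hn)
  rintro e ⟨he, p, q, rfl, hpq⟩
  exact ⟨he, _, hW hpq, midpoint_mem_segment p q⟩

theorem Covers.tsum_streetsAt_le {c : Space d} {R b t : ℝ} (h : Covers η c R b)
    (ht : t + 2 * b < R) (hb : 0 ≤ b) {W : Set (Space d)} (hW : W ⊆ Metric.closedBall c t) {n : ℕ}
    (hn : Config.count (Metric.closedBall c (t + b)) η ≤ n) :
    ∑' e : streetsAt W η, (Measure.hausdorffMeasure 1 : Measure (Space d)) (e : Set (Space d)) ≤
      ENNReal.ofReal (n ^ (d + 1) * (2 * (t + 2 * b))) := by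
  calc _ ≤ ∑' e : streetsAt W η, ENNReal.ofReal (2 * (t + 2 * b)) := by
        refine ENNReal.tsum_le_tsum fun ⟨e, he, p, q, hpq, hmid⟩ => ?_
        have hsub := h.subset_closedBall_of_mem_streets ht hb he (hW hmid)
          (hpq ▸ midpoint_mem_segment p q)
        subst hpq
        rw [hausdorffMeasure_segment, edist_dist]
        refine ENNReal.ofReal_le_ofReal ?_
        have h1 := hsub (left_mem_segment ℝ p q)
        have h2 := hsub (right_mem_segment ℝ p q)
        rw [Metric.mem_closedBall] at h1 h2
        linarith [dist_triangle_right p q c]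
    _ = ((streetsAt W η).encard : ℝ≥0∞) * ENNReal.ofReal (2 * (t + 2 * b)) :=
        ENNReal.tsum_set_const _ _
    _ ≤ ((n ^ (d + 1) : ℕ) : ℝ≥0∞) * ENNReal.ofReal (2 * (t + 2 * b)) := by
        gcongr
        exact_mod_cast h.encard_streetsAt_le (by linarith) hW hn
    _ = _ := by
        rw [ENNReal.ofReal_mul (p := (n : ℝ) ^ (d + 1)) (by positivity), ← Nat.cast_pow,
          ENNReal.ofReal_natCast]

theorem cube_subset_closedBall {s : ℝ} (hs : 0 ≤ s) :
    cube d s ⊆ Metric.closedBall 0 (d * s) := by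
  intro x hx
  rw [mem_closedBall_zero_iff]
  refine abs_le_of_sq_le_sq' ?_ (by positivity) |>.2
  rw [EuclideanSpace.real_norm_sq_eq]
  calc ∑ i, x i ^ 2 ≤ ∑ _i : Fin d, s ^ 2 :=
        Finset.sum_le_sum fun i _ => pow_le_pow_left₀ (hx i).1 (hx i).2 2
    _ = d * s ^ 2 := by simp
    _ ≤ (d * s) ^ 2 := by
        rw [mul_pow]
        refine mul_le_mul_of_nonneg_right ?_ (by positivity)
        exact_mod_cast Nat.le_self_pow two_ne_zero d

theorem closedBall_subset_cube (s : ℝ) :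
    Metric.closedBall (WithLp.toLp 2 fun _ => s / 2 : Space d) (s / 2) ⊆ cube d s := by
  intro x hx i
  rw [Metric.mem_closedBall, dist_eq_norm] at hx
  have := (PiLp.norm_apply_le (x - WithLp.toLp 2 fun _ => s / 2) i).trans hx
  simp only [PiLp.sub_apply, Real.norm_eq_abs, abs_le] at this
  constructor <;> linarith [this.1, this.2]

end LineOfSight
end

noncomputable section
namespace LineOfSight

variable {d : ℕ}

/-! ### Probability bounds for Poisson counts -/

theorem exists_finset_net (M : ℝ) {ε : ℝ} (hε : 0 < ε) : ∃ T : Finset (Space d),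
    (∀ g ∈ T, g ∈ Metric.closedBall (0 : Space d) M) ∧
      Metric.closedBall (0 : Space d) M ⊆ ⋃ g ∈ T, Metric.ball g ε := by
  obtain ⟨t, ht, hfin, hcov⟩ := (isCompact_closedBall (0 : Space d) M).finite_cover_balls hε
  refine ⟨hfin.toFinset, fun g hg => ht (hfin.mem_toFinset.1 hg), ?_⟩
  simpa using hcov

section

variable {L : ℝ≥0∞} {Q : Measure (Config d)}

theorem IsPoissonLaw.measure_compl_occupied_le
    (hQ : IsPoissonLaw (L • (volume : Measure (Space d))) Q) (hL : L ≠ ∞) (T : Finset (Space d))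
    (δ : ℝ) : Q (occupied T δ)ᶜ ≤ T.card *
      ENNReal.ofReal (Real.exp (-(L * volume (Metric.ball (0 : Space d) δ)).toReal)) := by
  have hsub : (occupied T δ)ᶜ ⊆ ⋃ g ∈ T, {η : Config d | Config.count (Metric.ball g δ) η = 0} := by
    intro η hη
    simp only [occupied, mem_compl_iff, mem_ofPred_eq, not_forall, not_not] at hη
    obtain ⟨g, hg, h⟩ := hη
    exact mem_iUnion₂.2 ⟨g, hg, h⟩
  have hterm : ∀ g ∈ T, Q {η : Config d | Config.count (Metric.ball g δ) η = 0} =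
      ENNReal.ofReal (Real.exp (-(L * volume (Metric.ball (0 : Space d) δ)).toReal)) := by
    intro g _
    rw [hQ.measure_count_eq_zero Metric.isOpen_ball.measurableSet
      (smul_volume_ne_top hL _ Metric.isBounded_ball), Measure.smul_apply, smul_eq_mul,
      Measure.addHaar_ball_center]
  refine (measure_mono hsub).trans ((measure_biUnion_finset_le _ _).trans ?_)
  rw [Finset.sum_congr rfl hterm, Finset.sum_const, nsmul_eq_mul]

theorem exists_le_measure_occupied (hL : L ≠ ∞) (hL0 : L ≠ 0) (T : Finset (Space d)) :
    ∃ q : ℝ≥0∞, 0 < q ∧ q ≠ ∞ ∧ ∀ Q : Measure (Config d),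
      IsPoissonLaw (L • (volume : Measure (Space d))) Q → q ≤ Q (occupied T 1) := by
  obtain ⟨U, hU, hdisj⟩ := T.finite_toSet.t2_separation
  set B : Space d → Set (Space d) := fun g => U g ∩ Metric.ball g 1 with hB
  have hBo : ∀ g, IsOpen (B g) := fun g => (hU g).2.inter Metric.isOpen_ball
  have hvol : ∀ g, 0 < ((L • (volume : Measure (Space d))) (B g)).toReal := fun g => by
    refine ENNReal.toReal_pos ?_ (smul_volume_ne_top hL _
      (Metric.isBounded_ball.subset inter_subset_right))
    rw [Measure.smul_apply, smul_eq_mul]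
    exact mul_ne_zero hL0 ((hBo g).measure_pos volume
      ⟨g, (hU g).1, Metric.mem_ball_self one_pos⟩).ne'
  refine ⟨∏ g ∈ T, (1 - ENNReal.ofReal
    (Real.exp (-((L • (volume : Measure (Space d))) (B g)).toReal))), ?_, ?_, fun Q hQ => ?_⟩
  · refine pos_iff_ne_zero.2 (Finset.prod_ne_zero_iff.2 fun g _ => (tsub_pos_of_lt ?_).ne')
    rw [ENNReal.ofReal_lt_one, Real.exp_lt_one_iff]
    exact neg_lt_zero.2 (hvol g)
  · exact ENNReal.prod_ne_top fun g _ => (tsub_le_self.trans_lt ENNReal.one_lt_top).ne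
  · have := hQ.isProbabilityMeasure
    have hprod := hQ.measure_biInter_eq_prod T (N := B)
      (hdisj.mono fun g => inter_subset_left)
      (A := fun g => (Config.count (B g) ⁻¹' {0})ᶜ) fun g _ =>
        (measurable_count_regionSigma (hBo g).measurableSet subset_rfl
          (measurableSet_singleton 0)).compl
    have hterm : ∀ g ∈ T, Q (Config.count (B g) ⁻¹' {0})ᶜ = 1 - ENNReal.ofReal
        (Real.exp (-((L • (volume : Measure (Space d))) (B g)).toReal)) := fun g _ => by
      rw [prob_compl_eq_one_sub (measurable_count (hBo g).measurableSet
        (measurableSet_singleton 0))]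
      congr 1
      exact hQ.measure_count_eq_zero (hBo g).measurableSet (smul_volume_ne_top hL _
        (Metric.isBounded_ball.subset inter_subset_right))
    rw [← Finset.prod_congr rfl hterm, ← hprod]
    refine measure_mono fun η hη g hg h0 => ?_
    have h1 := mem_iInter₂.1 hη g hg
    refine h1 (le_antisymm ?_ zero_le)
    exact h0 ▸ count_mono inter_subset_right η

theorem IsPoissonLaw.measure_le_count_le {m : Measure (Space d)} (hQ : IsPoissonLaw m Q)
    {B : Set (Space d)} (hB : MeasurableSet B) (hb : Bornology.IsBounded B) (hfin : m B ≠ ∞)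
    (n : ℕ) : Q {η | n ≤ Config.count B η} ≤ ENNReal.ofReal (Real.exp (m B).toReal / 2 ^ n) := by
  set x := (m B).toReal with hx
  have hx0 : 0 ≤ x := ENNReal.toReal_nonneg
  have hsub : {η : Config d | n ≤ Config.count B η} ⊆
      ⋃ k : ℕ, {η | Config.count B η = ((n + k : ℕ) : ℕ∞)} := by
    intro η hη
    obtain ⟨j, hj⟩ := ENat.ne_top_iff_exists.1 (count_ne_top hb η)
    have hnj : n ≤ j := by
      have : (n : ℕ∞) ≤ j := hj ▸ hη
      exact_mod_cast this
    exact mem_iUnion.2 ⟨j - n, by rw [mem_ofPred_eq, ← hj, Nat.add_sub_cancel' hnj]⟩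
  have hsum : HasSum (fun k : ℕ => (2 * x) ^ k / (k.factorial : ℝ)) (Real.exp (2 * x)) := by
    rw [Real.exp_eq_exp_ℝ]
    exact NormedSpace.expSeries_div_hasSum_exp (2 * x)
  calc Q {η | n ≤ Config.count B η}
      ≤ ∑' k : ℕ, Q {η | Config.count B η = ((n + k : ℕ) : ℕ∞)} :=
        (measure_mono hsub).trans (measure_iUnion_le _)
    _ ≤ ∑' k : ℕ, ENNReal.ofReal (Real.exp (-x) / 2 ^ n) *
          ENNReal.ofReal ((2 * x) ^ (n + k) / ((n + k).factorial : ℝ)) := by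
        refine ENNReal.tsum_le_tsum fun k => ?_
        rw [hQ.count_law B hB hfin, ← ENNReal.ofReal_mul (by positivity), ← hx]
        refine ENNReal.ofReal_le_ofReal ?_
        have h2 : (2 : ℝ) ^ n ≤ 2 ^ (n + k) := pow_le_pow_right₀ one_le_two (Nat.le_add_right n k)
        rw [mul_pow, div_mul_div_comm]
        rw [div_le_div_iff₀ (by positivity) (by positivity)]
        have h3 : 0 ≤ Real.exp (-x) * x ^ (n + k) * ((n + k).factorial : ℝ) := by positivity
        nlinarith
    _ = ENNReal.ofReal (Real.exp (-x) / 2 ^ n) *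
          ∑' k : ℕ, ENNReal.ofReal ((2 * x) ^ (n + k) / ((n + k).factorial : ℝ)) :=
        ENNReal.tsum_mul_left
    _ ≤ ENNReal.ofReal (Real.exp (-x) / 2 ^ n) *
          ∑' k : ℕ, ENNReal.ofReal ((2 * x) ^ k / (k.factorial : ℝ)) := by
        exact mul_le_mul' le_rfl (ENNReal.tsum_comp_le_tsum_of_injective (add_right_injective n)
          fun k : ℕ => ENNReal.ofReal ((2 * x) ^ k / (k.factorial : ℝ)))
    _ = ENNReal.ofReal (Real.exp x / 2 ^ n) := by
        rw [← ENNReal.ofReal_tsum_of_nonneg (fun k => by positivity) hsum.summable, hsum.tsum_eq,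
          ← ENNReal.ofReal_mul (by positivity), div_mul_eq_mul_div, ← Real.exp_add]
        congr 3
        ring

end

/-- A bound for a lower integral from a sequence of events that fail with small probability. -/
theorem lintegral_le_of_forall_notMem {α : Type*} [MeasurableSpace α] {μ : Measure α}
    [IsProbabilityMeasure μ] {g : α → ℝ≥0∞} {B : ℕ → Set α} (hB : ∀ n, MeasurableSet (B n))
    {w β : ℕ → ℝ} (hw : ∀ n, 0 ≤ w n) (hβ : ∀ n, 0 ≤ β n) (hg : ∀ n x, x ∉ B n → g x ≤
      ENNReal.ofReal (w n)) (hμ : ∀ n, μ (B n) ≤ ENNReal.ofReal (β n))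
    (hlim : Filter.Tendsto β Filter.atTop (nhds 0))
    (hsum : Summable fun n => w (n + 1) * β n) :
    ∫⁻ x, g x ∂μ ≤ ENNReal.ofReal (w 0 + ∑' n, w (n + 1) * β n) := by
  have hnull : μ (⋂ n, B n) = 0 := by
    refine le_antisymm (ge_of_tendsto' (x := Filter.atTop) (f := fun n => ENNReal.ofReal (β n)) ?_
      fun n => (measure_mono (iInter_subset B n)).trans (hμ n)) zero_le
    simpa using ENNReal.tendsto_ofReal hlim
  calc ∫⁻ x, g x ∂μ ≤ ∫⁻ x, (ENNReal.ofReal (w 0) +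
        ∑' n, (B n).indicator (fun _ => ENNReal.ofReal (w (n + 1))) x) ∂μ := by
        refine lintegral_mono_ae ?_
        filter_upwards [measure_eq_zero_iff_ae_notMem.1 hnull] with x hx
        have hex : ∃ n, x ∉ B n := by simpa using hx
        classical
        have hmin := Nat.find_spec hex
        rcases hn : Nat.find hex with _ | k
        · rw [hn] at hmin
          exact (hg 0 x hmin).trans le_self_add
        · rw [hn] at hmin
          have hk : x ∈ B k := by
            by_contra hk
            have := Nat.find_min' hex hk
            omega
          refine (hg (k + 1) x hmin).trans (le_add_left ?_)
          refine le_trans ?_ (ENNReal.le_tsum k)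
          rw [indicator_of_mem hk]
    _ = ENNReal.ofReal (w 0) + ∑' n, ENNReal.ofReal (w (n + 1)) * μ (B n) := by
        rw [lintegral_add_left measurable_const, lintegral_const, measure_univ, mul_one,
          lintegral_tsum fun n => (measurable_const.indicator (hB n)).aemeasurable]
        congr 2
        funext n
        rw [lintegral_indicator_const (hB n)]
    _ ≤ ENNReal.ofReal (w 0) + ∑' n, ENNReal.ofReal (w (n + 1) * β n) := by
        gcongr with n
        rw [ENNReal.ofReal_mul (hw _)]
        gcongr
        exact hμ n
    _ = _ := by
        rw [← ENNReal.ofReal_tsum_of_nonneg (fun n => mul_nonneg (hw _) (hβ n)) hsum,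
          ← ENNReal.ofReal_add (hw 0) (tsum_nonneg fun n => mul_nonneg (hw _) (hβ n))]

/-- The scale on which a Poisson point process of intensity `lamS` has one point per unit volume. -/
def scale (d : ℕ) (lamS : ℝ) : ℝ := lamS ^ (-(1 / (d : ℝ)))

theorem scale_pos (d : ℕ) {lamS : ℝ} (h : 0 < lamS) : 0 < scale d lamS := Real.rpow_pos_of_pos h _

theorem ofReal_mul_ofReal_scale_pow (hd : 0 < d) {lamS : ℝ} (hlamS : 0 < lamS) (ρ : ℝ) :
    ENNReal.ofReal lamS * ENNReal.ofReal ((ρ * scale d lamS) ^ d) =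
      ENNReal.ofReal (ρ ^ d) := by
  rw [← ENNReal.ofReal_mul hlamS.le, mul_pow, scale, ← Real.rpow_natCast (lamS ^ _),
    ← Real.rpow_mul hlamS.le, neg_mul, one_div, inv_mul_cancel₀ (by positivity), Real.rpow_neg_one]
  congr 1
  field_simp

end LineOfSight
end

noncomputable section
namespace LineOfSight

variable {d : ℕ}

/-! ### Bounds for the mean street length -/

/-- The total length of the streets with midpoint in `W`. -/
def lengthAt (W : Set (Space d)) (η : Config d) : ℝ≥0∞ :=
  ∑' e : streetsAt W η, (Measure.hausdorffMeasure 1 : Measure (Space d)) (e : Set (Space d))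

theorem exists_poisson_exponent (V : ℝ) : ∃ K : ℕ, Real.exp V / 2 ^ K ≤ Real.exp (-1) := by
  obtain ⟨K, hK⟩ := pow_unbounded_of_one_lt (Real.exp V / Real.exp (-1)) (one_lt_two (α := ℝ))
  refine ⟨K, ?_⟩
  rw [div_lt_iff₀ (Real.exp_pos _)] at hK
  rw [div_le_iff₀ (by positivity)]
  linarith

theorem exists_lintegral_le (hd : 0 < d) : ∃ C : ℝ, 0 < C ∧ ∀ lamS : ℝ, 0 < lamS →
    ∀ Q : Measure (Config d),
      IsPoissonLaw (ENNReal.ofReal lamS • (volume : Measure (Space d))) Q →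
      ∫⁻ η, lengthAt (cube d (scale d lamS)) η ∂Q ≤ ENNReal.ofReal (C * scale d lamS) ∧
      ∫⁻ η, ((streetsAt (cube d (scale d lamS)) η).encard : ℝ≥0∞) ∂Q ≤ ENNReal.ofReal C := by
  have hd1 : (1 : ℝ) ≤ d := by exact_mod_cast hd
  obtain ⟨T, -, hT⟩ := exists_finset_net (d := d) (d + 5 : ℝ) one_pos
  set v := (volume (Metric.ball (0 : Space d) 1)).toReal with hv
  have hvpos : 0 < v := ENNReal.toReal_pos (Metric.measure_ball_pos _ _ one_pos).ne'
    Metric.isBounded_ball.measure_lt_top.ne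
  set V := (volume (Metric.closedBall (0 : Space d) (d + 2))).toReal with hV
  obtain ⟨K, hK⟩ := exists_poisson_exponent V
  set b := min v 1 with hb
  have hbpos : 0 < b := lt_min hvpos one_pos
  -- the failure probability and the bound on success of level `n + 1`
  set β : ℕ → ℝ := fun n => (T.card + 1) * Real.exp (-b * (n + 1 : ℕ)) with hβ
  set m := d * (d + 1) + 1 with hm
  set w : ℕ → ℝ := fun n => K ^ (d + 1) * (2 * (d + 4)) * ((n + 1 : ℕ) : ℝ) ^ m with hw
  have hw0 : ∀ n, 0 ≤ w n := fun n => by positivity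
  have hβ0 : ∀ n, 0 ≤ β n := fun n => by positivity
  have hpoly : ∀ j : ℕ, Summable fun n : ℕ => (n : ℝ) ^ j * Real.exp (-b * n) :=
    fun j => Real.summable_pow_mul_exp_neg_nat_mul j hbpos
  have hlim : Filter.Tendsto β Filter.atTop (nhds 0) := by
    have h1 := ((summable_nat_add_iff 1).2 (hpoly 0)).tendsto_atTop_zero.const_mul (T.card + 1 : ℝ)
    simpa [hβ] using h1
  have hsum : Summable fun n => w (n + 1) * β n := by
    have h1 := ((summable_nat_add_iff 2).2 (hpoly m)).mul_left
      (K ^ (d + 1) * (2 * (d + 4)) * (T.card + 1) * Real.exp b)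
    refine h1.congr fun n => ?_
    have : Real.exp (-b * ((n + 2 : ℕ) : ℝ)) * Real.exp b = Real.exp (-b * ((n + 1 : ℕ) : ℝ)) := by
      rw [← Real.exp_add]; congr 1; push_cast; ring
    simp only [hw, hβ]
    rw [← this]
    ring
  set C := w 0 + ∑' n, w (n + 1) * β n with hC
  have hC0 : 0 ≤ C := add_nonneg (hw0 0) (tsum_nonneg fun n => mul_nonneg (hw0 _) (hβ0 n))
  refine ⟨C + 1, by linarith, fun lamS hlamS Q hQ => ?_⟩
  have := hQ.isProbabilityMeasure
  set s := scale d lamS with hs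
  have hspos : 0 < s := scale_pos d hlamS
  have hapos : ∀ n : ℕ, 0 < ((n + 1 : ℕ) : ℝ) * s := fun n => by positivity
  set k : ℕ → ℕ := fun n => K * (n + 1) ^ d with hk
  set B : ℕ → Set (Config d) := fun n => Config.rescale 0 _ (hapos n) ⁻¹'
    ((occupied T 1)ᶜ ∪ {η | k n ≤ Config.count (Metric.closedBall 0 (d + 2)) η}) with hB
  have hmeasc : MeasurableSet (Metric.closedBall (0 : Space d) (d + 2)) :=
    Metric.isClosed_closedBall.measurableSet
  have hBset : ∀ n, MeasurableSet ((occupied T 1)ᶜ ∪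
      {η : Config d | k n ≤ Config.count (Metric.closedBall 0 (d + 2)) η}) := fun n =>
    (measurableSet_occupied T 1).compl.union (measurable_count hmeasc
      (MeasurableSet.of_discrete (s := {j : ℕ∞ | k n ≤ j})))
  have hBm : ∀ n, MeasurableSet (B n) := fun n => measurable_rescale' (hapos n) (hBset n)
  have hBμ : ∀ n, Q (B n) ≤ ENNReal.ofReal (β n) := by
    intro n
    have hlaw := hQ.map_rescale (hapos n) 0
    rw [ofReal_mul_ofReal_scale_pow hd hlamS ((n + 1 : ℕ) : ℝ)] at hlaw
    rw [hB, ← Measure.map_apply (measurable_rescale' (hapos n)) (hBset n)]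
    set N : ℝ := ((n + 1 : ℕ) : ℝ) with hN
    have hN1 : 1 ≤ N := by rw [hN]; exact_mod_cast Nat.le_add_left 1 n
    have hNd : N ≤ N ^ d := le_self_pow₀ hN1 hd.ne'
    have h1 := hlaw.measure_compl_occupied_le ENNReal.ofReal_ne_top T 1
    have h2 := hlaw.measure_le_count_le hmeasc Metric.isBounded_closedBall
      (smul_volume_ne_top ENNReal.ofReal_ne_top _ Metric.isBounded_closedBall) (k n)
    rw [ENNReal.toReal_mul, ENNReal.toReal_ofReal (by positivity), ← hv] at h1
    rw [Measure.smul_apply, smul_eq_mul, ENNReal.toReal_mul, ENNReal.toReal_ofReal (by positivity),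
      ← hV] at h2
    have e1 : Real.exp (-(N ^ d * v)) ≤ Real.exp (-b * N) := by
      refine Real.exp_le_exp.2 ?_
      have := min_le_left v 1
      nlinarith
    have e2 : Real.exp (N ^ d * V) / 2 ^ k n ≤ Real.exp (-b * N) := by
      have hNn : N ^ d = (((n + 1) ^ d : ℕ) : ℝ) := by rw [hN]; push_cast; rfl
      have h3 : Real.exp (N ^ d * V) / 2 ^ k n = (Real.exp V / 2 ^ K) ^ ((n + 1) ^ d) := by
        rw [hNn, Real.exp_nat_mul, div_pow, ← pow_mul]
      rw [h3]
      refine (pow_le_pow_left₀ (by positivity) hK _).trans ?_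
      rw [← Real.exp_nat_mul, ← hNn]
      refine Real.exp_le_exp.2 ?_
      have := min_le_right v 1
      nlinarith
    calc _ ≤ _ := measure_union_le _ _
      _ ≤ T.card * ENNReal.ofReal (Real.exp (-(N ^ d * v))) +
          ENNReal.ofReal (Real.exp (N ^ d * V) / 2 ^ k n) := add_le_add h1 h2
      _ ≤ T.card * ENNReal.ofReal (Real.exp (-b * N)) + ENNReal.ofReal (Real.exp (-b * N)) := by
          gcongr
      _ = ENNReal.ofReal (β n) := by
          simp only [hβ]
          rw [add_mul, one_mul, ENNReal.ofReal_add (by positivity) (by positivity),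
            ENNReal.ofReal_mul (by positivity), ENNReal.ofReal_natCast]
  -- the deterministic bounds
  have hgood : ∀ n η, η ∉ B n → lengthAt (cube d s) η ≤ ENNReal.ofReal (s * w n) ∧
      ((streetsAt (cube d s) η).encard : ℝ≥0∞) ≤ ENNReal.ofReal (w n) := by
    intro n η hη
    set N : ℝ := ((n + 1 : ℕ) : ℝ) with hN
    have hN1 : 1 ≤ N := by rw [hN]; exact_mod_cast Nat.le_add_left 1 n
    simp only [hB, mem_preimage, mem_union, mem_compl_iff, not_or, not_not, mem_ofPred_eq,
      not_le] at hη
    have hcov := covers_of_mem_occupied hT (hapos n) hη.1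
    rw [mul_one] at hcov
    have hcount : Config.count (Metric.closedBall (0 : Space d) (d * (N * s) + 2 * (N * s))) η ≤
        k n := by
      refine le_trans (le_of_eq ?_) hη.2.le
      rw [count_rescale (hapos n)]
      congr 1
      ext x
      rw [mem_preimage, sub_zero, mem_closedBall_zero_iff, mem_closedBall_zero_iff, norm_smul,
        norm_inv, Real.norm_of_nonneg (hapos n).le, inv_mul_le_iff₀ (hapos n), ← hN]
      constructor <;> intro h <;> linarith
    have hcube : cube d s ⊆ Metric.closedBall 0 (d * (N * s)) :=
      (cube_subset_closedBall hspos.le).trans (Metric.closedBall_subset_closedBall (by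
        have : s ≤ N * s := le_mul_of_one_le_left hspos.le hN1
        gcongr))
    have hNs : 0 < N * s := hapos n
    have hkn : ((k n : ℕ) : ℝ) ^ (d + 1) * N = K ^ (d + 1) * N ^ m := by
      rw [hk, hm]
      push_cast
      rw [← Nat.cast_succ, ← hN]
      ring
    constructor
    · refine (hcov.tsum_streetsAt_le (t := d * (N * s)) (by nlinarith) (by positivity) hcube
        hcount).trans (ENNReal.ofReal_le_ofReal (le_of_eq ?_))
      calc ((k n : ℕ) : ℝ) ^ (d + 1) * (2 * (d * (N * s) + 2 * (2 * (N * s))))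
          = s * (2 * (d + 4)) * (((k n : ℕ) : ℝ) ^ (d + 1) * N) := by ring
        _ = s * w n := by rw [hkn, hw]; ring
    · have h1 := hcov.encard_streetsAt_le (t := d * (N * s)) (by nlinarith) hcube hcount
      have h2 : ((streetsAt (cube d s) η).encard : ℝ≥0∞) ≤ ((k n ^ (d + 1) : ℕ) : ℝ≥0∞) := by
        exact_mod_cast h1
      refine h2.trans ?_
      rw [← ENNReal.ofReal_natCast]
      refine ENNReal.ofReal_le_ofReal ?_
      push_cast
      calc ((k n : ℕ) : ℝ) ^ (d + 1) ≤ ((k n : ℕ) : ℝ) ^ (d + 1) * (N * (2 * (d + 4))) := by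
            refine le_mul_of_one_le_right (by positivity) ?_
            nlinarith
        _ = (2 * (d + 4)) * (((k n : ℕ) : ℝ) ^ (d + 1) * N) := by ring
        _ = w n := by rw [hkn, hw]; ring
  constructor
  · refine (lintegral_le_of_forall_notMem hBm (w := fun n => s * w n) (β := β)
      (fun n => mul_nonneg hspos.le (hw0 n)) hβ0 (fun n η hη => (hgood n η hη).1) hBμ hlim
      (by simpa only [mul_assoc] using hsum.mul_left s)).trans (ENNReal.ofReal_le_ofReal ?_)
    simp only [mul_assoc]
    rw [tsum_mul_left, ← mul_add, mul_comm]
    exact mul_le_mul_of_nonneg_right (by linarith) hspos.le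
  · exact (lintegral_le_of_forall_notMem hBm hw0 hβ0 (fun n η hη => (hgood n η hη).2) hBμ hlim
      hsum).trans (ENNReal.ofReal_le_ofReal (by linarith))

theorem exists_le_lintegral (hd : 0 < d) : ∃ q : ℝ≥0∞, 0 < q ∧ q ≠ ∞ ∧ ∀ lamS : ℝ, 0 < lamS →
    ∀ Q : Measure (Config d),
      IsPoissonLaw (ENNReal.ofReal lamS • (volume : Measure (Space d))) Q →
      q * ENNReal.ofReal (scale d lamS) ≤ ∫⁻ η, lengthAt (cube d (scale d lamS)) η ∂Q ∧
      q ≤ ∫⁻ η, ((streetsAt (cube d (scale d lamS)) η).encard : ℝ≥0∞) ∂Q := by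
  obtain ⟨T, -, hT⟩ := exists_finset_net (d := d) 15 one_pos
  obtain ⟨q, hq, hqtop, hqQ⟩ := exists_le_measure_occupied (d := d)
    (L := ENNReal.ofReal ((1 / 28) ^ d)) ENNReal.ofReal_ne_top
    (ENNReal.ofReal_pos.2 (by positivity)).ne' T
  refine ⟨q * ENNReal.ofReal (12 / 28), ENNReal.mul_pos hq.ne'
    (ENNReal.ofReal_pos.2 (by norm_num)).ne', ENNReal.mul_ne_top hqtop ENNReal.ofReal_ne_top,
    fun lamS hlamS Q hQ => ?_⟩
  set s := scale d lamS with hs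
  have hspos : 0 < s := scale_pos d hlamS
  set c : Space d := WithLp.toLp 2 fun _ => s / 2 with hc
  have ha : 0 < 1 / 28 * s := by positivity
  have hlaw := hQ.map_rescale ha c
  rw [ofReal_mul_ofReal_scale_pow hd hlamS (1 / 28)] at hlaw
  set E : Set (Config d) := Config.rescale c _ ha ⁻¹' occupied T 1 with hE
  have hEm : MeasurableSet E := measurable_rescale' ha (measurableSet_occupied T 1)
  have hqE : q ≤ Q E := by
    rw [hE, ← Measure.map_apply (measurable_rescale' ha) (measurableSet_occupied T 1)]
    exact hqQ _ hlaw
  have hdet : ∀ η ∈ E, ENNReal.ofReal (12 / 28) * ENNReal.ofReal s ≤ lengthAt (cube d s) η := by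
    intro η hη
    have hcov := covers_of_mem_occupied hT ha hη
    rw [mul_one] at hcov
    rw [← ENNReal.ofReal_mul (by norm_num)]
    refine le_trans (ENNReal.ofReal_le_ofReal (le_of_eq (by ring)))
      (hcov.le_tsum_streetsAt hd ha (subset_trans ?_ (closedBall_subset_cube s)))
    exact Metric.closedBall_subset_closedBall (by linarith)
  have hdet' : ∀ η ∈ E, 1 ≤ ((streetsAt (cube d s) η).encard : ℝ≥0∞) := by
    intro η hη
    have hne : (streetsAt (cube d s) η).Nonempty := by
      by_contra hemp
      rw [not_nonempty_iff_eq_empty] at hemp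
      have h1 := hdet η hη
      have : IsEmpty (streetsAt (cube d s) η) := by rw [hemp]; infer_instance
      rw [lengthAt, tsum_empty] at h1
      have h2 : 0 < ENNReal.ofReal (12 / 28) * ENNReal.ofReal s := ENNReal.mul_pos
        (ENNReal.ofReal_pos.2 (by norm_num)).ne' (ENNReal.ofReal_pos.2 hspos).ne'
      exact absurd h1 (not_le.2 h2)
    exact_mod_cast one_le_encard_iff_nonempty.2 hne
  have hint : ∀ (g : Config d → ℝ≥0∞) (K : ℝ≥0∞), (∀ η ∈ E, K ≤ g η) → q * K ≤ ∫⁻ η, g η ∂Q := by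
    intro g K hg
    calc q * K ≤ K * Q E := by rw [mul_comm]; gcongr
      _ = ∫⁻ η in E, K ∂Q := (setLIntegral_const E K).symm
      _ ≤ ∫⁻ η in E, g η ∂Q := setLIntegral_mono' hEm hg
      _ ≤ ∫⁻ η, g η ∂Q := setLIntegral_le_lintegral E g
  refine ⟨?_, ?_⟩
  · rw [mul_assoc]
    exact hint _ _ hdet
  · refine le_trans ?_ (hint _ _ hdet')
    gcongr
    rw [ENNReal.ofReal_le_one]
    norm_num

/-- The mean street length is comparable to the scale of the nuclei. -/
theorem exists_meanStreetLength_bounds (hd : 0 < d) : ∃ c₁ c₂ : ℝ, 0 < c₁ ∧ 0 < c₂ ∧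
    ∀ lamS : ℝ, 0 < lamS → ∀ Q : Measure (Config d),
      IsPoissonLaw (ENNReal.ofReal lamS • (volume : Measure (Space d))) Q →
      ENNReal.ofReal (c₁ * scale d lamS) ≤ meanStreetLength lamS Q ∧
      meanStreetLength lamS Q ≤ ENNReal.ofReal (c₂ * scale d lamS) := by
  obtain ⟨C, hC, hupper⟩ := exists_lintegral_le hd
  obtain ⟨q, hq, hqtop, hlower⟩ := exists_le_lintegral hd
  have hq' : 0 < q.toReal := ENNReal.toReal_pos hq.ne' hqtop
  refine ⟨q.toReal / C, C / q.toReal, by positivity, by positivity, fun lamS hlamS Q hQ => ?_⟩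
  obtain ⟨hu1, hu2⟩ := hupper lamS hlamS Q hQ
  obtain ⟨hl1, hl2⟩ := hlower lamS hlamS Q hQ
  have hspos := scale_pos d hlamS
  have hmean : meanStreetLength lamS Q = (∫⁻ η, lengthAt (cube d (scale d lamS)) η ∂Q) /
      ∫⁻ η, ((streetsAt (cube d (scale d lamS)) η).encard : ℝ≥0∞) ∂Q := rfl
  rw [hmean]
  constructor
  · refine le_trans (le_of_eq ?_) (ENNReal.div_le_div hl1 hu2)
    rw [← ENNReal.ofReal_toReal hqtop, ← ENNReal.ofReal_mul hq'.le, ← ENNReal.ofReal_div_of_pos hC]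
    rw [ENNReal.toReal_ofReal hq'.le]
    congr 1
    ring
  · refine (ENNReal.div_le_div hu1 hl2).trans (le_of_eq ?_)
    nth_rewrite 1 [← ENNReal.ofReal_toReal hqtop]
    rw [← ENNReal.ofReal_div_of_pos hq']
    congr 1
    ring

end LineOfSight
end

noncomputable section
namespace LineOfSight

variable {d : ℕ}

/-! ### Choice of the parameters -/

theorem exists_card_mul_exp_neg_le (N : ℕ) {v : ℝ} (hv : 0 < v) {ε : ℝ≥0∞} (hε : 0 < ε) :
    ∃ x₀ : ℝ, 0 ≤ x₀ ∧ ∀ x, x₀ ≤ x → N * ENNReal.ofReal (Real.exp (-(x * v))) ≤ ε := by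
  have h1 : Filter.Tendsto (fun x : ℝ => Real.exp (-(x * v))) Filter.atTop (nhds 0) :=
    Real.tendsto_exp_neg_atTop_nhds_zero.comp (Filter.tendsto_id.atTop_mul_const hv)
  have h2 : Filter.Tendsto (fun x : ℝ => (N : ℝ≥0∞) * ENNReal.ofReal (Real.exp (-(x * v))))
      Filter.atTop (nhds 0) := by
    have := ENNReal.Tendsto.const_mul (ENNReal.tendsto_ofReal h1)
      (Or.inr (ENNReal.natCast_ne_top N))
    simpa using this
  obtain ⟨x₀, hx₀⟩ := Filter.eventually_atTop.1 (h2.eventually (gt_mem_nhds hε))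
  exact ⟨max x₀ 0, le_max_right _ _, fun x hx => (hx₀ x ((le_max_left _ _).trans hx)).le⟩

theorem exists_card_mul_one_sub_le (N : ℕ) {ε : ℝ≥0∞} (hε : 0 < ε) (hε' : ε ≠ ∞) :
    ∃ p₀ ∈ Ioo (0 : ℝ) 1, ∀ p, p₀ < p → N * ENNReal.ofReal (1 - p) ≤ ε := by
  set e := ε.toReal with he
  have hepos : 0 < e := ENNReal.toReal_pos hε.ne' hε'
  have hN : (0 : ℝ) < N + 1 := by positivity
  set δ := min (1 / 2) (e / (N + 1)) with hδ
  have hδpos : 0 < δ := lt_min (by norm_num) (by positivity)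
  have hδ1 : δ ≤ 1 / 2 := min_le_left _ _
  refine ⟨1 - δ, ⟨by linarith, by linarith⟩, fun p hp => ?_⟩
  rw [← ENNReal.ofReal_toReal hε', ← ENNReal.ofReal_natCast, ← ENNReal.ofReal_mul (by positivity)]
  refine ENNReal.ofReal_le_ofReal ?_
  calc (N : ℝ) * (1 - p) ≤ N * (e / (N + 1)) := by
        refine mul_le_mul_of_nonneg_left ?_ (by positivity)
        linarith [min_le_right (1 / 2) (e / (N + 1))]
    _ ≤ e := by
        rw [mul_div_assoc', div_le_iff₀ hN]
        nlinarith

theorem measure_irregular_le {ε : ℝ≥0∞} {Q : Measure (Config d)}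
    {T : Finset (Space d)} {r κ : ℝ} (hT : Q (occupied T 1)ᶜ ≤ ε / 2)
    (hsep : Q (closeCrossroads d (2 * r) ∪ closeStreets d (r / 8) (2 * κ)) ≤ ε / 2) :
    Q (irregular T r κ) ≤ ε :=
  (measure_union_le _ _).trans ((add_le_add hT hsep).trans_eq (ENNReal.add_halves ε))

end LineOfSight
end

open LineOfSight

theorem mainTheorem1 (d : ℕ) (hd : 2 ≤ d) (H : ℝ≥0) :
    ∃ p₀ ∈ Set.Ioo (0 : ℝ) 1, ∃ U₀ : ℝ≥0,
      ∀ p ∈ Set.Ioo p₀ 1, ∀ U : ℝ≥0, U₀ ≤ U →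
      ∀ lamS : ℝ, 0 < lamS →
      ∀ (Ω : Type*) [MeasurableSpace Ω] (P : Measure Ω) [IsProbabilityMeasure P]
        (XS X Y : Ω → LineOfSight.Config d),
        LineOfSight.IsModel P lamS
          ((U : ℝ≥0∞) / LineOfSight.meanStreetLength lamS (P.map XS)) p XS X Y →
        ∃ A : Set Ω, MeasurableSet A ∧ 0 < P A ∧
          ∀ ω ∈ A, LineOfSight.Percolates (LineOfSight.connectivityGraph
            (LineOfSight.meanStreetLength lamS (P.map XS) / (H : ℝ≥0∞)) (XS ω) (X ω) (Y ω)) := by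
  have hd0 : 0 < d := by omega
  obtain ⟨c₁, c₂, hc₁, hc₂, hmean⟩ := exists_meanStreetLength_bounds hd0
  obtain ⟨ε, hεdef⟩ : ∃ ε : ℝ≥0∞, ε = (1 / 144) ^ (3 * (21 * 21)) := ⟨_, rfl⟩
  have hε : 0 < ε := hεdef ▸ ENNReal.pow_pos (by simp) _
  have hεtop : ε ≠ ∞ := hεdef ▸ ENNReal.pow_ne_top (ENNReal.div_ne_top (by simp) (by simp))
  -- the size of the blocks
  obtain ⟨T, hT', hT⟩ := exists_finset_net (d := d) 8 one_pos
  have hvpos : 0 < (volume (Metric.ball (0 : Space d) 1)).toReal :=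
    ENNReal.toReal_pos (Metric.measure_ball_pos _ _ one_pos).ne'
      Metric.isBounded_ball.measure_lt_top.ne
  obtain ⟨x₀, -, hx₀⟩ := exists_card_mul_exp_neg_le T.card hvpos (ENNReal.half_pos hε.ne')
  obtain ⟨ρ, hρ1, hρ⟩ : ∃ ρ : ℝ, 1 ≤ ρ ∧ x₀ ≤ ρ ^ d :=
    ⟨max 1 x₀, le_max_left _ _, (le_max_right _ _).trans
      (le_self_pow₀ (le_max_left _ _) hd0.ne')⟩
  have hρ0 : 0 < ρ := by linarith
  have hH : (0 : ℝ) ≤ H := H.2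
  -- the separation of the crossroads and of the streets
  obtain ⟨r, κ, hr, hrb, hκ, hκr, hsep⟩ := exists_separation hd0
    (ENNReal.ofReal_ne_top (r := ρ ^ d)) (ENNReal.half_pos hε.ne')
    (b := min (c₁ / (3 * ρ * (H + 1))) (1 / 2)) (by positivity)
  obtain ⟨W, hW', hW⟩ := exists_finset_net (d := d) 6 (ε := κ / 4) (by positivity)
  obtain ⟨p₀, hp₀, hp₀W⟩ := exists_card_mul_one_sub_le W.card hε hεtop
  obtain ⟨y₀, hy₀, hy₀W⟩ := exists_card_mul_exp_neg_le W.card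
    (v := κ * ρ / (4 * c₂)) (by positivity) hε
  refine ⟨p₀, hp₀, ⟨y₀, hy₀⟩, fun p hp U hU lamS hlamS Ω _ P _ XS X Y h => ?_⟩
  obtain ⟨hl1, hl2⟩ := hmean lamS hlamS _ h.nuclei_law
  set l := meanStreetLength lamS (P.map XS) with hl
  have hs := scale_pos d hlamS
  set s := scale d lamS
  have ha : 0 < ρ * s := by positivity
  have hl0 : l ≠ 0 := fun h0 => by
    rw [h0, nonpos_iff_eq_zero, ENNReal.ofReal_eq_zero] at hl1
    exact absurd hl1 (not_le.2 (by positivity))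
  have hlam : (U : ℝ≥0∞) / l ≠ ∞ := ENNReal.div_ne_top ENNReal.coe_ne_top hl0
  refine h.exists_percolates hd hlam (hp₀.1.trans hp.1).le ha hκ hκr
    (hrb.trans (min_le_right _ _)) hT hT' (hW.trans (iUnion₂_mono fun g _ =>
      Metric.ball_subset_closedBall)) hW' ?_ (fun c => ?_) ?_ ?_
  · rw [ENNReal.le_div_iff_mul_le (Or.inr hl0) (Or.inl ENNReal.coe_ne_top)]
    refine le_trans ?_ hl1
    rw [← ENNReal.ofReal_coe_nnreal, ← ENNReal.ofReal_mul (by positivity)]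
    refine ENNReal.ofReal_le_ofReal ?_
    have h1 := hrb.trans (min_le_left _ _)
    rw [le_div_iff₀ (by positivity)] at h1
    calc 3 * r * (ρ * s) * H ≤ 3 * r * (ρ * s) * (H + 1) := by gcongr; linarith
      _ = r * (3 * ρ * (H + 1)) * s := by ring
      _ ≤ c₁ * s := by gcongr
  · have hlaw := h.nuclei_law.map_rescale ha c
    rw [ofReal_mul_ofReal_scale_pow hd0 hlamS ρ] at hlaw
    rw [← hεdef]
    have h1 := hlaw.measure_compl_occupied_le ENNReal.ofReal_ne_top T 1
    rw [ENNReal.toReal_mul, ENNReal.toReal_ofReal (by positivity)] at h1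
    have h2 := measure_irregular_le (h1.trans (hx₀ _ hρ)) (hsep _ hlaw)
    rwa [Measure.map_apply (measurable_rescale' ha) (measurableSet_irregular T r κ)] at h2
  · rw [← hεdef]
    refine le_trans ?_ (hy₀W U hU)
    gcongr
    rw [← ENNReal.ofReal_le_iff_le_toReal (ENNReal.mul_ne_top hlam ENNReal.ofReal_ne_top)]
    calc ENNReal.ofReal (U * (κ * ρ / (4 * c₂)))
        = ENNReal.ofReal U / ENNReal.ofReal (c₂ * s) * ENNReal.ofReal (κ * (ρ * s) / 4) := by
          rw [← ENNReal.ofReal_div_of_pos (by positivity), ← ENNReal.ofReal_mul (by positivity)]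
          congr 1
          field_simp
      _ ≤ (U : ℝ≥0∞) / l * ENNReal.ofReal (κ * (ρ * s) / 4) := by
          rw [ENNReal.ofReal_coe_nnreal]
          gcongr
  · rw [← hεdef]
    exact hp₀W p hp.1
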